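/- **Theorem (Regret of FedOSGD for Lipschitz functions).** Setting. Let $d,M,K,R\ge 1$ be integers, $T=KR$, $G,B>0$. At each step $t=0,\dots,T-1$ each machine $m\in[M]$ faces a convex, differentiable, $G$-Lipschitz cost $f_t^m:\mathbb R^d\to\mathbb R$. The costs are chosen by an adaptive, possibly randomized adversary: $f_t^m$ may depend on all earlier costs and queried points, but not on the directions $u_t^m$ drawn at step $t$. FedOSGD$(\eta,\delta)$ starts at $x_0^m=0$; at step $t$ each machine draws $u_t^m$ uniformly from the unit sphere (independently over the machines and of the history), queries and pays for $f_t^m$ at $x_t^{m,1}=x_t^m+\delta u_t^m$ and $x_t^{m,2}=x_t^m-\delta u_t^m$, and forms $g_t^m=\frac{d}{2\delta}\big(f_t^m(x_t^{m,1})-f_t^m(x_t^{m,2})\big)u_t^m$; then $x_{t+1}^m=x_t^m-\eta g_t^m$ if $K\nmid t+1$, and $x_{t+1}^m=\frac1M\sum_n (x_t^n-\eta g_t^n)$ if $K\mid t+1$. Put $$\rho(G,B,d,M,K,R)=\frac{GB}{\sqrt{KR}}+\frac{GB\sqrt d}{\sqrt{MKR}}+\mathbb 1_{K>1}\frac{GBd^{1/4}}{\sqrt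 R}.$$ (1) *Regret.* There is a numerical constant $c>0$ such that, for $$\eta=\frac{B}{G\sqrt{KR}}\min\Big\{1,\frac{\sqrt M}{\sqrt d},\frac{1}{\mathbb 1_{K>1}\sqrt K d^{1/4}}\Big\}$$ (the last entry is $\infty$ if $K=1$) and every $\delta$ with $0<G\delta\le\rho(G,B,d,M,K,R)$ (for instance $\delta=\frac{Bd^{1/4}}{\sqrt R}\big(\mathbb 1_{K>1}+\frac{d^{1/4}}{\sqrt{MK}}\big)$), the queried points satisfy $$\mathbb E\Big[\frac1{2MKR}\sum_{t<KR,\,m\in[M],\,j\in\{1,2\}}\big(f_t^m(x_t^{m,j})-f_t^m(x^\star)\big)\Big]\le c\,\rho(G,B,d,M,K,R),$$ where $x^\star\in\arg\min_{\|x\|_2\le B}\sum_{t<KR}\sum_{m} f_t^m(x)$ (depending on the realized costs), and the random variable in the expectation is integrable. (2) *Optimality for $K=1$.* There is a numerical constant $c>0$ such that, for all $d,M,R\ge1$ and $G,B>0$ and for every randomized algorithm with two-point feedback in which the machines communicate after every step, there are non-negative, convex, differentiable, $G$-Lipschitz costs $f_t^m$, fixed in advance, for which the expected average cost at the queried points exceeds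 $\min_{\|x\|_2\le B}\frac1{MR}\sum_{t<R,m}f_t^m(x)$ by at least $c\,\min\{GB,\rho(G,B,d,M,1,R)\}$. (3) *Non-collaborative baseline.* Suppose that every machine runs $x_{t+1}^m=x_t^m-\eta g_t^m$, $x^m_0=0$, for $T$ steps without communication, with $\eta=\frac{B}{G\sqrt{dT}}$ and $0<\delta\le B\sqrt d/\sqrt T$. Then its expected average regret (as in (1), and again well defined) is at most $c\,GB\sqrt d/\sqrt{T}$ for a numerical constant $c$. (4) *Comparison.* If $a>0$ and $K^2\le a\,d$, then $$\rho(G,B,d,M,K,R)\le\Big(\frac1{\sqrt d}+\frac1{\sqrt M}+a^{1/4}\Big)\frac{GB\sqrt d}{\sqrt{KR}},$$ so the guarantee in (1) is then of at most the order of the guarantee in (3) with $T=KR$, and smaller by the displayed factor. -/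

import Mathlib

open MeasureTheory ProbabilityTheory

noncomputable section

/-- The decision space `ℝ^d` with the Euclidean norm. -/
abbrev Vec (d : ℕ) : Type := EuclideanSpace ℝ (Fin d)

/-- The admissible cost functions: convex, differentiable and `G`-Lipschitz on `ℝ^d`. -/
structure IsCost {d : ℕ} (G : ℝ) (φ : Vec d → ℝ) : Prop where
  convex : ConvexOn ℝ Set.univ φ
  differentiable : Differentiable ℝ φ
  lipschitz : ∀ x y, |φ x - φ y| ≤ G * ‖x - y‖

/-- The uniform distribution on the Euclidean unit sphere of `ℝ^d` (`d ≥ 1`): the normalized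
surface measure, regarded as a measure on `ℝ^d`. -/
def uniformSphere (d : ℕ) : Measure (Vec d) :=
  ((volume : Measure (Vec d)).toSphere Set.univ)⁻¹ •
    ((volume : Measure (Vec d)).toSphere).map Subtype.val

/-- The two-point gradient estimate `d (φ(x + δ v) - φ(x - δ v)) v / (2 δ)`. -/
def twoPointGrad {d : ℕ} (δ : ℝ) (φ : Vec d → ℝ) (x v : Vec d) : Vec d :=
  ((d : ℝ) * (φ (x + δ • v) - φ (x - δ • v)) / (2 * δ)) • v

/-- The iterates `x_t^m` of FedOSGD with step size `η`, query radius `δ` and averaging of the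
local models after every `K` steps, along the realized cost functions `φ t m` and the realized
directions `v t m`. -/
def fedIterate {d M : ℕ} (K : ℕ) (η δ : ℝ) (φ : ℕ → Fin M → Vec d → ℝ)
    (v : ℕ → Fin M → Vec d) : ℕ → Fin M → Vec d
  | 0 => fun _ => 0
  | t + 1 => fun m =>
      if (t + 1) % K = 0 then
        (M : ℝ)⁻¹ • ∑ n : Fin M, (fedIterate K η δ φ v t n -
          η • twoPointGrad δ (φ t n) (fedIterate K η δ φ v t n) (v t n))
      else
        fedIterate K η δ φ v t m -
          η • twoPointGrad δ (φ t m) (fedIterate K η δ φ v t m) (v t m)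

/-- The iterates of the non-collaborative baseline: every machine runs online gradient descent
with the two-point gradient estimate on its own, without any communication. -/
def ncIterate {d M : ℕ} (η δ : ℝ) (φ : ℕ → Fin M → Vec d → ℝ)
    (v : ℕ → Fin M → Vec d) : ℕ → Fin M → Vec d
  | 0 => fun _ => 0
  | t + 1 => fun m => ncIterate η δ φ v t m -
      η • twoPointGrad δ (φ t m) (ncIterate η δ φ v t m) (v t m)

/-- The average regret over `T` steps and `M` machines, against the fixed comparator `y`, at the
two queried points `x_t^m + δ v_t^m` and `x_t^m - δ v_t^m`. -/
def avgRegret {d M : ℕ} (T : ℕ) (δ : ℝ) (φ : ℕ → Fin M → Vec d → ℝ)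
    (v x : ℕ → Fin M → Vec d) (y : Vec d) : ℝ :=
  (1 / (2 * (M : ℝ) * (T : ℝ))) * ∑ t ∈ Finset.range T, ∑ m : Fin M,
    ((φ t m (x t m + δ • v t m) - φ t m y) + (φ t m (x t m - δ • v t m) - φ t m y))

/-- `y` minimizes the total cost `∑_{t<T} ∑_m φ t m` over the closed ball of radius `B`. -/
def IsBestInBall {d M : ℕ} (T : ℕ) (B : ℝ) (φ : ℕ → Fin M → Vec d → ℝ) (y : Vec d) : Prop :=
  ‖y‖ ≤ B ∧ ∀ z : Vec d, ‖z‖ ≤ B →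
    ∑ t ∈ Finset.range T, ∑ m : Fin M, φ t m y ≤ ∑ t ∈ Finset.range T, ∑ m : Fin M, φ t m z

section Game

variable {Ω : Type*} [MeasurableSpace Ω] {d M : ℕ}

/-- Everything that has happened when the directions of step `t` are drawn: the cost functions up
to and including step `t`, and the directions drawn before step `t`. As
`v = ((x + δ v) - (x - δ v)) / (2 δ)` and the iterates are functions of past costs and
directions, this is the information in the past queried points and in the costs. -/
@[reducible]
def history (f : ℕ → Fin M → Ω → Vec d → ℝ) (u : ℕ → Fin M → Ω → Vec d) (t : ℕ) :
    MeasurableSpace Ω :=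
  (⨆ s ∈ Finset.range (t + 1), ⨆ m : Fin M, ⨆ x : Vec d,
      MeasurableSpace.comap (fun ω => f s m ω x) inferInstance) ⊔
    ⨆ s ∈ Finset.range t, ⨆ m : Fin M, MeasurableSpace.comap (u s m) inferInstance

/-- The interaction over `T` steps with an adaptive (possibly randomized) adversary. The costs
`f t m` may depend in any way on the past and on extra randomness of the adversary; the
directions `u t m` are uniform on the sphere, independent over the machines and independent of
the history, which contains the costs of the current step. -/
structure IsAdaptiveGame (P : Measure Ω) (G : ℝ) (T : ℕ)
    (f : ℕ → Fin M → Ω → Vec d → ℝ) (u : ℕ → Fin M → Ω → Vec d) : Prop where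
  cost : ∀ t < T, ∀ m ω, IsCost G (f t m ω)
  measurable_cost : ∀ t < T, ∀ m x, Measurable fun ω => f t m ω x
  measurable_dir : ∀ t < T, ∀ m, Measurable (u t m)
  law_dir : ∀ t < T, ∀ m, P.map (u t m) = uniformSphere d
  indep_machines : ∀ t < T, iIndepFun (fun m => u t m) P
  indep_history : ∀ t < T,
    Indep (⨆ m : Fin M, MeasurableSpace.comap (u t m) inferInstance) (history f u t) P

end Game

/-- `GB/√(KR) + GB√d/√(MKR) + 1_{K>1} GB d^{1/4}/√R`. -/
def fedRate (G B : ℝ) (d M K R : ℕ) : ℝ :=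
  G * B / √((K : ℝ) * R) + G * B * √(d : ℝ) / √((M : ℝ) * K * R) +
    if 1 < K then G * B * (d : ℝ) ^ (1 / 4 : ℝ) / √(R : ℝ) else 0

/-- `GB√d/√T`, the rate of the non-collaborative baseline. -/
def ncRate (G B : ℝ) (d T : ℕ) : ℝ := G * B * √(d : ℝ) / √(T : ℝ)

/-- `B/(G√(KR)) · min {1, √M/√d, 1/(1_{K>1} √K d^{1/4})}`, the last entry being `∞` if
`K = 1`. -/
def fedStep (G B : ℝ) (d M K R : ℕ) : ℝ :=
  B / (G * √((K : ℝ) * R)) *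
    if 1 < K then min (min 1 (√(M : ℝ) / √(d : ℝ))) (1 / (√(K : ℝ) * (d : ℝ) ^ (1 / 4 : ℝ)))
    else min 1 (√(M : ℝ) / √(d : ℝ))

/-- A randomized algorithm with two-point feedback and intermittent communication every `K`
steps, with seeds in `S`. At step `t`, machine `m` chooses its two query points from the seed and
from the oracle answers it knows: its own ones of all earlier steps, and those of all machines up
to the last communication. (The earlier query points are functions of seed and answers. The seed
may be shared by the machines.) -/
structure TwoPointAlgorithm (S : Type*) [MeasurableSpace S] (d M K : ℕ) where
  query : ℕ → Fin M → S → (ℕ → Fin M → ℝ × ℝ) → Vec d × Vec d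
  measurable_query : ∀ t m, Measurable fun p : S × (ℕ → Fin M → ℝ × ℝ) => query t m p.1 p.2
  query_congr : ∀ t m ω h h',
    (∀ s n, s < t → (n = m ∨ s < K * (t / K)) → h s n = h' s n) →
      query t m ω h = query t m ω h'

namespace TwoPointAlgorithm

variable {S : Type*} [MeasurableSpace S] {d M K : ℕ}

/-- The oracle answers of the steps before `t` (later entries are `0`) when the algorithm with
seed `ω` plays against the costs `φ`. -/
def answers (A : TwoPointAlgorithm S d M K) (φ : ℕ → Fin M → Vec d → ℝ) (ω : S) :
    ℕ → ℕ → Fin M → ℝ × ℝ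
  | 0 => fun _ _ => (0, 0)
  | t + 1 => Function.update (answers A φ ω t) t fun m =>
      (φ t m (A.query t m ω (answers A φ ω t)).1, φ t m (A.query t m ω (answers A φ ω t)).2)

/-- The average cost over `T` steps and `M` machines at the two queried points. -/
def avgCost (A : TwoPointAlgorithm S d M K) (T : ℕ) (φ : ℕ → Fin M → Vec d → ℝ) (ω : S) : ℝ :=
  (1 / (2 * (M : ℝ) * (T : ℝ))) * ∑ t ∈ Finset.range T, ∑ m : Fin M,
    (φ t m (A.query t m ω (A.answers φ ω t)).1 + φ t m (A.query t m ω (A.answers φ ω t)).2)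

end TwoPointAlgorithm

end

/-! Upper bounds. Two facts about the two-point estimate carry them: its mean is an approximate
subgradient of norm at most `G`, and its second moment is of order `d G²` instead of the trivial `d²
G²`. For the mean, invariance of the uniform law under the reflection in the hyperplane orthogonal
to `w` writes the inner product of `w` with the mean as an average of increments of the cost between
mirror points, which differ by a multiple of `w` (`inner_meanGrad`). The Lipschitz condition on
these increments gives the norm bound (`norm_meanGrad_le`), and convexity along `w` gives the
subgradient inequality with error `2 G δ` (`sub_le_inner_meanGrad`). Neither gradients nor a
smoothed cost appear. For the second moment, the antipodal difference is an odd Lipschitz function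
of the direction. Extended homogeneously of degree one, it obeys a Gaussian Poincaré inequality,
proved by rotating a pair of independent Gaussian vectors through a half turn
(`integral_sq_le_of_odd_lipschitz`, `integral_antipodal_sq_le`).

Each direction is independent of the history together with the simultaneous directions of the other
machines, so the errors of the estimates are pairwise orthogonal over steps and machines
(`integral_inner_noise_noise`). The average of the machines performs exact gradient descent with the
averaged estimate, whose error has second moment of order `d G² / M`. The comparator may depend on
all the randomness; its product with the summed errors is bounded by `B` times the norm of the sum
(`exists_regret_bound`). Playing the local points instead of their average costs `G` times their
distance, which comes from at most `K - 1` local steps (`integral_norm_sub_average_le`) and produces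
the third term of the rate. The baseline is the same argument without averaging, one machine at a
time.

Lower bound. It suffices to find random costs on which every deterministic algorithm does badly
against a random comparator (`exists_hard_costs`). The costs are linear, with a penalty outside the
ball that keeps them nonnegative and makes far queries useless. Dimension term: the cost vectors are
independent noise blocks plus `ε` times a hidden vector, all up to scale. Since the answers see a
block only through its sum with the shifted hidden vector, integration by parts turns the
correlation of a query with the hidden vector into `ε` times a sum of scores of the blocks. Only the
projection of each score onto the two queried directions matters. These projections are orthogonal
random vectors with second moments at most 20, so the sum has size of order `√(RM)` whatever the
dimension (`abs_integral_inner_hidden_le`), while the comparator, minus the rescaled hidden vector,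
gains in proportion to `√d`. This allows `ε` of order `min {1, √d/√(RM)}`. Horizon term: one random
coefficient per step along a fixed axis, common to all machines. The comparator is the imaginary
part of a Riesz product, bounded by 2 and correlated with each coefficient at order `1/√R`. -/

noncomputable section

/-! ### The uniform law on the sphere as the direction of a Gaussian vector -/

open Metric Set in
/-- A measure with a radial density has independent radial and spherical parts, and the
spherical part is uniformly distributed. -/
theorem measure_radial_inter {d : ℕ} (hd : 1 ≤ d) {ρ : ℝ → ENNReal} (hρ : Measurable ρ)
    {A : Set (Vec d)} (hA : MeasurableSet A) {s : Set ℝ} (hs : MeasurableSet s) :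
    (volume.withDensity fun x : Vec d => ρ ‖x‖) {x | ‖x‖⁻¹ • x ∈ A ∧ ‖x‖ ∈ s} =
      uniformSphere d A * (volume.withDensity fun x : Vec d => ρ ‖x‖) {x | ‖x‖ ∈ s} := by
  have : Nontrivial (Vec d) := by
    have : NeZero d := ⟨by omega⟩
    infer_instance
  set τ := (volume : Measure (Vec d)).toSphere with hτ
  set r := Measure.volumeIoiPow (Module.finrank ℝ (Vec d) - 1) with hr
  set c : ENNReal := ∫⁻ y : Ioi (0 : ℝ), s.indicator ρ y ∂r with hc
  have key : ∀ A : Set (Vec d), MeasurableSet A →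
      (volume.withDensity fun x : Vec d => ρ ‖x‖) {x | ‖x‖⁻¹ • x ∈ A ∧ ‖x‖ ∈ s} =
        τ (Subtype.val ⁻¹' A) * c := by
    intro A hA
    have hm : MeasurableSet {x : Vec d | ‖x‖⁻¹ • x ∈ A ∧ ‖x‖ ∈ s} :=
      ((measurable_norm.inv.smul measurable_id) hA).inter (measurable_norm hs)
    rw [withDensity_apply _ hm, ← lintegral_indicator hm]
    have h1 : ∀ x : Vec d, {x : Vec d | ‖x‖⁻¹ • x ∈ A ∧ ‖x‖ ∈ s}.indicator
        (fun x => ρ ‖x‖) x = A.indicator 1 (‖x‖⁻¹ • x) * s.indicator ρ ‖x‖ := by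
      intro x
      by_cases h1 : ‖x‖⁻¹ • x ∈ A <;> by_cases h2 : ‖x‖ ∈ s <;> simp [indicator, h1, h2]
    simp_rw [h1]
    -- Polar coordinates parametrize only the complement of the origin, which carries all the mass.
    rw [← lintegral_add_compl _ (measurableSet_singleton (0 : Vec d)),
      Measure.restrict_singleton, measure_singleton, zero_smul, lintegral_zero_measure, zero_add,
      ← lintegral_subtype_comap (measurableSet_singleton (0 : Vec d)).compl]
    have h2 := (volume : Measure (Vec d)).measurePreserving_homeomorphUnitSphereProd.lintegral_comp_emb
      (Homeomorph.measurableEmbedding _)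
      (fun p => A.indicator 1 (p.1 : Vec d) * s.indicator ρ (p.2 : ℝ))
    simp only [homeomorphUnitSphereProd_apply_fst_coe,
      homeomorphUnitSphereProd_apply_snd_coe] at h2
    rw [h2, lintegral_prod_mul (f := fun p : sphere (0 : Vec d) 1 => A.indicator 1 (p : Vec d))
      (g := fun p : Ioi (0 : ℝ) => s.indicator ρ (p : ℝ))
      ((measurable_one.indicator hA).comp measurable_subtype_coe).aemeasurable
      ((hρ.indicator hs).comp measurable_subtype_coe).aemeasurable]
    congr 1
    rw [← lintegral_indicator_one (measurable_subtype_coe hA)]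
    rfl
  have huniv := key univ .univ
  simp only [mem_univ, true_and, preimage_univ] at huniv
  rw [key A hA, huniv, uniformSphere, Measure.smul_apply, Measure.map_apply measurable_subtype_coe hA,
    smul_eq_mul]
  have h0 : τ univ ≠ 0 := by
    rw [Measure.measure_univ_ne_zero]
    exact Measure.toSphere_ne_zero _
  have h3 : τ univ ≠ ⊤ := measure_ne_top _ _
  rw [show (τ univ)⁻¹ * τ (Subtype.val ⁻¹' A) * (τ univ * c)
    = ((τ univ)⁻¹ * τ univ) * (τ (Subtype.val ⁻¹' A) * c) by ring, ENNReal.inv_mul_cancel h0 h3,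
    one_mul]

open Metric in
instance isProbabilityMeasure_uniformSphere (d : ℕ) [NeZero d] :
    IsProbabilityMeasure (uniformSphere d) := by
  have : Nontrivial (Vec d) := inferInstance
  constructor
  rw [uniformSphere, Measure.smul_apply, Measure.map_apply measurable_subtype_coe .univ,
    Set.preimage_univ, smul_eq_mul]
  exact ENNReal.inv_mul_cancel (Measure.measure_univ_ne_zero.2 (Measure.toSphere_ne_zero _))
    (measure_ne_top _ _)

theorem ae_norm_uniformSphere (d : ℕ) : ∀ᵐ v ∂uniformSphere d, ‖v‖ = 1 := by
  have h : ∀ᵐ v ∂((volume : Measure (Vec d)).toSphere).map Subtype.val, ‖v‖ = 1 := by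
    rw [ae_map_iff measurable_subtype_coe.aemeasurable
      (measurableSet_eq_fun measurable_norm measurable_const)]
    exact .of_forall fun v => by simp
  exact (Measure.ae_smul_measure h _)

open Set in
/-- The product of measures with integrable densities on the line has the product density. -/
theorem pi_withDensity_ofReal {ι : Type*} [Fintype ι] {p : ι → ℝ → ℝ}
    (hp : ∀ i, Integrable (p i)) (h0 : ∀ i x, 0 ≤ p i x) :
    Measure.pi (fun i => (volume : Measure ℝ).withDensity fun x => ENNReal.ofReal (p i x)) =
      (volume : Measure (ι → ℝ)).withDensity fun x => ENNReal.ofReal (∏ i, p i (x i)) := by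
  have : ∀ i, IsFiniteMeasure ((volume : Measure ℝ).withDensity fun x => ENNReal.ofReal (p i x)) :=
    fun i => isFiniteMeasure_withDensity_ofReal (hp i).2
  refine Measure.pi_eq fun s hs => ?_
  rw [withDensity_apply _ (MeasurableSet.univ_pi hs), ← lintegral_indicator (MeasurableSet.univ_pi hs)]
  have h1 : ∀ x : ι → ℝ, (univ.pi s).indicator (fun x => ENNReal.ofReal (∏ i, p i (x i))) x =
      ENNReal.ofReal (∏ i, (s i).indicator (p i) (x i)) := by
    intro x
    by_cases hx : x ∈ univ.pi s
    · rw [indicator_of_mem hx]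
      congr 1
      exact Finset.prod_congr rfl fun i _ => (indicator_of_mem (hx i (mem_univ _)) _).symm
    · rw [indicator_of_notMem hx]
      simp only [mem_pi, mem_univ, true_implies, not_forall] at hx
      obtain ⟨i, hi⟩ := hx
      rw [Finset.prod_eq_zero (Finset.mem_univ i) (indicator_of_notMem hi _), ENNReal.ofReal_zero]
  simp_rw [h1]
  have hint : ∀ i, Integrable ((s i).indicator (p i)) := fun i => (hp i).indicator (hs i)
  have hpos : ∀ i x, 0 ≤ (s i).indicator (p i) x := fun i x => indicator_nonneg (fun _ _ => h0 i _) _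
  rw [← ofReal_integral_eq_lintegral_ofReal (by rw [volume_pi]; exact Integrable.fintype_prod_dep hint)
    (.of_forall fun x => Finset.prod_nonneg fun i _ => hpos i _)]
  rw [integral_fintype_prod_volume_eq_prod, ENNReal.ofReal_prod_of_nonneg
    fun i _ => integral_nonneg (hpos i)]
  refine Finset.prod_congr rfl fun i _ => ?_
  rw [ofReal_integral_eq_lintegral_ofReal (hint i) (.of_forall (hpos i)),
    withDensity_apply _ (hs i), ← lintegral_indicator (hs i)]
  refine lintegral_congr fun x => ?_
  by_cases hx : x ∈ s i <;> simp [hx]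

theorem stdGaussian_eq_withDensity_norm (d : ℕ) :
    stdGaussian (Vec d) = volume.withDensity fun x : Vec d =>
      ENNReal.ofReal ((√(2 * Real.pi))⁻¹ ^ d * Real.exp (-‖x‖ ^ 2 / 2)) := by
  rw [← map_pi_eq_stdGaussian]
  have h1 : (gaussianReal 0 1) =
      (volume : Measure ℝ).withDensity fun x => ENNReal.ofReal (gaussianPDFReal 0 1 x) := by
    rw [gaussianReal_of_var_ne_zero _ one_ne_zero]; rfl
  rw [h1, pi_withDensity_ofReal (fun _ => integrable_gaussianPDFReal 0 1)
    (fun _ => gaussianPDFReal_nonneg 0 1)]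
  have h2 := (PiLp.volume_preserving_toLp (Fin d))
  ext A hA
  rw [Measure.map_apply h2.measurable hA, withDensity_apply _ (h2.measurable hA),
    withDensity_apply _ hA, ← lintegral_indicator hA, ← h2.lintegral_comp
      (Measurable.indicator (by fun_prop) hA), ← lintegral_indicator (h2.measurable hA)]
  refine lintegral_congr fun x => ?_
  by_cases hx : WithLp.toLp 2 x ∈ A
  · rw [Set.indicator_of_mem (by exact hx), Set.indicator_of_mem hx]
    congr 1
    simp only [gaussianPDFReal, sub_zero, NNReal.coe_one, mul_one]
    rw [Finset.prod_mul_distrib, Finset.prod_const, Finset.card_univ, Fintype.card_fin,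
      ← Real.exp_sum, EuclideanSpace.real_norm_sq_eq]
    simp [Finset.sum_div, neg_div]
  · rw [Set.indicator_of_notMem (by exact hx), Set.indicator_of_notMem hx]

/-- The Gaussian density is radial, so direction and length are independent. Every integral over the
sphere below is computed by passing to a Gaussian integral this way. -/
theorem map_normalize_norm_stdGaussian {d : ℕ} (hd : 1 ≤ d) :
    (stdGaussian (Vec d)).map (fun x => (‖x‖⁻¹ • x, ‖x‖)) =
      (uniformSphere d).prod ((stdGaussian (Vec d)).map norm) := by
  have : NeZero d := ⟨by omega⟩
  have : IsProbabilityMeasure ((stdGaussian (Vec d)).map norm) :=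
    Measure.isProbabilityMeasure_map measurable_norm.aemeasurable
  refine (Measure.prod_eq fun A s hA hs => ?_).symm
  have hm : Measurable fun x : Vec d => (‖x‖⁻¹ • x, ‖x‖) :=
    (measurable_norm.inv.smul measurable_id).prodMk measurable_norm
  rw [Measure.map_apply hm (hA.prod hs), Measure.map_apply measurable_norm hs,
    stdGaussian_eq_withDensity_norm]
  exact measure_radial_inter hd (ρ := fun r => ENNReal.ofReal
    ((√(2 * Real.pi))⁻¹ ^ d * Real.exp (-r ^ 2 / 2))) (by fun_prop) hA hs

theorem map_normalize_stdGaussian {d : ℕ} (hd : 1 ≤ d) :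
    (stdGaussian (Vec d)).map (fun x => ‖x‖⁻¹ • x) = uniformSphere d := by
  have : IsProbabilityMeasure ((stdGaussian (Vec d)).map norm) :=
    Measure.isProbabilityMeasure_map measurable_norm.aemeasurable
  have hm : Measurable fun x : Vec d => (‖x‖⁻¹ • x, ‖x‖) :=
    (measurable_norm.inv.smul measurable_id).prodMk measurable_norm
  have := congrArg (Measure.map Prod.fst) (map_normalize_norm_stdGaussian hd)
  rwa [Measure.map_map measurable_fst hm, Measure.map_fst_prod, measure_univ, one_smul] at this

/-- Normalization commutes with linear isometries, so the invariance is inherited from the Gaussian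
law. -/
theorem uniformSphere_map_isometry {d : ℕ} (hd : 1 ≤ d) (e : Vec d ≃ₗᵢ[ℝ] Vec d) :
    (uniformSphere d).map e = uniformSphere d := by
  have hm : Measurable fun x : Vec d => ‖x‖⁻¹ • x := measurable_norm.inv.smul measurable_id
  rw [← map_normalize_stdGaussian hd, Measure.map_map e.continuous.measurable hm]
  conv_rhs => rw [← stdGaussian_map e, Measure.map_map hm e.continuous.measurable]
  congr 1
  ext1 x
  simp

theorem integral_uniformSphere_comp_isometry {d : ℕ} (hd : 1 ≤ d) (e : Vec d ≃ₗᵢ[ℝ] Vec d)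
    {F : Type*} [NormedAddCommGroup F] [NormedSpace ℝ F] (f : Vec d → F) :
    ∫ v, f (e v) ∂uniformSphere d = ∫ v, f v ∂uniformSphere d := by
  have h : MeasurePreserving e (uniformSphere d) (uniformSphere d) :=
    ⟨e.continuous.measurable, uniformSphere_map_isometry hd e⟩
  exact h.integral_comp e.toHomeomorph.measurableEmbedding f

/-- For `H` on the sphere, extended homogeneously of degree two. -/
theorem integral_normSq_mul_stdGaussian {d : ℕ} (hd : 1 ≤ d) {H : Vec d → ℝ} (hH : Measurable H) :
    ∫ x, ‖x‖ ^ 2 * H (‖x‖⁻¹ • x) ∂stdGaussian (Vec d) =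
      (∫ x, ‖x‖ ^ 2 ∂stdGaussian (Vec d)) * ∫ v, H v ∂uniformSphere d := by
  have : NeZero d := ⟨by omega⟩
  have : IsProbabilityMeasure ((stdGaussian (Vec d)).map norm) :=
    Measure.isProbabilityMeasure_map measurable_norm.aemeasurable
  have hm : Measurable fun x : Vec d => (‖x‖⁻¹ • x, ‖x‖) :=
    (measurable_norm.inv.smul measurable_id).prodMk measurable_norm
  have h := integral_prod_mul (μ := uniformSphere d) (ν := (stdGaussian (Vec d)).map norm)
    H (fun r => r ^ 2)
  rw [← map_normalize_norm_stdGaussian hd, integral_map hm.aemeasurable (by fun_prop),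
    integral_map measurable_norm.aemeasurable (by fun_prop), mul_comm] at h
  rw [← h]
  simp_rw [mul_comm]

theorem integral_inner_sq_stdGaussian {d : ℕ} (a : Vec d) :
    ∫ x, inner ℝ a x ^ 2 ∂stdGaussian (Vec d) = ‖a‖ ^ 2 := by
  have h := variance_dual_stdGaussian (innerSL ℝ a)
  rw [variance_of_integral_eq_zero (innerSL ℝ a).continuous.aemeasurable
    (integral_strongDual_stdGaussian _), innerSL_apply_norm] at h
  simpa using h

theorem integrable_normSq_stdGaussian (d : ℕ) :
    Integrable (fun x => ‖x‖ ^ 2) (stdGaussian (Vec d)) := by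
  have h : MemLp id 2 (stdGaussian (Vec d)) := IsGaussian.memLp_two_id
  exact h.integrable_norm_pow two_ne_zero

theorem integral_normSq_stdGaussian (d : ℕ) :
    ∫ x, ‖x‖ ^ 2 ∂stdGaussian (Vec d) = d := by
  have h : ∀ x : Vec d, ‖x‖ ^ 2 = ∑ i, inner ℝ (EuclideanSpace.single i (1 : ℝ)) x ^ 2 := by
    intro x
    rw [EuclideanSpace.real_norm_sq_eq]
    simp [EuclideanSpace.inner_single_left]
  simp_rw [h]
  rw [integral_finsetSum]
  · simp_rw [integral_inner_sq_stdGaussian]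
    simp
  · intro i _
    refine (integrable_normSq_stdGaussian d).mono' (by fun_prop) (.of_forall fun x => ?_)
    have h1 := abs_real_inner_le_norm (EuclideanSpace.single i (1 : ℝ)) x
    rw [Real.norm_eq_abs, abs_pow]
    have h2 : ‖EuclideanSpace.single i (1 : ℝ)‖ = 1 := by simp
    rw [h2, one_mul] at h1
    gcongr

/-- The integrand is homogeneous of degree two, so it is the Gaussian second moment `‖a‖ ^ 2`
divided by the mean squared length `d`. -/
theorem integral_inner_sq_uniformSphere {d : ℕ} (hd : 1 ≤ d) (a : Vec d) :
    ∫ v, inner ℝ a v ^ 2 ∂uniformSphere d = ‖a‖ ^ 2 / d := by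
  have h := integral_normSq_mul_stdGaussian hd (H := fun v => inner ℝ a v ^ 2) (by fun_prop)
  rw [integral_normSq_stdGaussian] at h
  have h2 : ∀ x : Vec d, ‖x‖ ^ 2 * inner ℝ a (‖x‖⁻¹ • x) ^ 2 = inner ℝ a x ^ 2 := by
    intro x
    by_cases hx : x = 0
    · simp [hx]
    · have : ‖x‖ ≠ 0 := by simpa
      rw [inner_smul_right]
      field_simp
  simp_rw [h2, integral_inner_sq_stdGaussian] at h
  have : (d : ℝ) ≠ 0 := by positivity
  field_simp
  linarith

/-! ### A Gaussian Poincaré inequality by rotation -/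

open Filter Topology in
/-- A Poincaré inequality for odd Lipschitz functions under the standard Gaussian measure. -/
theorem integral_sq_le_of_odd_lipschitz {d : ℕ} {F : Vec d → ℝ} {L : ℝ} (hL : 0 ≤ L)
    (hF : ∀ x y, |F x - F y| ≤ L * ‖x - y‖) (hodd : ∀ x, F (-x) = -F x)
    (hdiff : ∀ᵐ x ∂stdGaussian (Vec d), DifferentiableAt ℝ F x) :
    ∫ x, F x ^ 2 ∂stdGaussian (Vec d) ≤ Real.pi ^ 2 / 4 * L ^ 2 := by
  set γ := stdGaussian (Vec d) with hγ
  have hlip : LipschitzWith L.toNNReal F := by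
    refine LipschitzWith.of_dist_le_mul fun x y => ?_
    rw [Real.dist_eq, dist_eq_norm, Real.coe_toNNReal _ hL]
    exact hF x y
  have hcont : Continuous F := hlip.continuous
  have hsq : Integrable (fun p : Vec d × Vec d => (2 * ‖p.1‖ + ‖p.2‖) ^ 2) (γ.prod γ) := by
    have h1 : Integrable (fun p : Vec d × Vec d => 8 * ‖p.1‖ ^ 2 + 2 * ‖p.2‖ ^ 2) (γ.prod γ) :=
      (((integrable_normSq_stdGaussian d).comp_fst γ).const_mul 8).add
        (((integrable_normSq_stdGaussian d).comp_snd γ).const_mul 2)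
    refine h1.mono' (by fun_prop) (.of_forall fun p => ?_)
    rw [Real.norm_of_nonneg (by positivity)]
    nlinarith [sq_nonneg (2 * ‖p.1‖ - ‖p.2‖)]
  -- A pair of independent standard Gaussian vectors has a rotation-invariant law, so all small
  -- rotation steps contribute equally.
  have hrot : ∀ θ : ℝ, (γ.prod γ).map (ContinuousLinearMap.rotation θ) = γ.prod γ := fun θ =>
    IsGaussian.map_rotation_eq_self (by simpa using integral_id_stdGaussian) θ
  -- one small rotation
  let a : ℝ → Vec d × Vec d → ℝ := fun ε p => F p.1 - F (Real.cos ε • p.1 + Real.sin ε • p.2)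
  have ha_cont : ∀ ε, Continuous (a ε) := fun ε => by fun_prop
  have ha_bound : ∀ ε, 0 ≤ ε → ε ≤ Real.pi → ∀ p, |a ε p| ≤ L * (ε * (2 * ‖p.1‖ + ‖p.2‖)) := by
    intro ε h0 h1 p
    refine (hF _ _).trans (mul_le_mul_of_nonneg_left ?_ hL)
    have h2 : p.1 - (Real.cos ε • p.1 + Real.sin ε • p.2) =
        (1 - Real.cos ε) • p.1 - Real.sin ε • p.2 := by module
    rw [h2]
    refine (norm_sub_le _ _).trans ?_
    rw [norm_smul, norm_smul, Real.norm_eq_abs, Real.norm_eq_abs,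
      abs_of_nonneg (by linarith [Real.cos_le_one ε])]
    -- From `1 - cos ε ≤ ε²/2` and `ε ≤ π ≤ 4`. A bound linear in `ε` is all that domination needs.
    have h3 : 1 - Real.cos ε ≤ 2 * ε := by
      have := Real.one_sub_sq_div_two_le_cos (x := ε)
      nlinarith [Real.pi_le_four]
    have h4 : |Real.sin ε| ≤ ε := (Real.abs_sin_le_abs (x := ε)).trans_eq (abs_of_nonneg h0)
    nlinarith [norm_nonneg p.1, norm_nonneg p.2]
  have ha_int : ∀ ε, 0 ≤ ε → ε ≤ Real.pi → Integrable (fun p => a ε p ^ 2) (γ.prod γ) := by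
    intro ε h0 h1
    refine (hsq.const_mul (L ^ 2 * ε ^ 2)).mono' ((ha_cont ε).pow 2).aestronglyMeasurable
      (.of_forall fun p => ?_)
    have := ha_bound ε h0 h1 p
    rw [Real.norm_eq_abs, abs_pow]
    calc |a ε p| ^ 2 ≤ (L * (ε * (2 * ‖p.1‖ + ‖p.2‖))) ^ 2 := by gcongr
      _ = _ := by ring
  have htel : ∀ N : ℕ, 1 ≤ N → 4 * ∫ x, F x ^ 2 ∂γ ≤
      ∫ p, ((N : ℝ) * a (Real.pi / N) p) ^ 2 ∂(γ.prod γ) := by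
    intro N hN
    have hN0 : (N : ℝ) ≠ 0 := by positivity
    set ε := Real.pi / N with hε
    have hε0 : 0 ≤ ε := by positivity
    have hε1 : ε ≤ Real.pi := div_le_self Real.pi_pos.le (by exact_mod_cast hN)
    let X : ℕ → Vec d × Vec d → Vec d :=
      fun k p => Real.cos (k * ε) • p.1 + Real.sin (k * ε) • p.2
    have hstep : ∀ k p, F (X k p) - F (X (k + 1) p) =
        a ε (ContinuousLinearMap.rotation (k * ε) p) := by
      intro k p
      simp only [a, X, ContinuousLinearMap.rotation_apply]
      congr 2
      push_cast
      rw [add_mul, one_mul, Real.cos_add, Real.sin_add]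
      module
    have hpt : ∀ p, 4 * F p.1 ^ 2 ≤ N * ∑ k ∈ Finset.range N,
        a ε (ContinuousLinearMap.rotation (k * ε) p) ^ 2 := by
      intro p
      -- The `N` steps add up to a half turn, which sends `p.1` to `-p.1`; oddness makes the total
      -- increment `2 F`. Cauchy–Schwarz over the steps follows.
      have h1 : ∑ k ∈ Finset.range N, (F (X k p) - F (X (k + 1) p)) = 2 * F p.1 := by
        rw [Finset.sum_range_sub']
        have h3 : (N : ℝ) * ε = Real.pi := by rw [hε]; field_simp
        simp only [X, h3]
        simp [hodd]
        ring
      have h2 := sq_sum_le_card_mul_sum_sq (s := Finset.range N)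
        (f := fun k => F (X k p) - F (X (k + 1) p))
      rw [h1, Finset.card_range] at h2
      simp_rw [hstep] at h2
      linarith
    have hi : ∀ k : ℕ, Integrable (fun p => a ε (ContinuousLinearMap.rotation (k * ε) p) ^ 2)
        (γ.prod γ) := by
      intro k
      have h1 := ha_int ε hε0 hε1
      rw [← hrot (k * ε)] at h1
      exact h1.comp_measurable (ContinuousLinearMap.continuous _).measurable
    have hv : ∀ k : ℕ, ∫ p, a ε (ContinuousLinearMap.rotation (k * ε) p) ^ 2 ∂(γ.prod γ) =
        ∫ p, a ε p ^ 2 ∂(γ.prod γ) := by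
      intro k
      conv_rhs => rw [← hrot (k * ε)]
      have hc : Continuous fun p => a ε p ^ 2 := (ha_cont ε).pow 2
      rw [integral_map (ContinuousLinearMap.continuous _).aemeasurable hc.aestronglyMeasurable]
    calc 4 * ∫ x, F x ^ 2 ∂γ = ∫ p, 4 * F p.1 ^ 2 ∂(γ.prod γ) := by
          rw [integral_fun_fst (fun x => 4 * F x ^ 2)]
          simp [integral_const_mul]
      _ ≤ ∫ p, N * ∑ k ∈ Finset.range N,
            a ε (ContinuousLinearMap.rotation (k * ε) p) ^ 2 ∂(γ.prod γ) := by
          refine integral_mono_of_nonneg (.of_forall fun p => by positivity)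
            ((integrable_finsetSum _ fun k _ => hi k).const_mul _) (.of_forall hpt)
      _ = N * (N * ∫ p, a ε p ^ 2 ∂(γ.prod γ)) := by
          rw [integral_const_mul, integral_finsetSum _ fun k _ => hi k]
          simp_rw [hv]
          simp
      _ = _ := by
          simp_rw [mul_pow]
          rw [integral_const_mul]
          ring
  -- As the angle tends to zero, the scaled increment becomes `π` times the derivative at `p.1` in
  -- the independent direction `p.2`, up to a sign that the square removes.
  have hlim : Tendsto (fun N : ℕ => ∫ p, (((N + 1 : ℕ) : ℝ) * a (Real.pi / (N + 1 : ℕ)) p) ^ 2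
      ∂(γ.prod γ)) atTop (𝓝 (∫ p, (Real.pi * fderiv ℝ F p.1 p.2) ^ 2 ∂(γ.prod γ))) := by
    refine tendsto_integral_of_dominated_convergence
      (fun p => (L * Real.pi) ^ 2 * (2 * ‖p.1‖ + ‖p.2‖) ^ 2)
      (fun N => ((ha_cont _).const_mul _ |>.pow 2).aestronglyMeasurable)
      (hsq.const_mul _) (fun N => .of_forall fun p => ?_) ?_
    · have hN0 : (0 : ℝ) < (N + 1 : ℕ) := by positivity
      have h1 := ha_bound (Real.pi / (N + 1 : ℕ)) (by positivity)
        (div_le_self Real.pi_pos.le (by exact_mod_cast Nat.le_add_left 1 N)) p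
      rw [Real.norm_eq_abs, abs_pow, abs_mul, abs_of_pos hN0, ← mul_pow]
      refine pow_le_pow_left₀ (by positivity) ?_ 2
      calc ((N + 1 : ℕ) : ℝ) * |a (Real.pi / (N + 1 : ℕ)) p|
          ≤ ((N + 1 : ℕ) : ℝ) * (L * (Real.pi / (N + 1 : ℕ) * (2 * ‖p.1‖ + ‖p.2‖))) := by gcongr
        _ = _ := by field_simp
    · have h1 : ∀ᵐ p ∂(γ.prod γ), DifferentiableAt ℝ F p.1 :=
        Measure.quasiMeasurePreserving_fst.ae hdiff
      filter_upwards [h1] with p hp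
      have h2 : HasDerivAt (fun ε : ℝ => F (Real.cos ε • p.1 + Real.sin ε • p.2))
          (fderiv ℝ F p.1 p.2) 0 := by
        have h3 : HasDerivAt (fun ε : ℝ => Real.cos ε • p.1 + Real.sin ε • p.2) p.2 0 := by
          have := ((Real.hasDerivAt_cos 0).smul_const p.1).add
            ((Real.hasDerivAt_sin 0).smul_const p.2)
          simp only [Real.sin_zero, neg_zero, zero_smul, Real.cos_zero, one_smul, zero_add] at this
          exact this
        refine HasFDerivAt.comp_hasDerivAt 0 ?_ h3
        simpa using hp.hasFDerivAt
      have h4 : Tendsto (fun N : ℕ => Real.pi / (N + 1 : ℕ)) atTop (𝓝[≠] 0) := by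
        refine tendsto_nhdsWithin_iff.2 ⟨?_, .of_forall fun N => ?_⟩
        · exact (tendsto_const_div_atTop_nhds_zero_nat Real.pi).comp (tendsto_add_atTop_nat 1)
        · exact div_ne_zero Real.pi_ne_zero (by positivity)
      have h5 := (hasDerivAt_iff_tendsto_slope.1 h2).comp h4
      have h6 := (h5.const_mul (-Real.pi)).pow 2
      rw [show (-Real.pi * fderiv ℝ F p.1 p.2) ^ 2 = (Real.pi * fderiv ℝ F p.1 p.2) ^ 2 by ring] at h6
      refine h6.congr fun N => ?_
      have hN0 : ((N + 1 : ℕ) : ℝ) ≠ 0 := by positivity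
      simp only [Function.comp_apply, slope_def_field, a, Real.cos_zero, Real.sin_zero, one_smul,
        zero_smul, add_zero, sub_zero]
      congr 1
      field_simp [Real.pi_ne_zero]
      ring
  have hfin : ∫ p, (Real.pi * fderiv ℝ F p.1 p.2) ^ 2 ∂(γ.prod γ) ≤ Real.pi ^ 2 * L ^ 2 := by
    have hmeas : Measurable fun p : Vec d × Vec d => fderiv ℝ F p.1 p.2 := by
      have h1 : Measurable (fderiv ℝ F) := measurable_fderiv ℝ F
      have h2 : Continuous fun q : (Vec d →L[ℝ] ℝ) × Vec d => q.1 q.2 :=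
        isBoundedBilinearMap_apply.continuous
      exact h2.measurable.comp ((h1.comp measurable_fst).prodMk measurable_snd)
    have hb : ∀ x, ‖fderiv ℝ F x‖ ≤ L := fun x => by
      have := norm_fderiv_le_of_lipschitz ℝ (x₀ := x) hlip
      rwa [Real.coe_toNNReal _ hL] at this
    have hint : Integrable (fun p : Vec d × Vec d => (Real.pi * fderiv ℝ F p.1 p.2) ^ 2)
        (γ.prod γ) := by
      refine (((integrable_normSq_stdGaussian d).comp_snd γ).const_mul ((Real.pi * L) ^ 2)).mono'
        ((hmeas.const_mul _).pow_const 2).aestronglyMeasurable (.of_forall fun p => ?_)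
      rw [Real.norm_eq_abs, abs_pow, abs_mul, abs_of_pos Real.pi_pos, ← mul_pow]
      have h1 : |fderiv ℝ F p.1 p.2| ≤ L * ‖p.2‖ :=
        ((fderiv ℝ F p.1).le_opNorm p.2).trans (by gcongr; exact hb _)
      calc (Real.pi * |fderiv ℝ F p.1 p.2|) ^ 2 ≤ (Real.pi * (L * ‖p.2‖)) ^ 2 := by gcongr
        _ = _ := by ring
    rw [integral_prod _ hint]
    -- With `x` fixed, the derivative is a linear form of a standard Gaussian vector, whose variance
    -- is the squared dual norm: no factor `d` enters.
    have hinner : ∀ x, ∫ y, (Real.pi * fderiv ℝ F x y) ^ 2 ∂γ = Real.pi ^ 2 * ‖fderiv ℝ F x‖ ^ 2 := by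
      intro x
      simp_rw [mul_pow]
      rw [integral_const_mul]
      congr 1
      have h := variance_dual_stdGaussian (fderiv ℝ F x)
      rwa [variance_of_integral_eq_zero (fderiv ℝ F x).continuous.aemeasurable
        (integral_strongDual_stdGaussian _)] at h
    simp_rw [hinner]
    refine (integral_mono_of_nonneg (.of_forall fun x => by positivity)
      (integrable_const (Real.pi ^ 2 * L ^ 2)) (.of_forall fun x => ?_)).trans_eq (by simp)
    exact mul_le_mul_of_nonneg_left (pow_le_pow_left₀ (norm_nonneg _) (hb x) 2) (sq_nonneg _)
  have := le_of_tendsto_of_tendsto' tendsto_const_nhds hlim (fun N => htel (N + 1) (by omega))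
  linarith


/-! ### Mean and second moment of the two-point estimate -/

theorem IsCost.continuous {d : ℕ} {G : ℝ} {φ : Vec d → ℝ} (h : IsCost G φ) : Continuous φ :=
  h.differentiable.continuous

/-- The second moment of the difference of a cost at two antipodal points of a sphere. -/
theorem integral_antipodal_sq_le {d : ℕ} (hd : 1 ≤ d) {G δ : ℝ} (hG : 0 ≤ G) (hδ : 0 ≤ δ)
    {φ : Vec d → ℝ} (h : IsCost G φ) (x : Vec d) :
    ∫ v, (φ (x + δ • v) - φ (x - δ • v)) ^ 2 ∂uniformSphere d ≤ 90 * (G * δ) ^ 2 / d := by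
  have : NeZero d := ⟨by omega⟩
  set η : Vec d → ℝ := fun v => φ (x + δ • v) - φ (x - δ • v) with hη
  have hc : Continuous η := by
    have := h.continuous
    fun_prop
  have hηd : Differentiable ℝ η := by
    have := h.differentiable
    fun_prop
  have hlip : ∀ u v, |η u - η v| ≤ 2 * (G * δ) * ‖u - v‖ := by
    intro u v
    have h1 := h.lipschitz (x + δ • u) (x + δ • v)
    have h2 := h.lipschitz (x - δ • v) (x - δ • u)
    rw [show x + δ • u - (x + δ • v) = δ • (u - v) by module, norm_smul,
      Real.norm_of_nonneg hδ] at h1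
    rw [show x - δ • v - (x - δ • u) = δ • (u - v) by module, norm_smul,
      Real.norm_of_nonneg hδ] at h2
    calc |η u - η v| = |(φ (x + δ • u) - φ (x + δ • v)) + (φ (x - δ • v) - φ (x - δ • u))| := by
          simp only [hη]; ring_nf
      _ ≤ _ := (abs_add_le _ _).trans (by linarith)
  have hodd : ∀ v, η (-v) = -η v := fun v => by
    simp only [hη, smul_neg, sub_neg_eq_add, ← sub_eq_add_neg]
    ring
  have hbd : ∀ v, |η v| ≤ 2 * (G * δ) * ‖v‖ := fun v => by
    have h0 : η 0 = 0 := by simp [hη]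
    simpa [h0] using hlip v 0
  -- The extension of degree one is again odd and Lipschitz, with constant `6 G δ`: `2 G δ` from the
  -- radial factor and twice `2 G δ` from the normalized argument. It may fail to be differentiable
  -- at the origin, a null set.
  set F : Vec d → ℝ := fun z => ‖z‖ * η (‖z‖⁻¹ • z) with hF
  have hunit : ∀ z : Vec d, z ≠ 0 → ‖‖z‖⁻¹ • z‖ = 1 := fun z hz => by
    rw [norm_smul, norm_inv, norm_norm, inv_mul_cancel₀ (norm_ne_zero_iff.2 hz)]
  have hGδ : 0 ≤ G * δ := mul_nonneg hG hδ
  have hFb : ∀ z, |F z| ≤ 2 * (G * δ) * ‖z‖ := by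
    intro z
    by_cases hz : z = 0
    · simp [hF, hz]
    · have := hbd (‖z‖⁻¹ • z)
      rw [hunit z hz, mul_one] at this
      simp only [hF, abs_mul, abs_norm]
      nlinarith [norm_nonneg z]
  have hFlip : ∀ z z', |F z - F z'| ≤ 6 * (G * δ) * ‖z - z'‖ := by
    intro z z'
    by_cases hz : z = 0
    · subst hz
      have := hFb z'
      have h0 : F 0 = 0 := by simp [hF]
      rw [h0, zero_sub, abs_neg, zero_sub, norm_neg]
      nlinarith [norm_nonneg z', mul_nonneg hGδ (norm_nonneg z')]
    by_cases hz' : z' = 0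
    · subst hz'
      have := hFb z
      have h0 : F 0 = 0 := by simp [hF]
      rw [h0, sub_zero, sub_zero]
      nlinarith [norm_nonneg z, mul_nonneg hGδ (norm_nonneg z)]
    have h1 : F z - F z' = (‖z‖ - ‖z'‖) * η (‖z‖⁻¹ • z) +
        ‖z'‖ * (η (‖z‖⁻¹ • z) - η (‖z'‖⁻¹ • z')) := by simp only [hF]; ring
    have h2 := hbd (‖z‖⁻¹ • z)
    rw [hunit z hz, mul_one] at h2
    have h3 := abs_norm_sub_norm_le z z'
    have h4 := hlip (‖z‖⁻¹ • z) (‖z'‖⁻¹ • z')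
    have hn : ‖z‖ ≠ 0 := norm_ne_zero_iff.2 hz
    have hn' : ‖z'‖ ≠ 0 := norm_ne_zero_iff.2 hz'
    have h5 : ‖z'‖ * ‖‖z‖⁻¹ • z - ‖z'‖⁻¹ • z'‖ ≤ 2 * ‖z - z'‖ := by
      rw [← norm_norm z', ← norm_smul, norm_norm z']
      have : ‖z'‖ • (‖z‖⁻¹ • z - ‖z'‖⁻¹ • z') = (z - z') + (‖z'‖ - ‖z‖) • (‖z‖⁻¹ • z) := by
        rw [smul_sub, smul_smul ‖z'‖ ‖z'‖⁻¹, mul_inv_cancel₀ hn', sub_smul, smul_smul ‖z‖,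
          mul_inv_cancel₀ hn]
        module
      rw [this]
      refine (norm_add_le _ _).trans ?_
      rw [norm_smul, hunit z hz, mul_one, Real.norm_eq_abs, abs_sub_comm]
      linarith
    rw [h1]
    refine (abs_add_le _ _).trans ?_
    rw [abs_mul, abs_mul, abs_norm]
    have h6 : |‖z‖ - ‖z'‖| * |η (‖z‖⁻¹ • z)| ≤ ‖z - z'‖ * (2 * (G * δ)) := by gcongr
    have h7 : ‖z'‖ * |η (‖z‖⁻¹ • z) - η (‖z'‖⁻¹ • z')| ≤ 2 * (G * δ) * (2 * ‖z - z'‖) := by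
      calc _ ≤ ‖z'‖ * (2 * (G * δ) * ‖‖z‖⁻¹ • z - ‖z'‖⁻¹ • z'‖) := by gcongr
        _ = 2 * (G * δ) * (‖z'‖ * ‖‖z‖⁻¹ • z - ‖z'‖⁻¹ • z'‖) := by ring
        _ ≤ _ := by gcongr
    linarith
  have hdiff : ∀ᵐ z ∂stdGaussian (Vec d), DifferentiableAt ℝ F z := by
    have h0 : ∀ᵐ z ∂stdGaussian (Vec d), z ≠ 0 := by
      have : Nontrivial (Vec d) := inferInstance
      rw [stdGaussian_eq_withDensity_norm]
      refine (withDensity_absolutelyContinuous _ _).ae_le ?_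
      exact Measure.ae_ne volume 0
    filter_upwards [h0] with z hz
    have h1 : DifferentiableAt ℝ (fun z : Vec d => ‖z‖) z := differentiableAt_id.norm ℝ hz
    have h2 : DifferentiableAt ℝ (fun z : Vec d => ‖z‖⁻¹ • z) z :=
      (h1.inv (norm_ne_zero_iff.2 hz)).smul differentiableAt_id
    exact h1.mul ((hηd _).comp z h2)
  have hmain := integral_sq_le_of_odd_lipschitz (F := F) (L := 6 * (G * δ)) (by positivity) hFlip
    (fun z => by simp only [hF, norm_neg, smul_neg, hodd]; ring) hdiff
  have h8 := integral_normSq_mul_stdGaussian hd (H := fun v => η v ^ 2) (hc.pow 2).measurable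
  rw [integral_normSq_stdGaussian] at h8
  have h9 : ∀ z, F z ^ 2 = ‖z‖ ^ 2 * η (‖z‖⁻¹ • z) ^ 2 := fun z => mul_pow _ _ _
  simp_rw [h9] at hmain
  rw [h8] at hmain
  have hd0 : (0 : ℝ) < d := by positivity
  rw [le_div_iff₀ hd0, mul_comm]
  refine hmain.trans ?_
  -- The Poincaré constant `π²/4` times `6² = 36` is `9 π²`, hence the 90.
  have hpi : Real.pi ^ 2 ≤ 10 := by nlinarith [Real.pi_lt_d2, Real.pi_pos]
  nlinarith [sq_nonneg (G * δ)]

theorem continuous_twoPointGrad {d : ℕ} {G δ : ℝ} {φ : Vec d → ℝ} (h : IsCost G φ) (x : Vec d) :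
    Continuous (twoPointGrad δ φ x) := by
  have := h.continuous
  unfold twoPointGrad
  fun_prop

/-- A crude bound, linear in `d`, that serves only to establish boundedness and integrability; it
does not enter the rates. -/
theorem norm_twoPointGrad_le {d : ℕ} {G δ : ℝ} (hδ : 0 < δ) {φ : Vec d → ℝ}
    (h : IsCost G φ) (x : Vec d) {v : Vec d} (hv : ‖v‖ = 1) : ‖twoPointGrad δ φ x v‖ ≤ d * G := by
  have h1 := h.lipschitz (x + δ • v) (x - δ • v)
  rw [show x + δ • v - (x - δ • v) = (2 * δ) • v by module, norm_smul, hv, mul_one,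
    Real.norm_of_nonneg (by positivity)] at h1
  rw [twoPointGrad, norm_smul, hv, mul_one, Real.norm_eq_abs, abs_div, abs_mul, Nat.abs_cast,
    abs_of_pos (by positivity : 0 < 2 * δ), div_le_iff₀ (by positivity), mul_assoc]
  gcongr

/-- The mean of the two-point gradient estimate. -/
def meanGrad {d : ℕ} (δ : ℝ) (φ : Vec d → ℝ) (x : Vec d) : Vec d :=
  ∫ v, twoPointGrad δ φ x v ∂uniformSphere d

theorem integrable_twoPointGrad {d : ℕ} (hd : 1 ≤ d) {G δ : ℝ} (hδ : 0 < δ) {φ : Vec d → ℝ}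
    (h : IsCost G φ) (x : Vec d) : Integrable (twoPointGrad δ φ x) (uniformSphere d) := by
  have : NeZero d := ⟨by omega⟩
  refine Integrable.of_bound (continuous_twoPointGrad h x).aestronglyMeasurable (d * G) ?_
  filter_upwards [ae_norm_uniformSphere d] with v hv
  exact norm_twoPointGrad_le hδ h x hv

/-- Concentration of the antipodal difference saves one factor `d` over the pointwise bound. The
constant is `90/4 = 22.5`, rounded up. -/
theorem integral_normSq_twoPointGrad_le {d : ℕ} (hd : 1 ≤ d) {G δ : ℝ} (hG : 0 ≤ G) (hδ : 0 < δ)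
    {φ : Vec d → ℝ} (h : IsCost G φ) (x : Vec d) :
    ∫ v, ‖twoPointGrad δ φ x v‖ ^ 2 ∂uniformSphere d ≤ 23 * d * G ^ 2 := by
  have hd0 : (0 : ℝ) < d := by positivity
  have h1 : ∫ v, ‖twoPointGrad δ φ x v‖ ^ 2 ∂uniformSphere d =
      ∫ v, (d / (2 * δ)) ^ 2 * (φ (x + δ • v) - φ (x - δ • v)) ^ 2 ∂uniformSphere d := by
    refine integral_congr_ae ?_
    filter_upwards [ae_norm_uniformSphere d] with v hv
    rw [twoPointGrad, norm_smul, hv, mul_one, Real.norm_eq_abs, sq_abs]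
    ring
  rw [h1, integral_const_mul]
  calc _ ≤ (d / (2 * δ)) ^ 2 * (90 * (G * δ) ^ 2 / d) := by
        gcongr
        exact integral_antipodal_sq_le hd hG hδ.le h x
    _ = 22.5 * d * G ^ 2 := by field_simp; ring
    _ ≤ _ := by gcongr; norm_num

/-- The mean of the estimate, tested against a vector, in terms of the values of the cost at
points that are mirror images of each other. -/
theorem inner_meanGrad {d : ℕ} (hd : 1 ≤ d) {G δ : ℝ} (hδ : 0 < δ)
    {φ : Vec d → ℝ} (h : IsCost G φ) (x w : Vec d) :
    inner ℝ w (meanGrad δ φ x) = d / (2 * δ) * ∫ v, (φ (x + δ • v) -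
      φ (x + δ • (ℝ ∙ w)ᗮ.reflection v)) * inner ℝ w v ∂uniformSphere d := by
  have : NeZero d := ⟨by omega⟩
  have hφ := h.continuous
  set R := (ℝ ∙ w)ᗮ.reflection with hR
  have hRw : ∀ v, inner ℝ w (R v) = -inner ℝ w v := by
    intro v
    have h1 : R w = -w := Submodule.reflection_orthogonalComplement_singleton_eq_neg w
    have h2 := R.inner_map_map w v
    rwa [h1, inner_neg_left, neg_eq_iff_eq_neg] at h2
  have hb : ∀ s : ℝ, Integrable (fun v => φ (x + s • v) * inner ℝ w v) (uniformSphere d) := by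
    intro s
    refine Integrable.of_bound (by fun_prop) ((|φ x| + G * |s|) * ‖w‖) ?_
    filter_upwards [ae_norm_uniformSphere d] with v hv
    have h1 := h.lipschitz (x + s • v) x
    rw [add_sub_cancel_left, norm_smul, hv, mul_one, Real.norm_eq_abs] at h1
    have h2 := abs_real_inner_le_norm w v
    rw [hv, mul_one] at h2
    rw [norm_mul, Real.norm_eq_abs, Real.norm_eq_abs]
    have h3 : |φ (x + s • v)| ≤ |φ x| + G * |s| := by
      have := abs_sub_abs_le_abs_sub (φ (x + s • v)) (φ x)
      linarith
    exact mul_le_mul h3 h2 (abs_nonneg _) ((abs_nonneg _).trans h3)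
  -- Substituting `-R v` for `v` keeps the inner product with `w`, since `R` flips its sign, and
  -- turns the antipodal point into the mirror image.
  have hrefl : ∫ v, φ (x - δ • v) * inner ℝ w v ∂uniformSphere d =
      ∫ v, φ (x + δ • R v) * inner ℝ w v ∂uniformSphere d := by
    rw [← integral_uniformSphere_comp_isometry hd (R.trans (LinearIsometryEquiv.neg ℝ))
      (fun v => φ (x - δ • v) * inner ℝ w v)]
    simp only [LinearIsometryEquiv.trans_apply, LinearIsometryEquiv.coe_neg, smul_neg,
      sub_neg_eq_add, inner_neg_right, hRw, neg_neg]
  have hb' : Integrable (fun v => φ (x - δ • v) * inner ℝ w v) (uniformSphere d) := by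
    simpa [sub_eq_add_neg] using hb (-δ)
  have hbR : Integrable (fun v => φ (x + δ • R v) * inner ℝ w v) (uniformSphere d) := by
    have hmp : MeasurePreserving (R.trans (LinearIsometryEquiv.neg ℝ)) (uniformSphere d)
      (uniformSphere d) := ⟨(LinearIsometryEquiv.continuous _).measurable,
        uniformSphere_map_isometry hd _⟩
    have := hmp.integrable_comp_of_integrable hb'
    refine this.congr (.of_forall fun v => ?_)
    simp [hRw]
  have hin : inner ℝ w (meanGrad δ φ x) =
      ∫ v, inner ℝ w (twoPointGrad δ φ x v) ∂uniformSphere d :=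
    (integral_inner (integrable_twoPointGrad hd hδ h x) w).symm
  have hpt : ∀ v, inner ℝ w (twoPointGrad δ φ x v) =
      d / (2 * δ) * (φ (x + δ • v) * inner ℝ w v - φ (x - δ • v) * inner ℝ w v) := by
    intro v
    rw [twoPointGrad, inner_smul_right]
    ring
  simp_rw [hin, hpt]
  rw [integral_const_mul, integral_sub (hb δ) hb', hrefl, ← integral_sub (hb δ) hbR]
  simp_rw [sub_mul]

theorem reflection_orthogonal_singleton_apply {d : ℕ} (w v : Vec d) :
    (ℝ ∙ w)ᗮ.reflection v = v - (2 * inner ℝ w v / ‖w‖ ^ 2) • w := by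
  rw [Submodule.reflection_orthogonal_apply, Submodule.reflection_singleton_apply]
  simp only [RCLike.ofReal_real_eq_id, id_eq]
  module

/-- A direction and its mirror image differ by a multiple of `w` proportional to the inner product
with `w`, so the Lipschitz condition bounds the integrand by a multiple of the squared inner
product, whose mean is `‖w‖²/d`. The choice of the mean itself as `w` closes the estimate. -/
theorem norm_meanGrad_le {d : ℕ} (hd : 1 ≤ d) {G δ : ℝ} (hG : 0 ≤ G) (hδ : 0 < δ)
    {φ : Vec d → ℝ} (h : IsCost G φ) (x : Vec d) : ‖meanGrad δ φ x‖ ≤ G := by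
  have : NeZero d := ⟨by omega⟩
  set w := meanGrad δ φ x
  by_cases hw0 : w = 0
  · rw [hw0, norm_zero]; exact hG
  have hn : 0 < ‖w‖ := norm_pos_iff.2 hw0
  have hd0 : (0 : ℝ) < d := by positivity
  have h1 : inner ℝ w w = _ := inner_meanGrad hd hδ h x w
  rw [real_inner_self_eq_norm_sq] at h1
  have h2 : ∫ v, (φ (x + δ • v) - φ (x + δ • (ℝ ∙ w)ᗮ.reflection v)) * inner ℝ w v
      ∂uniformSphere d ≤ ∫ v, 2 * G * δ / ‖w‖ * inner ℝ w v ^ 2 ∂uniformSphere d := by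
    have hφ := h.continuous
    have hint : Integrable (fun v => 2 * G * δ / ‖w‖ * inner ℝ w v ^ 2) (uniformSphere d) := by
      refine Integrable.of_bound (by fun_prop) (2 * G * δ / ‖w‖ * ‖w‖ ^ 2) ?_
      filter_upwards [ae_norm_uniformSphere d] with v hv
      have h2 := abs_real_inner_le_norm w v
      rw [hv, mul_one] at h2
      rw [norm_mul, Real.norm_of_nonneg (by positivity), norm_pow, Real.norm_eq_abs]
      gcongr
    have hpt : ∀ v, |(φ (x + δ • v) - φ (x + δ • (ℝ ∙ w)ᗮ.reflection v)) * inner ℝ w v| ≤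
        2 * G * δ / ‖w‖ * inner ℝ w v ^ 2 := by
      intro v
      have h3 := h.lipschitz (x + δ • v) (x + δ • (ℝ ∙ w)ᗮ.reflection v)
      rw [reflection_orthogonal_singleton_apply, show x + δ • v - (x + δ • (v -
        (2 * inner ℝ w v / ‖w‖ ^ 2) • w)) = (δ * (2 * inner ℝ w v / ‖w‖ ^ 2)) • w by module,
        norm_smul, Real.norm_eq_abs, abs_mul, abs_div, abs_mul, abs_of_pos hδ,
        abs_of_pos (by positivity : 0 < ‖w‖ ^ 2), abs_two] at h3
      rw [abs_mul, reflection_orthogonal_singleton_apply]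
      calc _ ≤ G * (δ * (2 * |inner ℝ w v| / ‖w‖ ^ 2) * ‖w‖) * |inner ℝ w v| := by gcongr
        _ = 2 * G * δ / ‖w‖ * |inner ℝ w v| ^ 2 := by field_simp
        _ = _ := by rw [sq_abs]
    refine integral_mono (hint.mono' (by fun_prop) (.of_forall hpt)) hint
      fun v => (le_abs_self _).trans (hpt v)
  rw [integral_const_mul, integral_inner_sq_uniformSphere hd] at h2
  have h4 : ‖w‖ ^ 2 ≤ G * ‖w‖ := by
    rw [h1]
    calc _ ≤ (d : ℝ) / (2 * δ) * (2 * G * δ / ‖w‖ * (‖w‖ ^ 2 / d)) := by gcongr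
      _ = G * ‖w‖ := by field_simp
  nlinarith

/-- The point `q` lies between `q - w` and `q + c • w`, and slopes of a convex function increase
along this segment. -/
theorem mul_sub_le_sub_of_convexOn {d : ℕ} {φ : Vec d → ℝ} (h : ConvexOn ℝ Set.univ φ) (q w : Vec d)
    {c : ℝ} (hc : 0 ≤ c) : c * (φ q - φ (q - w)) ≤ φ (q + c • w) - φ q := by
  have h0 : c / (1 + c) + 1 / (1 + c) = 1 := by field_simp; ring
  have h1 := h.2 (Set.mem_univ (q - w)) (Set.mem_univ (q + c • w))
    (by positivity) (by positivity) h0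
  have h2 : (c / (1 + c)) • (q - w) + (1 / (1 + c)) • (q + c • w) = q := by
    have : (c / (1 + c)) • (q - w) + (1 / (1 + c)) • (q + c • w) =
      (c / (1 + c) + 1 / (1 + c)) • q := by module
    rw [this, ← add_div, add_comm c 1, div_self (by positivity), one_smul]
  rw [h2, smul_eq_mul, smul_eq_mul] at h1
  have h3 : c / (1 + c) * φ (q - w) + 1 / (1 + c) * φ (q + c • w) =
    (c * φ (q - w) + φ (q + c • w)) / (1 + c) := by ring
  rw [h3, le_div_iff₀ (by positivity)] at h1
  linarith

/-- The mean of the two-point estimate is an approximate subgradient. -/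
theorem sub_le_inner_meanGrad {d : ℕ} (hd : 1 ≤ d) {G δ : ℝ} (hG : 0 ≤ G) (hδ : 0 < δ)
    {φ : Vec d → ℝ} (h : IsCost G φ) (x y : Vec d) :
    φ x - φ y ≤ inner ℝ (x - y) (meanGrad δ φ x) + 2 * (G * δ) := by
  have : NeZero d := ⟨by omega⟩
  obtain ⟨w, rfl⟩ : ∃ w, y = x - w := ⟨x - y, by simp⟩
  rw [sub_sub_cancel]
  by_cases hw0 : w = 0
  · subst hw0
    simp
    positivity
  have hn : 0 < ‖w‖ := norm_pos_iff.2 hw0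
  have hd0 : (0 : ℝ) < d := by positivity
  have hφ := h.continuous
  -- Moving both ends of the increment by at most `δ` costs `G δ` each.
  have hlow : ∀ q, ‖q - x‖ ≤ δ → φ x - φ (x - w) - 2 * (G * δ) ≤ φ q - φ (q - w) := by
    intro q hq
    have h1 := abs_le.1 (h.lipschitz q x)
    have h2 := abs_le.1 (h.lipschitz (q - w) (x - w))
    rw [show q - w - (x - w) = q - x by abel] at h2
    have : G * ‖q - x‖ ≤ G * δ := by gcongr
    linarith [h1.1, h2.2]
  set D := φ x - φ (x - w) - 2 * (G * δ) with hD
  -- Of the two mirror points, the one further along `w` is the other plus a nonnegative multiple of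
  -- `w`; convexity compares the increment between them with the increment over a full step `w`
  -- ending at the lower point. The sign of `s` decides the order.
  have hpt : ∀ v : Vec d, ‖v‖ = 1 → 2 * δ / ‖w‖ ^ 2 * D * inner ℝ w v ^ 2 ≤
      (φ (x + δ • v) - φ (x + δ • (ℝ ∙ w)ᗮ.reflection v)) * inner ℝ w v := by
    intro v hv
    set s : ℝ := inner ℝ w v with hs
    have hrn : ‖(ℝ ∙ w)ᗮ.reflection v‖ = 1 := by rw [LinearIsometryEquiv.norm_map, hv]
    have hrv := reflection_orthogonal_singleton_apply w v
    rw [← hs] at hrv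
    rcases le_total 0 s with hs0 | hs0
    · have h1 := mul_sub_le_sub_of_convexOn h.convex (x + δ • (ℝ ∙ w)ᗮ.reflection v) w
        (c := δ * (2 * s / ‖w‖ ^ 2)) (by positivity)
      have h2 := hlow (x + δ • (ℝ ∙ w)ᗮ.reflection v) (by
        rw [add_sub_cancel_left, norm_smul, hrn, mul_one, Real.norm_of_nonneg hδ.le])
      have h3 : x + δ • (ℝ ∙ w)ᗮ.reflection v + (δ * (2 * s / ‖w‖ ^ 2)) • w = x + δ • v := by
        rw [hrv]; module
      rw [h3] at h1
      have h4 := mul_le_mul_of_nonneg_left h2 (by positivity : 0 ≤ δ * (2 * s / ‖w‖ ^ 2))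
      calc _ = (δ * (2 * s / ‖w‖ ^ 2) * D) * s := by ring
        _ ≤ _ := mul_le_mul_of_nonneg_right (h4.trans h1) hs0
    · have h1 := mul_sub_le_sub_of_convexOn h.convex (x + δ • v) w
        (c := δ * (2 * (-s) / ‖w‖ ^ 2)) (by have : 0 ≤ -s := by linarith
                                            positivity)
      have h2 := hlow (x + δ • v) (by
        rw [add_sub_cancel_left, norm_smul, hv, mul_one, Real.norm_of_nonneg hδ.le])
      have h3 : x + δ • v + (δ * (2 * (-s) / ‖w‖ ^ 2)) • w = x + δ • (ℝ ∙ w)ᗮ.reflection v := by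
        rw [hrv]; module
      rw [h3] at h1
      have h4 := mul_le_mul_of_nonneg_left h2 (by
        have : 0 ≤ -s := by linarith
        positivity : 0 ≤ δ * (2 * (-s) / ‖w‖ ^ 2))
      have h5 := mul_le_mul_of_nonneg_right (h4.trans h1) (by linarith : 0 ≤ -s)
      calc _ = (δ * (2 * (-s) / ‖w‖ ^ 2) * D) * (-s) := by ring
        _ ≤ _ := h5
        _ = _ := by ring
  have hinner : ∀ v : Vec d, ‖v‖ = 1 → |inner ℝ w v| ≤ ‖w‖ := fun v hv => by
    simpa [hv] using abs_real_inner_le_norm w v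
  have hi1 : Integrable (fun v => 2 * δ / ‖w‖ ^ 2 * D * inner ℝ w v ^ 2) (uniformSphere d) := by
    refine Integrable.of_bound (by fun_prop) (|2 * δ / ‖w‖ ^ 2 * D| * ‖w‖ ^ 2) ?_
    filter_upwards [ae_norm_uniformSphere d] with v hv
    rw [norm_mul, Real.norm_eq_abs, norm_pow, Real.norm_eq_abs]
    gcongr
    exact hinner v hv
  have hi2 : Integrable (fun v => (φ (x + δ • v) - φ (x + δ • (ℝ ∙ w)ᗮ.reflection v)) *
      inner ℝ w v) (uniformSphere d) := by
    refine Integrable.of_bound (by fun_prop) (G * (δ * 2) * ‖w‖) ?_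
    filter_upwards [ae_norm_uniformSphere d] with v hv
    have h1 := h.lipschitz (x + δ • v) (x + δ • (ℝ ∙ w)ᗮ.reflection v)
    have h2 : ‖x + δ • v - (x + δ • (ℝ ∙ w)ᗮ.reflection v)‖ ≤ δ * 2 := by
      rw [show x + δ • v - (x + δ • (ℝ ∙ w)ᗮ.reflection v) =
        δ • (v - (ℝ ∙ w)ᗮ.reflection v) by module, norm_smul, Real.norm_of_nonneg hδ.le]
      have := norm_sub_le v ((ℝ ∙ w)ᗮ.reflection v)
      rw [LinearIsometryEquiv.norm_map, hv] at this
      gcongr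
      linarith
    rw [norm_mul, Real.norm_eq_abs, Real.norm_eq_abs]
    refine mul_le_mul (h1.trans (by gcongr)) (hinner v hv) (abs_nonneg _) (by positivity)
  have h6 := integral_mono_ae hi1 hi2 (by
    filter_upwards [ae_norm_uniformSphere d] with v hv using hpt v hv)
  rw [integral_const_mul, integral_inner_sq_uniformSphere hd] at h6
  rw [inner_meanGrad hd hδ h x w]
  -- The normalization `d / (2 δ)` of the estimate cancels exactly against the mean of the squared
  -- inner product.
  have h7 : (d : ℝ) / (2 * δ) * (2 * δ / ‖w‖ ^ 2 * D * (‖w‖ ^ 2 / d)) = D := by field_simp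
  have h8 := mul_le_mul_of_nonneg_left h6 (by positivity : 0 ≤ (d : ℝ) / (2 * δ))
  rw [h7] at h8
  linarith

/-! ### Independence of the past and conditional moments -/

/-- If `m₁ ⊔ m₂` is independent of `m₃` and `m₁` is independent of `m₂`, then `m₁` is independent
of `m₃ ⊔ m₂`. -/
theorem indep_sup_right {Ω : Type*} {m₁ m₂ m₃ m₀ : MeasurableSpace Ω} {P : Measure Ω}
    [IsProbabilityMeasure P] (h₁ : m₁ ≤ m₀) (h₂ : m₂ ≤ m₀) (h₃ : m₃ ≤ m₀)
    (h : Indep (m₁ ⊔ m₂) m₃ P) (h' : Indep m₁ m₂ P) : Indep m₁ (m₃ ⊔ m₂) P := by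
  refine IndepSets.indep (p1 := {s | MeasurableSet[m₁] s})
    (p2 := {s | ∃ A B, MeasurableSet[m₃] A ∧ MeasurableSet[m₂] B ∧ s = A ∩ B}) h₁ (sup_le h₃ h₂)
    (@MeasurableSpace.isPiSystem_measurableSet _ m₁) ?_
    (@MeasurableSpace.generateFrom_measurableSet _ m₁).symm ?_ ?_
  · rintro _ ⟨A, B, hA, hB, rfl⟩ _ ⟨A', B', hA', hB', rfl⟩ _
    exact ⟨A ∩ A', B ∩ B', hA.inter hA', hB.inter hB', by ext; simp; tauto⟩
  · refine le_antisymm (sup_le ?_ ?_) (MeasurableSpace.generateFrom_le ?_)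
    · exact fun A hA => MeasurableSpace.measurableSet_generateFrom
        ⟨A, Set.univ, hA, MeasurableSet.univ, by simp⟩
    · exact fun B hB => MeasurableSpace.measurableSet_generateFrom
        ⟨Set.univ, B, MeasurableSet.univ, hB, by simp⟩
    · rintro _ ⟨A, B, hA, hB, rfl⟩
      exact MeasurableSet.inter (le_sup_left (a := m₃) (b := m₂) A hA)
        (le_sup_right (a := m₃) (b := m₂) B hB)
  · rw [IndepSets_iff]
    rintro C _ hC ⟨A, B, hA, hB, rfl⟩
    rw [Indep_iff] at h h'
    -- On the generating π-system of intersections, the probability factors first into `C ∩ B` and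
    -- `A`, and then `C` splits from `B`.
    have e1 := h (C ∩ B) A (MeasurableSet.inter (le_sup_left (a := m₁) (b := m₂) C hC)
      (le_sup_right (a := m₁) (b := m₂) B hB)) hA
    have e2 := h B A (le_sup_right (a := m₁) (b := m₂) B hB) hA
    have e3 := h' C B hC hB
    rw [show C ∩ (A ∩ B) = C ∩ B ∩ A by ext; simp; tauto, Set.inter_comm A B, e1, e2, e3, mul_assoc]

/-- Integrating out a variable that is independent of the rest. -/
theorem integral_comp_of_indepFun {Ω W V : Type*} {mΩ : MeasurableSpace Ω} {mW : MeasurableSpace W}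
    {mV : MeasurableSpace V} {P : Measure Ω} [IsProbabilityMeasure P] {X : Ω → W} {U : Ω → V}
    (hX : Measurable X) (hU : Measurable U) (h : IndepFun X U P) {Ψ : W × V → ℝ}
    (hΨ : Measurable Ψ) (hi : Integrable (fun ω => Ψ (X ω, U ω)) P) :
    ∫ ω, Ψ (X ω, U ω) ∂P = ∫ ω, ∫ v, Ψ (X ω, v) ∂(P.map U) ∂P := by
  have hmap := (indepFun_iff_map_prod_eq_prod_map_map hX.aemeasurable hU.aemeasurable).1 h
  have h1 : ∫ ω, Ψ (X ω, U ω) ∂P = ∫ p, Ψ p ∂(P.map fun ω => (X ω, U ω)) :=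
    (integral_map (hX.prodMk hU).aemeasurable hΨ.aestronglyMeasurable).symm
  have : IsProbabilityMeasure (P.map X) := Measure.isProbabilityMeasure_map hX.aemeasurable
  have : IsProbabilityMeasure (P.map U) := Measure.isProbabilityMeasure_map hU.aemeasurable
  have h2 : Integrable Ψ ((P.map X).prod (P.map U)) := by
    rw [← hmap, integrable_map_measure hΨ.aestronglyMeasurable (hX.prodMk hU).aemeasurable]
    exact hi
  rw [h1, hmap, integral_prod _ h2, integral_map hX.aemeasurable
    (hΨ.stronglyMeasurable.integral_prod_right').aestronglyMeasurable]

section MeasurableCost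

variable {W : Type*} [MeasurableSpace W] {d : ℕ} {ψ : W → Vec d → ℝ}

/-- Costs are measurable only pointwise in their argument; continuity in the argument upgrades this
to joint measurability, so that random points may be inserted. -/
theorem measurable_cost_comp {V : Type*} [MeasurableSpace V] (hc : ∀ w, Continuous (ψ w))
    (hm : ∀ x, Measurable fun w => ψ w x) {X : V → Vec d} {Z : V → W} (hX : Measurable X)
    (hZ : Measurable Z) : Measurable fun w => ψ (Z w) (X w) := by
  have h := measurable_uncurry_of_continuous_of_measurable (u := fun x w => ψ w x) hc hm
  exact h.comp (hX.prodMk hZ)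

theorem measurable_twoPointGrad_comp {V : Type*} [MeasurableSpace V] (hc : ∀ w, Continuous (ψ w))
    (hm : ∀ x, Measurable fun w => ψ w x) (δ : ℝ) {X U : V → Vec d} {Z : V → W}
    (hX : Measurable X) (hU : Measurable U) (hZ : Measurable Z) :
    Measurable fun w => twoPointGrad δ (ψ (Z w)) (X w) (U w) := by
  unfold twoPointGrad
  have h1 := measurable_cost_comp hc hm (hX.add (hU.const_smul δ)) hZ
  have h2 := measurable_cost_comp hc hm (hX.sub (hU.const_smul δ)) hZ
  exact (((h1.sub h2).const_mul _).div_const _).smul hU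

theorem measurable_meanGrad_comp (hd : 1 ≤ d) (hc : ∀ w, Continuous (ψ w))
    (hm : ∀ x, Measurable fun w => ψ w x) (δ : ℝ) {X : W → Vec d} (hX : Measurable X) :
    Measurable fun w => meanGrad δ (ψ w) (X w) := by
  have : NeZero d := ⟨by omega⟩
  have h := measurable_twoPointGrad_comp hc hm δ (hX.comp measurable_fst) measurable_snd
    (measurable_fst (α := W) (β := Vec d))
  exact (h.stronglyMeasurable.integral_prod_right' (ν := uniformSphere d)).measurable

end MeasurableCost

theorem ae_norm_of_map_eq_uniformSphere {Ω : Type*} [MeasurableSpace Ω] {P : Measure Ω} {d : ℕ}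
    {U : Ω → Vec d} (hU : Measurable U) (hlaw : P.map U = uniformSphere d) :
    ∀ᵐ ω ∂P, ‖U ω‖ = 1 := by
  have h := ae_norm_uniformSphere d
  rw [← hlaw] at h
  exact ae_of_ae_map hU.aemeasurable h

theorem integral_inner_sub_meanGrad {d : ℕ} (hd : 1 ≤ d) {G δ : ℝ} (hδ : 0 < δ) {φ : Vec d → ℝ}
    (h : IsCost G φ) (x y : Vec d) :
    ∫ v, inner ℝ y (twoPointGrad δ φ x v - meanGrad δ φ x) ∂uniformSphere d = 0 := by
  have : NeZero d := ⟨by omega⟩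
  have hint := integrable_twoPointGrad hd hδ h x
  have hs : Integrable (fun v => twoPointGrad δ φ x v - meanGrad δ φ x) (uniformSphere d) :=
    hint.sub (integrable_const _)
  rw [integral_inner hs, integral_sub hint (integrable_const _), integral_const, probReal_univ,
    one_smul, ← meanGrad, sub_self, inner_zero_right]

section Noise

variable {Ω W : Type*} {mΩ : MeasurableSpace Ω} {mW : MeasurableSpace W} {P : Measure Ω}
  [IsProbabilityMeasure P] {d : ℕ} {G δ : ℝ} {ψ : W → Vec d → ℝ} {Z : Ω → W} {X : W → Vec d}
  {U : Ω → Vec d}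

/-- The error of the two-point estimate has mean zero given the past. -/
theorem integral_inner_noise_eq_zero (hd : 1 ≤ d) (hG : 0 ≤ G) (hδ : 0 < δ)
    (hU : Measurable U) (hlaw : P.map U = uniformSphere d) (hZ : Measurable Z)
    (hind : IndepFun Z U P) (hψ : ∀ w, IsCost G (ψ w))
    (hψm : ∀ x, Measurable fun w => ψ w x) (hX : Measurable X)
    {Y : W → Vec d} (hY : Measurable Y) {C : ℝ} (hYC : ∀ᵐ ω ∂P, ‖Y (Z ω)‖ ≤ C) :
    ∫ ω, inner ℝ (Y (Z ω)) (twoPointGrad δ (ψ (Z ω)) (X (Z ω)) (U ω) -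
      meanGrad δ (ψ (Z ω)) (X (Z ω))) ∂P = 0 := by
  have : NeZero d := ⟨by omega⟩
  have hc : ∀ ω, Continuous (ψ ω) := fun ω => (hψ ω).continuous
  let Ψ : W × Vec d → ℝ := fun p =>
    inner ℝ (Y p.1) (twoPointGrad δ (ψ p.1) (X p.1) p.2 - meanGrad δ (ψ p.1) (X p.1))
  have hΨ : Measurable Ψ := (hY.comp measurable_fst).inner ((measurable_twoPointGrad_comp hc hψm δ
      (hX.comp measurable_fst) measurable_snd measurable_fst).sub
      ((measurable_meanGrad_comp hd hc hψm δ hX).comp measurable_fst))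
  have hu := ae_norm_of_map_eq_uniformSphere hU hlaw
  have hi : Integrable (fun ω => Ψ (Z ω, U ω)) P := by
    refine Integrable.of_bound (C := C * (d * G + G))
      (hΨ.comp (hZ.prodMk hU)).aestronglyMeasurable ?_
    filter_upwards [hu, hYC] with ω h1 h2
    refine (norm_inner_le_norm _ _).trans ?_
    refine mul_le_mul h2 ((norm_sub_le _ _).trans ?_) (norm_nonneg _) ((norm_nonneg _).trans h2)
    exact add_le_add (norm_twoPointGrad_le hδ (hψ _) _ h1) (norm_meanGrad_le hd hG hδ (hψ _) _)
  refine (integral_comp_of_indepFun hZ hU hind hΨ hi).trans ?_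
  rw [hlaw]
  have hzero : ∀ ω, ∫ v, Ψ (Z ω, v) ∂uniformSphere d = 0 := fun ω =>
    integral_inner_sub_meanGrad hd hδ (hψ (Z ω)) (X (Z ω)) (Y (Z ω))
  simp_rw [hzero]
  exact integral_zero _ _

theorem integral_normSq_estimate_le (hd : 1 ≤ d) (hG : 0 ≤ G) (hδ : 0 < δ)
    (hU : Measurable U) (hlaw : P.map U = uniformSphere d) (hZ : Measurable Z)
    (hind : IndepFun Z U P) (hψ : ∀ w, IsCost G (ψ w))
    (hψm : ∀ x, Measurable fun w => ψ w x) (hX : Measurable X) :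
    ∫ ω, ‖twoPointGrad δ (ψ (Z ω)) (X (Z ω)) (U ω)‖ ^ 2 ∂P ≤ 23 * d * G ^ 2 := by
  have : NeZero d := ⟨by omega⟩
  have hc : ∀ ω, Continuous (ψ ω) := fun ω => (hψ ω).continuous
  let Ψ : W × Vec d → ℝ := fun p => ‖twoPointGrad δ (ψ p.1) (X p.1) p.2‖ ^ 2
  have hΨ : Measurable Ψ := (measurable_twoPointGrad_comp hc hψm δ
      (hX.comp measurable_fst) measurable_snd measurable_fst).norm.pow_const 2
  have hu := ae_norm_of_map_eq_uniformSphere hU hlaw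
  have hi : Integrable (fun ω => Ψ (Z ω, U ω)) P := by
    refine Integrable.of_bound (C := (d * G) ^ 2)
      (hΨ.comp (hZ.prodMk hU)).aestronglyMeasurable ?_
    filter_upwards [hu] with ω h1
    simp only [Ψ, norm_pow, norm_norm]
    exact pow_le_pow_left₀ (norm_nonneg _) (norm_twoPointGrad_le hδ (hψ _) _ h1) 2
  refine (integral_comp_of_indepFun hZ hU hind hΨ hi).trans_le ?_
  rw [hlaw]
  refine (integral_mono_of_nonneg (.of_forall fun ω => integral_nonneg fun v => by positivity)
    (integrable_const (23 * d * G ^ 2)) (.of_forall fun ω => ?_)).trans_eq (by simp)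
  exact integral_normSq_twoPointGrad_le hd hG hδ (hψ _) (X _)

end Noise

section History

variable {Ω : Type*} {d M : ℕ} {f : ℕ → Fin M → Ω → Vec d → ℝ} {u : ℕ → Fin M → Ω → Vec d}

/-- The history together with the current directions of the other machines. -/
@[reducible]
def jointHistory (f : ℕ → Fin M → Ω → Vec d → ℝ) (u : ℕ → Fin M → Ω → Vec d) (t : ℕ) (m : Fin M) :
    MeasurableSpace Ω :=
  history f u t ⊔ ⨆ n ∈ {n | n ≠ m}, MeasurableSpace.comap (u t n) inferInstance

theorem measurable_history_cost {s t : ℕ} (hst : s ≤ t) (m : Fin M) (x : Vec d) :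
    Measurable[history f u t] fun ω => f s m ω x := by
  refine Measurable.mono (comap_measurable _) ?_ le_rfl
  refine le_trans ?_ le_sup_left
  refine le_iSup₂_of_le s (Finset.mem_range.2 (by omega)) ?_
  exact le_iSup_of_le m (le_iSup_of_le x le_rfl)

theorem measurable_history_dir {s t : ℕ} (hst : s < t) (m : Fin M) :
    Measurable[history f u t] (u s m) := by
  refine Measurable.mono (comap_measurable _) ?_ le_rfl
  refine le_trans ?_ le_sup_right
  exact le_iSup₂_of_le s (Finset.mem_range.2 hst) (le_iSup_of_le m le_rfl)

theorem measurable_jointHistory_dir {s t : ℕ} {n m : Fin M} (h : s < t ∨ s = t ∧ n ≠ m) :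
    Measurable[jointHistory f u t m] (u s n) := by
  rcases h with h | ⟨rfl, h⟩
  · exact (measurable_history_dir h n).mono le_sup_left le_rfl
  · refine Measurable.mono (comap_measurable _) (le_trans ?_ le_sup_right) le_rfl
    exact le_iSup₂_of_le n h le_rfl

namespace IsAdaptiveGame

variable {m₀ : MeasurableSpace Ω} {P : Measure Ω} {G : ℝ} {T : ℕ}

theorem history_le (hg : IsAdaptiveGame P G T f u) {t : ℕ} (ht : t < T) : history f u t ≤ m₀ := by
  refine sup_le ?_ ?_
  · refine iSup₂_le fun r hr => iSup_le fun m => iSup_le fun x => ?_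
    exact (hg.measurable_cost r (by have := Finset.mem_range.1 hr; omega) m x).comap_le
  · refine iSup₂_le fun r hr => iSup_le fun m => ?_
    exact (hg.measurable_dir r (by have := Finset.mem_range.1 hr; omega) m).comap_le

theorem jointHistory_le (hg : IsAdaptiveGame P G T f u) {t : ℕ} (ht : t < T) (m : Fin M) : jointHistory f u t m ≤ m₀ :=
  sup_le (hg.history_le ht) (iSup₂_le fun n _ => (hg.measurable_dir t ht n).comap_le)

/-- Joint independence of the current directions from the history combines with their independence
over machines. The enlarged σ-algebra is what makes the errors of two machines at the same step
orthogonal. -/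
theorem indep_jointHistory [IsProbabilityMeasure P] (hg : IsAdaptiveGame P G T f u) {t : ℕ} (ht : t < T) (m : Fin M) :
    Indep (MeasurableSpace.comap (u t m) inferInstance) (jointHistory f u t m) P := by
  have hle : ∀ n, MeasurableSpace.comap (u t n) inferInstance ≤ m₀ := fun n =>
    (hg.measurable_dir t ht n).comap_le
  refine indep_sup_right (hle m) (iSup₂_le fun n _ => hle n) (hg.history_le ht) ?_ ?_
  · refine indep_of_indep_of_le_left (hg.indep_history t ht) (sup_le ?_ ?_)
    · exact le_iSup (fun n => MeasurableSpace.comap (u t n) inferInstance) m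
    · exact iSup₂_le fun n _ => le_iSup (fun n => MeasurableSpace.comap (u t n) inferInstance) n
  · have h := indep_iSup_of_disjoint hle (hg.indep_machines t ht).iIndep (S := {m})
      (T := {n | n ≠ m}) (by simp)
    simpa using h

end IsAdaptiveGame

end History

/-! ### Second moments of orthogonal sums, and gradient descent -/

theorem integral_norm_le_sqrt {Ω E : Type*} [MeasurableSpace Ω] [NormedAddCommGroup E]
    {P : Measure Ω} [IsProbabilityMeasure P] {V : Ω → E} (hV : MemLp V 2 P) {b : ℝ}
    (h : ∫ ω, ‖V ω‖ ^ 2 ∂P ≤ b) : ∫ ω, ‖V ω‖ ∂P ≤ √b := by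
  have h1 : Integrable (fun ω => ‖V ω‖) P := (hV.integrable (by norm_num)).norm
  have h2 : Integrable (fun ω => ‖V ω‖ ^ 2) P := hV.integrable_norm_pow two_ne_zero
  set c := ∫ ω, ‖V ω‖ ∂P with hc
  have h3 : 0 ≤ ∫ ω, (‖V ω‖ - c) ^ 2 ∂P := integral_nonneg fun ω => sq_nonneg _
  have h4 : ∫ ω, (‖V ω‖ - c) ^ 2 ∂P = ∫ ω, ‖V ω‖ ^ 2 ∂P - c ^ 2 := by
    have : ∀ ω, (‖V ω‖ - c) ^ 2 = ‖V ω‖ ^ 2 - 2 * c * ‖V ω‖ + c ^ 2 := fun ω => by ring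
    simp_rw [this]
    have h5 : Integrable (fun ω => ‖V ω‖ ^ 2 - 2 * c * ‖V ω‖) P := h2.sub (h1.const_mul _)
    rw [integral_add h5 (integrable_const _), integral_sub h2 (h1.const_mul _),
      integral_const_mul, ← hc]
    simp
    ring
  exact Real.le_sqrt_of_sq_le (by linarith)

theorem integrable_inner_of_memLp {Ω E : Type*} [MeasurableSpace Ω] [NormedAddCommGroup E]
    [InnerProductSpace ℝ E] {P : Measure Ω} {V W : Ω → E} (hV : MemLp V 2 P) (hW : MemLp W 2 P) :
    Integrable (fun ω => inner ℝ (V ω) (W ω)) P := by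
  refine ((hV.integrable_norm_pow two_ne_zero).add (hW.integrable_norm_pow two_ne_zero)).mono'
    (hV.aestronglyMeasurable.inner hW.aestronglyMeasurable) (.of_forall fun ω => ?_)
  have h1 := abs_real_inner_le_norm (V ω) (W ω)
  rw [Real.norm_eq_abs]
  simp only [Pi.add_apply]
  nlinarith [sq_nonneg (‖V ω‖ - ‖W ω‖), norm_nonneg (V ω), norm_nonneg (W ω)]

/-- A sum of pairwise orthogonal random vectors with bounded second moments. -/
theorem integral_normSq_sum_le {Ω ι E : Type*} [MeasurableSpace Ω] [NormedAddCommGroup E]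
    [InnerProductSpace ℝ E] {P : Measure Ω} {ξ : ι → Ω → E} (S : Finset ι) (hL : ∀ i ∈ S, MemLp (ξ i) 2 P)
    (horth : ∀ i ∈ S, ∀ j ∈ S, i ≠ j → ∫ ω, inner ℝ (ξ i ω) (ξ j ω) ∂P = 0) {s : ℝ}
    (hs : ∀ i ∈ S, ∫ ω, ‖ξ i ω‖ ^ 2 ∂P ≤ s) (a : ι → ℝ) :
    ∫ ω, ‖∑ i ∈ S, a i • ξ i ω‖ ^ 2 ∂P ≤ (∑ i ∈ S, a i ^ 2) * s := by
  classical
  have hint : ∀ i ∈ S, ∀ j ∈ S, Integrable (fun ω => inner ℝ (ξ i ω) (ξ j ω)) P :=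
    fun i hi j hj => integrable_inner_of_memLp (hL i hi) (hL j hj)
  have h1 : ∀ ω, ‖∑ i ∈ S, a i • ξ i ω‖ ^ 2 =
      ∑ i ∈ S, ∑ j ∈ S, a i * a j * inner ℝ (ξ i ω) (ξ j ω) := by
    intro ω
    rw [← real_inner_self_eq_norm_sq, sum_inner]
    refine Finset.sum_congr rfl fun i _ => ?_
    rw [inner_sum]
    refine Finset.sum_congr rfl fun j _ => ?_
    rw [inner_smul_left, inner_smul_right]
    simp
    ring
  simp_rw [h1]
  rw [integral_finsetSum _ fun i hi => integrable_finsetSum _ fun j hj =>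
    (hint i hi j hj).const_mul _, Finset.sum_mul]
  refine Finset.sum_le_sum fun i hi => ?_
  rw [integral_finsetSum _ fun j hj => (hint i hi j hj).const_mul _, Finset.sum_eq_single i]
  · rw [integral_const_mul]
    simp_rw [real_inner_self_eq_norm_sq]
    rw [← sq]
    exact mul_le_mul_of_nonneg_left (hs i hi) (sq_nonneg _)
  · intro j hj hij
    rw [integral_const_mul, horth i hi j hj hij.symm, mul_zero]
  · exact fun h => absurd hi h

/-- The regret of gradient descent for linear losses. -/
theorem sum_inner_le_of_gradient_step {d T : ℕ} {η : ℝ} (hη : 0 < η) {z γ : ℕ → Vec d}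
    (h0 : z 0 = 0) (hz : ∀ t < T, z (t + 1) = z t - η • γ t) (y : Vec d) :
    ∑ t ∈ Finset.range T, inner ℝ (z t - y) (γ t) ≤
      ‖y‖ ^ 2 / (2 * η) + η / 2 * ∑ t ∈ Finset.range T, ‖γ t‖ ^ 2 := by
  -- With the squared distance to the comparator as potential the relation is an identity; the
  -- inequality comes only from dropping the final potential.
  have key : ∀ n ≤ T, ∑ t ∈ Finset.range n, inner ℝ (z t - y) (γ t) + ‖z n - y‖ ^ 2 / (2 * η) =
      ‖y‖ ^ 2 / (2 * η) + η / 2 * ∑ t ∈ Finset.range n, ‖γ t‖ ^ 2 := by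
    intro n
    induction n with
    | zero => intro _; simp [h0]
    | succ n ih =>
      intro hn
      have ih := ih (by omega)
      rw [Finset.sum_range_succ, Finset.sum_range_succ, hz n (by omega),
        show z n - η • γ n - y = (z n - y) - η • γ n by abel, norm_sub_sq_real, inner_smul_right,
        norm_smul, Real.norm_of_nonneg hη.le, mul_add, ← add_assoc, ← ih]
      field_simp
      ring
  have := key T le_rfl
  have h1 : 0 ≤ ‖z T - y‖ ^ 2 / (2 * η) := by positivity
  linarith

/-! ### The iterates as random vectors and the orthogonality of their errors -/

section Game

variable {Ω : Type*} {d M : ℕ}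

/-- The iterates of FedOSGD as random vectors; `K = 0` means no communication. -/
def iter (K : ℕ) (η δ : ℝ) (f : ℕ → Fin M → Ω → Vec d → ℝ) (u : ℕ → Fin M → Ω → Vec d)
    (t : ℕ) (m : Fin M) (ω : Ω) : Vec d :=
  fedIterate K η δ (fun t m => f t m ω) (fun t m => u t m ω) t m

/-- The gradient estimates along the iterates. -/
def est (K : ℕ) (η δ : ℝ) (f : ℕ → Fin M → Ω → Vec d → ℝ) (u : ℕ → Fin M → Ω → Vec d)
    (t : ℕ) (m : Fin M) (ω : Ω) : Vec d :=
  twoPointGrad δ (f t m ω) (iter K η δ f u t m ω) (u t m ω)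

/-- The conditional means of the gradient estimates. -/
def drift (K : ℕ) (η δ : ℝ) (f : ℕ → Fin M → Ω → Vec d → ℝ) (u : ℕ → Fin M → Ω → Vec d)
    (t : ℕ) (m : Fin M) (ω : Ω) : Vec d :=
  meanGrad δ (f t m ω) (iter K η δ f u t m ω)

/-- The errors of the gradient estimates. -/
def noise (K : ℕ) (η δ : ℝ) (f : ℕ → Fin M → Ω → Vec d → ℝ) (u : ℕ → Fin M → Ω → Vec d)
    (t : ℕ) (m : Fin M) (ω : Ω) : Vec d :=
  est K η δ f u t m ω - drift K η δ f u t m ω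

theorem iter_zero (K : ℕ) (η δ : ℝ) (f : ℕ → Fin M → Ω → Vec d → ℝ) (u : ℕ → Fin M → Ω → Vec d)
    (m : Fin M) (ω : Ω) : iter K η δ f u 0 m ω = 0 := rfl

theorem iter_succ (K : ℕ) (η δ : ℝ) (f : ℕ → Fin M → Ω → Vec d → ℝ) (u : ℕ → Fin M → Ω → Vec d)
    (t : ℕ) (m : Fin M) (ω : Ω) : iter K η δ f u (t + 1) m ω =
      if (t + 1) % K = 0 then (M : ℝ)⁻¹ • ∑ n : Fin M, (iter K η δ f u t n ω -
        η • est K η δ f u t n ω) else iter K η δ f u t m ω - η • est K η δ f u t m ω := rfl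

/-- Since `(t + 1) % 0 = t + 1` is never zero, the period `K = 0` means that no averaging takes
place. The baseline can therefore use all lemmas on `iter`. -/
theorem ncIterate_eq_fedIterate (η δ : ℝ) (φ : ℕ → Fin M → Vec d → ℝ)
    (v : ℕ → Fin M → Vec d) : ncIterate η δ φ v = fedIterate 0 η δ φ v := by
  ext1 t
  induction t with
  | zero => rfl
  | succ t ih =>
    ext1 m
    simp only [ncIterate, fedIterate, Nat.mod_zero, Nat.succ_ne_zero, if_false, ih]

namespace IsAdaptiveGame

variable {m₀ : MeasurableSpace Ω} {P : Measure Ω} {G : ℝ} {T : ℕ}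
  {f : ℕ → Fin M → Ω → Vec d → ℝ} {u : ℕ → Fin M → Ω → Vec d}

theorem continuous_cost (hg : IsAdaptiveGame P G T f u) {t : ℕ} (ht : t < T) (m : Fin M) (ω : Ω) :
    Continuous (f t m ω) :=
  (hg.cost t ht m ω).continuous

/-- The σ-algebra is left free because the estimate is needed as measurable for the history, for the
joint history and for the whole space. -/
theorem measurable_est_of (hg : IsAdaptiveGame P G T f u) {𝓗 : MeasurableSpace Ω} (K : ℕ)
    (η δ : ℝ) {t : ℕ} (ht : t < T) {m : Fin M} (h1 : ∀ x, Measurable[𝓗] fun ω => f t m ω x)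
    (h2 : Measurable[𝓗] (iter K η δ f u t m)) (h3 : Measurable[𝓗] (u t m)) :
    Measurable[𝓗] (est K η δ f u t m) :=
  @measurable_twoPointGrad_comp Ω 𝓗 d (f t m) Ω 𝓗 (hg.continuous_cost ht m) h1 δ
    (iter K η δ f u t m) (u t m) (fun ω => ω) h2 h3 (@measurable_id _ 𝓗)

theorem measurable_drift_of (hg : IsAdaptiveGame P G T f u) (hd : 1 ≤ d) {𝓗 : MeasurableSpace Ω}
    (K : ℕ) (η δ : ℝ) {t : ℕ} (ht : t < T) {m : Fin M}
    (h1 : ∀ x, Measurable[𝓗] fun ω => f t m ω x)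
    (h2 : Measurable[𝓗] (iter K η δ f u t m)) : Measurable[𝓗] (drift K η δ f u t m) :=
  @measurable_meanGrad_comp Ω 𝓗 d (f t m) hd (hg.continuous_cost ht m) h1 δ
    (iter K η δ f u t m) h2

theorem measurable_iter_of_le (hg : IsAdaptiveGame P G T f u) (K : ℕ) (η δ : ℝ) {s t : ℕ}
    (hst : s ≤ t) (hs : s ≤ T) (m : Fin M) :
    Measurable[history f u t] (iter K η δ f u s m) := by
  induction s generalizing m with
  | zero => exact measurable_const
  | succ s ih =>
    have ih' := fun n => ih (by omega) (by omega) n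
    have he : ∀ n, Measurable[history f u t] (est K η δ f u s n) := fun n =>
      hg.measurable_est_of K η δ (by omega) (fun x => measurable_history_cost (by omega) n x)
        (ih' n) (measurable_history_dir (by omega) n)
    have hn : ∀ n, Measurable[history f u t] fun ω =>
        iter K η δ f u s n ω - η • est K η δ f u s n ω := fun n => (ih' n).sub ((he n).const_smul η)
    by_cases hK : (s + 1) % K = 0
    · have : iter K η δ f u (s + 1) m = fun ω => (M : ℝ)⁻¹ • ∑ n : Fin M,
        (iter K η δ f u s n ω - η • est K η δ f u s n ω) := by
        ext1 ω; rw [iter_succ, if_pos hK]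
      rw [this]
      have hs : Measurable[history f u t] fun ω => ∑ n : Fin M,
        (iter K η δ f u s n ω - η • est K η δ f u s n ω) := Finset.measurable_sum _ fun n _ => hn n
      exact hs.const_smul ((M : ℝ)⁻¹)
    · have : iter K η δ f u (s + 1) m = fun ω =>
        iter K η δ f u s m ω - η • est K η δ f u s m ω := by
        ext1 ω; rw [iter_succ, if_neg hK]
      rw [this]
      exact hn m

theorem measurable_iter (hg : IsAdaptiveGame P G T f u) (K : ℕ) (η δ : ℝ) {t : ℕ} (ht : t < T)
    (m : Fin M) : Measurable (iter K η δ f u t m) :=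
  (hg.measurable_iter_of_le K η δ le_rfl ht.le m).mono (hg.history_le ht) le_rfl

theorem measurable_est (hg : IsAdaptiveGame P G T f u) (K : ℕ) (η δ : ℝ) {t : ℕ} (ht : t < T)
    (m : Fin M) : Measurable (est K η δ f u t m) :=
  hg.measurable_est_of K η δ ht (hg.measurable_cost t ht m) (hg.measurable_iter K η δ ht m)
    (hg.measurable_dir t ht m)

theorem measurable_drift (hg : IsAdaptiveGame P G T f u) (hd : 1 ≤ d) (K : ℕ) (η δ : ℝ) {t : ℕ}
    (ht : t < T) (m : Fin M) : Measurable (drift K η δ f u t m) :=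
  hg.measurable_drift_of hd K η δ ht (hg.measurable_cost t ht m) (hg.measurable_iter K η δ ht m)

theorem measurable_noise (hg : IsAdaptiveGame P G T f u) (hd : 1 ≤ d) (K : ℕ) (η δ : ℝ) {t : ℕ}
    (ht : t < T) (m : Fin M) : Measurable (noise K η δ f u t m) :=
  (hg.measurable_est K η δ ht m).sub (hg.measurable_drift hd K η δ ht m)

theorem measurable_noise_jointHistory (hg : IsAdaptiveGame P G T f u) (hd : 1 ≤ d) (K : ℕ)
    (η δ : ℝ) {s t : ℕ} (ht : t < T) {n m : Fin M} (h : s < t ∨ s = t ∧ n ≠ m) :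
    Measurable[jointHistory f u t m] (noise K η δ f u s n) := by
  have hst : s ≤ t := by rcases h with h | h <;> omega
  have h1 : ∀ x, Measurable[jointHistory f u t m] fun ω => f s n ω x := fun x =>
    (measurable_history_cost hst n x).mono le_sup_left le_rfl
  have h2 : Measurable[jointHistory f u t m] (iter K η δ f u s n) :=
    (hg.measurable_iter_of_le K η δ hst (by omega) n).mono le_sup_left le_rfl
  exact (hg.measurable_est_of K η δ (by omega) h1 h2 (measurable_jointHistory_dir h)).sub
    (hg.measurable_drift_of hd K η δ (by omega) h1 h2)

theorem ae_norm_dir (hg : IsAdaptiveGame P G T f u) : ∀ᵐ ω ∂P, ∀ t < T, ∀ m, ‖u t m ω‖ = 1 := by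
  refine ae_all_iff.2 fun t => ?_
  by_cases ht : t < T
  · refine (ae_all_iff.2 fun m => ae_norm_of_map_eq_uniformSphere (hg.measurable_dir t ht m)
      (hg.law_dir t ht m)).mono fun ω h _ => h
  · exact .of_forall fun ω h => absurd h ht

theorem norm_drift_le (hg : IsAdaptiveGame P G T f u) (hd : 1 ≤ d) (hG : 0 ≤ G) {δ : ℝ}
    (hδ : 0 < δ) (K : ℕ) (η : ℝ) {t : ℕ} (ht : t < T) (m : Fin M) (ω : Ω) :
    ‖drift K η δ f u t m ω‖ ≤ G :=
  norm_meanGrad_le hd hG hδ (hg.cost t ht m ω) _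

theorem norm_est_le (hg : IsAdaptiveGame P G T f u) {δ : ℝ} (hδ : 0 < δ) (K : ℕ) (η : ℝ) {t : ℕ}
    (ht : t < T) (m : Fin M) {ω : Ω} (hω : ‖u t m ω‖ = 1) : ‖est K η δ f u t m ω‖ ≤ d * G :=
  norm_twoPointGrad_le hδ (hg.cost t ht m ω) _ hω

theorem norm_noise_le (hg : IsAdaptiveGame P G T f u) (hd : 1 ≤ d) (hG : 0 ≤ G) {δ : ℝ}
    (hδ : 0 < δ) (K : ℕ) (η : ℝ) {t : ℕ} (ht : t < T) (m : Fin M) {ω : Ω} (hω : ‖u t m ω‖ = 1) :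
    ‖noise K η δ f u t m ω‖ ≤ d * G + G :=
  (norm_sub_le _ _).trans
    (add_le_add (hg.norm_est_le hδ K η ht m hω) (hg.norm_drift_le hd hG hδ K η ht m ω))

theorem norm_iter_le (hg : IsAdaptiveGame P G T f u) {δ : ℝ} (hδ : 0 < δ) (K : ℕ)
    (η : ℝ) {ω : Ω} (hω : ∀ t < T, ∀ m, ‖u t m ω‖ = 1) {t : ℕ} (ht : t ≤ T) (m : Fin M) :
    ‖iter K η δ f u t m ω‖ ≤ t * (|η| * (d * G)) := by
  induction t generalizing m with
  | zero => simp [iter_zero]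
  | succ t ih =>
    have hn : ∀ n, ‖iter K η δ f u t n ω - η • est K η δ f u t n ω‖ ≤
        ((t + 1 : ℕ) : ℝ) * (|η| * (d * G)) := by
      intro n
      refine (norm_sub_le _ _).trans ?_
      rw [norm_smul, Real.norm_eq_abs]
      have h1 := ih (by omega) n
      have h2 := mul_le_mul_of_nonneg_left (hg.norm_est_le hδ K η (by omega : t < T) n
        (hω t (by omega) n)) (abs_nonneg η)
      push_cast
      linarith
    rw [iter_succ]
    split_ifs
    · have hM : (0 : ℝ) < M := by
        have := m.pos
        exact_mod_cast this
      rw [norm_smul, norm_inv, Real.norm_natCast, inv_mul_le_iff₀ hM]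
      refine (norm_sum_le _ _).trans ((Finset.sum_le_sum fun n _ => hn n).trans_eq ?_)
      simp
    · exact hn m

variable [IsProbabilityMeasure P]

theorem memLp_noise (hg : IsAdaptiveGame P G T f u) (hd : 1 ≤ d) (hG : 0 ≤ G) {δ : ℝ}
    (hδ : 0 < δ) (K : ℕ) (η : ℝ) {t : ℕ} (ht : t < T) (m : Fin M) :
    MemLp (noise K η δ f u t m) 2 P :=
  MemLp.of_bound (hg.measurable_noise hd K η δ ht m).aestronglyMeasurable (d * G + G)
    (hg.ae_norm_dir.mono fun _ hω => hg.norm_noise_le hd hG hδ K η ht m (hω t ht m))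

/-- Given the joint history, the direction is still uniform, so the error is centred. The test
vector is bounded only almost surely because the directions have norm one only almost surely. -/
theorem integral_inner_noise (hg : IsAdaptiveGame P G T f u) (hd : 1 ≤ d) (hG : 0 ≤ G) {δ : ℝ}
    (hδ : 0 < δ) (K : ℕ) (η : ℝ) {t : ℕ} (ht : t < T) (m : Fin M) {Y : Ω → Vec d}
    (hY : Measurable[jointHistory f u t m] Y) {C : ℝ} (hYC : ∀ᵐ ω ∂P, ‖Y ω‖ ≤ C) :
    ∫ ω, inner ℝ (Y ω) (noise K η δ f u t m ω) ∂P = 0 := by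
  -- The past is encoded as the identity into the same space with the coarser σ-algebra: functions
  -- of it are then exactly the functions measurable for the joint history.
  have hid : @Measurable _ _ m₀ (jointHistory f u t m) (id : Ω → Ω) :=
    measurable_id'' (hg.jointHistory_le ht m)
  have hIF : @IndepFun _ _ _ m₀ (jointHistory f u t m) _ (id : Ω → Ω) (u t m) P := by
    rw [@IndepFun_iff_Indep _ _ _ m₀ (jointHistory f u t m), MeasurableSpace.comap_id]
    exact (hg.indep_jointHistory ht m).symm
  exact @integral_inner_noise_eq_zero Ω Ω m₀ (jointHistory f u t m) P _ d G δ (f t m) id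
    (iter K η δ f u t m) (u t m) hd hG hδ (hg.measurable_dir t ht m) (hg.law_dir t ht m) hid hIF
    (hg.cost t ht m) (fun x => (measurable_history_cost le_rfl m x).mono le_sup_left le_rfl)
    ((hg.measurable_iter_of_le K η δ le_rfl ht.le m).mono le_sup_left le_rfl) Y hY C hYC

theorem integral_normSq_est_le (hg : IsAdaptiveGame P G T f u) (hd : 1 ≤ d) (hG : 0 ≤ G) {δ : ℝ}
    (hδ : 0 < δ) (K : ℕ) (η : ℝ) {t : ℕ} (ht : t < T) (m : Fin M) :
    ∫ ω, ‖est K η δ f u t m ω‖ ^ 2 ∂P ≤ 23 * d * G ^ 2 := by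
  have hid : @Measurable _ _ m₀ (jointHistory f u t m) (id : Ω → Ω) :=
    measurable_id'' (hg.jointHistory_le ht m)
  have hIF : @IndepFun _ _ _ m₀ (jointHistory f u t m) _ (id : Ω → Ω) (u t m) P := by
    rw [@IndepFun_iff_Indep _ _ _ m₀ (jointHistory f u t m), MeasurableSpace.comap_id]
    exact (hg.indep_jointHistory ht m).symm
  exact @integral_normSq_estimate_le Ω Ω m₀ (jointHistory f u t m) P _ d G δ (f t m) id
    (iter K η δ f u t m) (u t m) hd hG hδ (hg.measurable_dir t ht m) (hg.law_dir t ht m) hid hIF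
    (hg.cost t ht m) (fun x => (measurable_history_cost le_rfl m x).mono le_sup_left le_rfl)
    ((hg.measurable_iter_of_le K η δ le_rfl ht.le m).mono le_sup_left le_rfl)

/-- The error is orthogonal to the conditional mean, so by Pythagoras its second moment is at most
that of the estimate. -/
theorem integral_normSq_noise_le (hg : IsAdaptiveGame P G T f u) (hd : 1 ≤ d) (hG : 0 ≤ G) {δ : ℝ}
    (hδ : 0 < δ) (K : ℕ) (η : ℝ) {t : ℕ} (ht : t < T) (m : Fin M) :
    ∫ ω, ‖noise K η δ f u t m ω‖ ^ 2 ∂P ≤ 23 * d * G ^ 2 := by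
  refine le_trans ?_ (hg.integral_normSq_est_le hd hG hδ K η ht m)
  have hdm : Measurable[jointHistory f u t m] (drift K η δ f u t m) :=
    hg.measurable_drift_of hd K η δ ht
      (fun x => (measurable_history_cost le_rfl m x).mono le_sup_left le_rfl)
      ((hg.measurable_iter_of_le K η δ le_rfl ht.le m).mono le_sup_left le_rfl)
  have h0 := hg.integral_inner_noise hd hG hδ K η ht m hdm
    (.of_forall (hg.norm_drift_le hd hG hδ K η ht m))
  have hdL : MemLp (drift K η δ f u t m) 2 P :=
    MemLp.of_bound (hg.measurable_drift hd K η δ ht m).aestronglyMeasurable G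
      (.of_forall (hg.norm_drift_le hd hG hδ K η ht m))
  have hnL := hg.memLp_noise hd hG hδ K η ht m
  have h1 : ∀ ω, ‖est K η δ f u t m ω‖ ^ 2 = ‖noise K η δ f u t m ω‖ ^ 2 +
      2 * inner ℝ (drift K η δ f u t m ω) (noise K η δ f u t m ω) +
      ‖drift K η δ f u t m ω‖ ^ 2 := by
    intro ω
    have : est K η δ f u t m ω = noise K η δ f u t m ω + drift K η δ f u t m ω := by
      simp [noise]
    rw [this, norm_add_sq_real, real_inner_comm]
  simp_rw [h1]
  have i1 := hnL.integrable_norm_pow two_ne_zero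
  have i2 := (integrable_inner_of_memLp hdL hnL).const_mul 2
  have i3 : Integrable (fun ω => ‖noise K η δ f u t m ω‖ ^ 2 +
      2 * inner ℝ (drift K η δ f u t m ω) (noise K η δ f u t m ω)) P := i1.add i2
  rw [integral_add i3 (hdL.integrable_norm_pow two_ne_zero), integral_add i1 i2,
    integral_const_mul, h0, mul_zero, add_zero]
  exact le_add_of_nonneg_right (integral_nonneg fun ω => by positivity)

/-- Of two distinct errors, the earlier one, or either one if they are simultaneous, belongs to the
joint history of the other. -/
theorem integral_inner_noise_noise (hg : IsAdaptiveGame P G T f u) (hd : 1 ≤ d) (hG : 0 ≤ G)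
    {δ : ℝ} (hδ : 0 < δ) (K : ℕ) (η : ℝ) {s t : ℕ} (hs : s < T) (ht : t < T) {n m : Fin M}
    (h : (s, n) ≠ (t, m)) :
    ∫ ω, inner ℝ (noise K η δ f u s n ω) (noise K η δ f u t m ω) ∂P = 0 := by
  wlog hle : s ≤ t generalizing s t n m
  · rw [← this ht hs h.symm (by omega)]
    simp_rw [real_inner_comm]
  have h' : s < t ∨ s = t ∧ n ≠ m := by
    rcases hle.lt_or_eq with h1 | h1
    · exact .inl h1
    · exact .inr ⟨h1, fun h2 => h (by rw [h1, h2])⟩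
  exact hg.integral_inner_noise hd hG hδ K η ht m
    (hg.measurable_noise_jointHistory hd K η δ ht h')
    (hg.ae_norm_dir.mono fun _ hω => hg.norm_noise_le hd hG hδ K η hs n (hω s hs n))

/-- Weighted sums of the errors of the estimates behave like sums of orthogonal vectors. -/
theorem integral_normSq_sum_noise_le (hg : IsAdaptiveGame P G T f u) (hd : 1 ≤ d) (hG : 0 ≤ G)
    {δ : ℝ} (hδ : 0 < δ) (K : ℕ) (η : ℝ) (S : Finset (ℕ × Fin M)) (hS : ∀ p ∈ S, p.1 < T)
    (a : ℕ × Fin M → ℝ) :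
    ∫ ω, ‖∑ p ∈ S, a p • noise K η δ f u p.1 p.2 ω‖ ^ 2 ∂P ≤
      (∑ p ∈ S, a p ^ 2) * (23 * d * G ^ 2) :=
  integral_normSq_sum_le (ξ := fun p : ℕ × Fin M => noise K η δ f u p.1 p.2) S
    (fun p hp => hg.memLp_noise hd hG hδ K η (hS p hp) p.2)
    (fun p hp q hq hpq => hg.integral_inner_noise_noise hd hG hδ K η (hS p hp) (hS q hq) hpq)
    (fun p hp => hg.integral_normSq_noise_le hd hG hδ K η (hS p hp) p.2) a

end IsAdaptiveGame

end Game

/-! ### Regret of a weighted average of the machines -/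

/-- The minimum over a ball of a random continuous function is measurable. -/
theorem measurable_min_on_ball {Ω : Type*} [MeasurableSpace Ω] {d : ℕ} {Φ : Ω → Vec d → ℝ}
    (hc : ∀ ω, Continuous (Φ ω)) (hm : ∀ x, Measurable fun ω => Φ ω x) {B : ℝ} (hB : 0 ≤ B)
    {y : Ω → Vec d} (hy : ∀ ω, ‖y ω‖ ≤ B) (hmin : ∀ ω z, ‖z‖ ≤ B → Φ ω (y ω) ≤ Φ ω z) :
    Measurable fun ω => Φ ω (y ω) := by
  let S := Metric.closedBall (0 : Vec d) B
  have : Nonempty S := ⟨⟨0, by simpa [S] using hB⟩⟩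
  let D := TopologicalSpace.denseSeq S
  refine measurable_of_Iio fun c => ?_
  -- The minimum is below `c` exactly when some point of a fixed countable dense set gives a value
  -- below `c`; the minimizer itself need not be measurable.
  have h : (fun ω => Φ ω (y ω)) ⁻¹' Set.Iio c = ⋃ n, {ω | Φ ω (D n : Vec d) < c} := by
    ext ω
    simp only [Set.mem_preimage, Set.mem_Iio, Set.mem_iUnion, Set.mem_ofPred_eq]
    constructor
    · intro h
      have hopen : IsOpen {z : S | Φ ω (z : Vec d) < c} :=
        isOpen_lt ((hc ω).comp continuous_subtype_val) continuous_const
      obtain ⟨n, hn⟩ := (TopologicalSpace.denseRange_denseSeq S).exists_mem_open hopen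
        ⟨⟨y ω, by simpa [S] using hy ω⟩, h⟩
      exact ⟨n, hn⟩
    · rintro ⟨n, hn⟩
      exact (hmin ω _ (mem_closedBall_zero_iff.1 (D n).2)).trans_lt hn
  rw [h]
  exact MeasurableSet.iUnion fun n => measurableSet_lt (hm _) measurable_const

namespace IsAdaptiveGame

variable {Ω : Type*} {d M : ℕ} {m₀ : MeasurableSpace Ω} {P : Measure Ω}
  {G : ℝ} {T : ℕ} {f : ℕ → Fin M → Ω → Vec d → ℝ} {u : ℕ → Fin M → Ω → Vec d}

/-- The cost at the two queried points in terms of the linearized regret. -/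
theorem two_point_cost_le (hg : IsAdaptiveGame P G T f u) (hd : 1 ≤ d) (hG : 0 ≤ G) {δ : ℝ}
    (hδ : 0 < δ) (K : ℕ) (η : ℝ) {t : ℕ} (ht : t < T) (m : Fin M) {ω : Ω}
    (hω : ‖u t m ω‖ = 1) (y : Vec d) :
    (f t m ω (iter K η δ f u t m ω + δ • u t m ω) - f t m ω y) +
      (f t m ω (iter K η δ f u t m ω - δ • u t m ω) - f t m ω y) ≤
      2 * inner ℝ (iter K η δ f u t m ω - y) (drift K η δ f u t m ω) + 6 * (G * δ) := by
  have hc := hg.cost t ht m ω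
  set x := iter K η δ f u t m ω
  have h1 := (abs_le.1 (hc.lipschitz (x + δ • u t m ω) x)).2
  have h2 := (abs_le.1 (hc.lipschitz (x - δ • u t m ω) x)).2
  rw [add_sub_cancel_left, norm_smul, hω, mul_one, Real.norm_of_nonneg hδ.le] at h1
  rw [sub_sub_cancel_left, norm_neg, norm_smul, hω, mul_one, Real.norm_of_nonneg hδ.le] at h2
  -- For each of the two queries, `G δ` pays for the move to the centre and `2 G δ` for the
  -- approximate subgradient: together `6 G δ`.
  have h3 := sub_le_inner_meanGrad hd hG hδ hc x y
  simp only [drift]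
  linarith

variable [IsProbabilityMeasure P]

theorem memLp_iter (hg : IsAdaptiveGame P G T f u) {δ : ℝ} (hδ : 0 < δ) (K : ℕ) (η : ℝ) {t : ℕ}
    (ht : t < T) (m : Fin M) : MemLp (iter K η δ f u t m) 2 P :=
  MemLp.of_bound (hg.measurable_iter K η δ ht m).aestronglyMeasurable (t * (|η| * (d * G)))
    (hg.ae_norm_dir.mono fun _ hω => hg.norm_iter_le hδ K η hω ht.le m)

theorem memLp_drift (hg : IsAdaptiveGame P G T f u) (hd : 1 ≤ d) (hG : 0 ≤ G) {δ : ℝ} (hδ : 0 < δ)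
    (K : ℕ) (η : ℝ) {t : ℕ} (ht : t < T) (m : Fin M) : MemLp (drift K η δ f u t m) 2 P :=
  MemLp.of_bound (hg.measurable_drift hd K η δ ht m).aestronglyMeasurable G
    (.of_forall (hg.norm_drift_le hd hG hδ K η ht m))

/-- The linearized regret of a weighted average of the machines that follows the gradient descent
recursion is dominated by an integrable random variable with a small expectation. -/
theorem exists_regret_bound (hg : IsAdaptiveGame P G T f u) (hd : 1 ≤ d) (hG : 0 ≤ G) {δ : ℝ}
    (hδ : 0 < δ) (K : ℕ) {η B : ℝ} (hη : 0 < η) (hB : 0 ≤ B) {a : Fin M → ℝ}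
    (ha : ∑ m, |a m| ≤ 1)
    (hrec : ∀ ω, ∀ t < T, ∑ m, a m • iter K η δ f u (t + 1) m ω =
      ∑ m, a m • iter K η δ f u t m ω - η • ∑ m, a m • est K η δ f u t m ω) :
    ∃ W : Ω → ℝ, Integrable W P ∧
      (∀ ω y, ‖y‖ ≤ B → ∑ t ∈ Finset.range T, ∑ m, a m *
        inner ℝ (∑ n, a n • iter K η δ f u t n ω - y) (drift K η δ f u t m ω) ≤ W ω) ∧
      ∫ ω, W ω ∂P ≤ B ^ 2 / (2 * η) + η * T * (G ^ 2 + (∑ m, a m ^ 2) * (23 * d * G ^ 2)) +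
        B * √(T * (∑ m, a m ^ 2) * (23 * d * G ^ 2)) := by
  set s : ℝ := 23 * d * G ^ 2 with hs
  set z : ℕ → Ω → Vec d := fun t ω => ∑ m, a m • iter K η δ f u t m ω with hz
  set γ : ℕ → Ω → Vec d := fun t ω => ∑ m, a m • est K η δ f u t m ω with hγ
  set e : ℕ → Ω → Vec d := fun t ω => ∑ m, a m • drift K η δ f u t m ω with he
  set ν : ℕ → Ω → Vec d := fun t ω => ∑ m, a m • noise K η δ f u t m ω with hν
  have hsplit : ∀ t ω, γ t ω = e t ω + ν t ω := by
    intro t ω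
    simp only [hγ, he, hν, ← Finset.sum_add_distrib, ← smul_add, noise, add_sub_cancel]
  have hzL : ∀ t < T, MemLp (z t) 2 P := fun t ht =>
    memLp_finsetSum _ fun m _ => (hg.memLp_iter hδ K η ht m).const_smul (a m)
  have heL : ∀ t < T, MemLp (e t) 2 P := fun t ht =>
    memLp_finsetSum _ fun m _ => (hg.memLp_drift hd hG hδ K η ht m).const_smul (a m)
  have hνL : ∀ t < T, MemLp (ν t) 2 P := fun t ht =>
    memLp_finsetSum _ fun m _ => (hg.memLp_noise hd hG hδ K η ht m).const_smul (a m)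
  have hγL : ∀ t < T, MemLp (γ t) 2 P := fun t ht => by
    have : γ t = e t + ν t := by ext1 ω; exact hsplit t ω
    rw [this]
    exact (heL t ht).add (hνL t ht)
  have hsumL : MemLp (fun ω => ∑ t ∈ Finset.range T, ν t ω) 2 P :=
    memLp_finsetSum _ fun t ht => hνL t (Finset.mem_range.1 ht)
  have heb : ∀ t < T, ∀ ω, ‖e t ω‖ ≤ G := by
    intro t ht ω
    refine (norm_sum_le _ _).trans ?_
    calc ∑ m, ‖a m • drift K η δ f u t m ω‖ ≤ ∑ m, |a m| * G := by
          refine Finset.sum_le_sum fun m _ => ?_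
          rw [norm_smul, Real.norm_eq_abs]
          exact mul_le_mul_of_nonneg_left (hg.norm_drift_le hd hG hδ K η ht m ω) (abs_nonneg _)
      _ ≤ G := by
          rw [← Finset.sum_mul]
          nlinarith
  -- The weights are `1/M` for FedOSGD, where the sum of squares is `1/M` and yields the gain from
  -- collaboration, and an indicator for the baseline, where it is 1.
  have hν2 : ∀ t < T, ∫ ω, ‖ν t ω‖ ^ 2 ∂P ≤ (∑ m, a m ^ 2) * s := by
    intro t ht
    have h := hg.integral_normSq_sum_noise_le hd hG hδ K η ({t} ×ˢ Finset.univ)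
      (fun p hp => by rwa [Finset.mem_singleton.1 (Finset.mem_product.1 hp).1]) (fun p => a p.2)
    simpa [Finset.sum_product, hs] using h
  have hsum2 : ∫ ω, ‖∑ t ∈ Finset.range T, ν t ω‖ ^ 2 ∂P ≤ T * (∑ m, a m ^ 2) * s := by
    have h := hg.integral_normSq_sum_noise_le hd hG hδ K η (Finset.range T ×ˢ Finset.univ)
      (fun p hp => by simpa using hp) (fun p => a p.2)
    simpa [Finset.sum_product, hs] using h
  have hγ2 : ∀ t < T, ∫ ω, ‖γ t ω‖ ^ 2 ∂P ≤ 2 * G ^ 2 + 2 * ((∑ m, a m ^ 2) * s) := by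
    intro t ht
    have i1 : Integrable (fun ω => 2 * ‖ν t ω‖ ^ 2) P :=
      ((hνL t ht).integrable_norm_pow two_ne_zero).const_mul 2
    have h1 : ∫ ω, ‖γ t ω‖ ^ 2 ∂P ≤ ∫ ω, (2 * G ^ 2 + 2 * ‖ν t ω‖ ^ 2) ∂P := by
      refine integral_mono ((hγL t ht).integrable_norm_pow two_ne_zero)
        ((integrable_const _).add i1) fun ω => ?_
      simp only [hsplit]
      have h2 := norm_add_le (e t ω) (ν t ω)
      have h3 := heb t ht ω
      have h4 := norm_nonneg (e t ω)
      have h5 := norm_nonneg (ν t ω)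
      have h6 : ‖e t ω + ν t ω‖ ^ 2 ≤ (G + ‖ν t ω‖) ^ 2 :=
        pow_le_pow_left₀ (norm_nonneg _) (h2.trans (by linarith)) 2
      nlinarith [sq_nonneg (G - ‖ν t ω‖)]
    refine h1.trans ?_
    rw [integral_add (integrable_const _) i1, integral_const, probReal_univ, one_smul,
      integral_const_mul]
    linarith [hν2 t ht]
  -- The weighted iterate is determined by the past, unlike the comparator.
  have hzero : ∀ t < T, ∫ ω, inner ℝ (z t ω) (ν t ω) ∂P = 0 := by
    intro t ht
    have h1 : ∀ ω, inner ℝ (z t ω) (ν t ω) =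
        ∑ m, a m * inner ℝ (z t ω) (noise K η δ f u t m ω) := by
      intro ω
      simp only [hν, inner_sum, inner_smul_right]
    simp_rw [h1]
    rw [integral_finsetSum _ fun m _ => (integrable_inner_of_memLp (hzL t ht)
      (hg.memLp_noise hd hG hδ K η ht m)).const_mul _]
    refine Finset.sum_eq_zero fun m _ => ?_
    rw [integral_const_mul]
    have hzm : Measurable[jointHistory f u t m] (z t) := by
      refine Finset.measurable_sum _ fun n _ => ?_
      have h2 : Measurable[jointHistory f u t m] (iter K η δ f u t n) :=
        (hg.measurable_iter_of_le K η δ le_rfl ht.le n).mono le_sup_left le_rfl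
      exact h2.const_smul (a n)
    have hzb : ∀ᵐ ω ∂P, ‖z t ω‖ ≤ ∑ n, ‖a n‖ * (t * (|η| * (d * G))) := by
      filter_upwards [hg.ae_norm_dir] with ω hω
      refine (norm_sum_le _ _).trans (Finset.sum_le_sum fun n _ => ?_)
      rw [norm_smul]
      exact mul_le_mul_of_nonneg_left (hg.norm_iter_le hδ K η hω ht.le n) (norm_nonneg _)
    rw [hg.integral_inner_noise hd hG hδ K η ht m hzm hzb, mul_zero]
  have iγ : Integrable (fun ω => ∑ t ∈ Finset.range T, ‖γ t ω‖ ^ 2) P :=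
    integrable_finsetSum _ fun t ht =>
      (hγL t (Finset.mem_range.1 ht)).integrable_norm_pow two_ne_zero
  have izν : Integrable (fun ω => ∑ t ∈ Finset.range T, inner ℝ (z t ω) (ν t ω)) P :=
    integrable_finsetSum _ fun t ht => integrable_inner_of_memLp (hzL t (Finset.mem_range.1 ht))
      (hνL t (Finset.mem_range.1 ht))
  have isum : Integrable (fun ω => ‖∑ t ∈ Finset.range T, ν t ω‖) P :=
    (hsumL.integrable (by norm_num)).norm
  have j1 : Integrable (fun ω => B ^ 2 / (2 * η) + η / 2 * ∑ t ∈ Finset.range T, ‖γ t ω‖ ^ 2) P :=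
    (integrable_const _).add (iγ.const_mul _)
  have j2 : Integrable (fun ω => B ^ 2 / (2 * η) + η / 2 * ∑ t ∈ Finset.range T, ‖γ t ω‖ ^ 2 -
      ∑ t ∈ Finset.range T, inner ℝ (z t ω) (ν t ω)) P := j1.sub izν
  -- The comparator may depend on all errors, so its term is not centred; only its norm bound is
  -- used, against the norm of the total error. The resulting bound is the same for all comparators
  -- in the ball.
  refine ⟨fun ω => B ^ 2 / (2 * η) + η / 2 * ∑ t ∈ Finset.range T, ‖γ t ω‖ ^ 2 -
    ∑ t ∈ Finset.range T, inner ℝ (z t ω) (ν t ω) + B * ‖∑ t ∈ Finset.range T, ν t ω‖,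
    j2.add (isum.const_mul B), fun ω y hy => ?_, ?_⟩
  · have h1 : ∑ t ∈ Finset.range T, ∑ m, a m * inner ℝ (∑ n, a n • iter K η δ f u t n ω - y)
        (drift K η δ f u t m ω) = ∑ t ∈ Finset.range T, (inner ℝ (z t ω - y) (γ t ω) -
          inner ℝ (z t ω) (ν t ω) + inner ℝ y (ν t ω)) := by
      refine Finset.sum_congr rfl fun t _ => ?_
      have h2 : ∑ m, a m * inner ℝ (z t ω - y) (drift K η δ f u t m ω) =
          inner ℝ (z t ω - y) (e t ω) := by
        simp only [he, inner_sum, inner_smul_right]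
      rw [h2, hsplit, inner_add_right, inner_sub_left (z t ω) y (ν t ω)]
      ring
    rw [h1, Finset.sum_add_distrib, Finset.sum_sub_distrib, ← inner_sum]
    have h3 := sum_inner_le_of_gradient_step hη (z := fun t => z t ω) (γ := fun t => γ t ω)
      (by simp [hz, iter_zero]) (fun t ht => hrec ω t ht) y
    have h4 : ‖y‖ ^ 2 / (2 * η) ≤ B ^ 2 / (2 * η) := by gcongr
    have h5 : inner ℝ y (∑ t ∈ Finset.range T, ν t ω) ≤ B * ‖∑ t ∈ Finset.range T, ν t ω‖ :=
      (real_inner_le_norm _ _).trans (by gcongr)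
    linarith
  · rw [integral_add j2 (isum.const_mul B), integral_sub j1 izν,
      integral_add (integrable_const _) (iγ.const_mul _), integral_const_mul, integral_const_mul,
      integral_finsetSum _ fun t ht => (hγL t (Finset.mem_range.1 ht)).integrable_norm_pow
        two_ne_zero,
      integral_finsetSum _ fun t ht => integrable_inner_of_memLp (hzL t (Finset.mem_range.1 ht))
        (hνL t (Finset.mem_range.1 ht)),
      Finset.sum_eq_zero fun t ht => hzero t (Finset.mem_range.1 ht)]
    have h1 : ∑ t ∈ Finset.range T, ∫ ω, ‖γ t ω‖ ^ 2 ∂P ≤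
        T * (2 * G ^ 2 + 2 * ((∑ m, a m ^ 2) * s)) := by
      refine (Finset.sum_le_sum fun t ht => hγ2 t (Finset.mem_range.1 ht)).trans_eq ?_
      rw [Finset.sum_const, Finset.card_range, nsmul_eq_mul]
    have h2 := integral_norm_le_sqrt hsumL hsum2
    have h3 := mul_le_mul_of_nonneg_left h1 (by positivity : 0 ≤ η / 2)
    have h4 := mul_le_mul_of_nonneg_left h2 hB
    simp only [integral_const, probReal_univ, one_smul, sub_zero]
    linarith

/-- The comparator enters only through its total cost, which is the minimum over the ball and hence
measurable. Boundedness comes from the crude bound on the iterates. -/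
theorem integrable_avgRegret (hg : IsAdaptiveGame P G T f u) (hG : 0 ≤ G) {δ : ℝ}
    (hδ : 0 < δ) (K : ℕ) (η : ℝ) {B : ℝ} (hB : 0 ≤ B) {y : Ω → Vec d}
    (hy : ∀ ω, IsBestInBall T B (fun t m => f t m ω) (y ω)) :
    Integrable (fun ω => avgRegret T δ (fun t m => f t m ω) (fun t m => u t m ω)
      (fun t m => iter K η δ f u t m ω) (y ω)) P := by
  have hmin : Measurable fun ω => ∑ t ∈ Finset.range T, ∑ m, f t m ω (y ω) := by
    refine measurable_min_on_ball (Φ := fun ω x => ∑ t ∈ Finset.range T, ∑ m, f t m ω x)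
      (fun ω => ?_) (fun x => ?_) hB (fun ω => (hy ω).1) (fun ω => (hy ω).2)
    · exact continuous_finsetSum _ fun t ht => continuous_finsetSum _ fun m _ =>
        hg.continuous_cost (Finset.mem_range.1 ht) m ω
    · exact Finset.measurable_sum _ fun t ht => Finset.measurable_sum _ fun m _ =>
        hg.measurable_cost t (Finset.mem_range.1 ht) m x
  have heq : ∀ ω, avgRegret T δ (fun t m => f t m ω) (fun t m => u t m ω)
      (fun t m => iter K η δ f u t m ω) (y ω) = 1 / (2 * (M : ℝ) * (T : ℝ)) *
        (∑ t ∈ Finset.range T, ∑ m, (f t m ω (iter K η δ f u t m ω + δ • u t m ω) +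
          f t m ω (iter K η δ f u t m ω - δ • u t m ω)) -
          2 * ∑ t ∈ Finset.range T, ∑ m, f t m ω (y ω)) := by
    intro ω
    rw [avgRegret]
    congr 1
    rw [Finset.mul_sum, ← Finset.sum_sub_distrib]
    refine Finset.sum_congr rfl fun t _ => ?_
    rw [Finset.mul_sum, ← Finset.sum_sub_distrib]
    exact Finset.sum_congr rfl fun m _ => by ring
  have hmeas : Measurable fun ω => avgRegret T δ (fun t m => f t m ω) (fun t m => u t m ω)
      (fun t m => iter K η δ f u t m ω) (y ω) := by
    simp_rw [heq]
    refine ((Finset.measurable_sum _ fun t ht => Finset.measurable_sum _ fun m _ => ?_).sub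
      (hmin.const_mul 2)).const_mul _
    have ht := Finset.mem_range.1 ht
    have hx := hg.measurable_iter K η δ ht m
    have hu := (hg.measurable_dir t ht m).const_smul δ
    exact (measurable_cost_comp (hg.continuous_cost ht m) (hg.measurable_cost t ht m)
      (hx.add hu) measurable_id).add (measurable_cost_comp (hg.continuous_cost ht m)
      (hg.measurable_cost t ht m) (hx.sub hu) measurable_id)
  refine Integrable.of_bound (C := |1 / (2 * (M : ℝ) * (T : ℝ))| * ∑ t ∈ Finset.range T,
    ∑ _m : Fin M, 2 * (G * (t * (|η| * (d * G)) + δ + B))) hmeas.aestronglyMeasurable ?_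
  filter_upwards [hg.ae_norm_dir] with ω hω
  rw [avgRegret, Real.norm_eq_abs, abs_mul]
  refine mul_le_mul_of_nonneg_left ?_ (abs_nonneg _)
  refine (Finset.abs_sum_le_sum_abs _ _).trans (Finset.sum_le_sum fun t ht => ?_)
  refine (Finset.abs_sum_le_sum_abs _ _).trans (Finset.sum_le_sum fun m _ => ?_)
  have ht := Finset.mem_range.1 ht
  have hx := hg.norm_iter_le hδ K η hω ht.le m
  have hyB := (hy ω).1
  have hb : ∀ w : Vec d, ‖w‖ ≤ δ → |f t m ω (iter K η δ f u t m ω + w) - f t m ω (y ω)| ≤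
      G * (t * (|η| * (d * G)) + δ + B) := by
    intro w hw
    refine ((hg.cost t ht m ω).lipschitz _ _).trans (mul_le_mul_of_nonneg_left ?_ hG)
    have := norm_sub_le (iter K η δ f u t m ω + w) (y ω)
    have := norm_add_le (iter K η δ f u t m ω) w
    linarith
  have hv : ‖δ • u t m ω‖ ≤ δ := by
    rw [norm_smul, hω t ht m, mul_one, Real.norm_of_nonneg hδ.le]
  have h1 := hb (δ • u t m ω) hv
  have h2 := hb (-(δ • u t m ω)) (by rwa [norm_neg])
  rw [← sub_eq_add_neg] at h2
  refine (abs_add_le _ _).trans ?_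
  linarith

end IsAdaptiveGame

/-! ### Step sizes and rates -/

theorem sqrt_sqrt_eq_rpow {x : ℝ} (hx : 0 ≤ x) : √√x = x ^ (1 / 4 : ℝ) := by
  rw [Real.sqrt_eq_rpow, Real.sqrt_eq_rpow, ← Real.rpow_mul hx]
  norm_num

/-- The factor by which the step size of FedOSGD is smaller than `B/(G√(KR))`. -/
theorem exists_fedStep_factor {G B : ℝ} {d M K R : ℕ} (hd : 1 ≤ d) (hM : 1 ≤ M) (hK : 1 ≤ K) :
    ∃ μ : ℝ, fedStep G B d M K R = B / (G * √((K : ℝ) * R)) * μ ∧ 0 < μ ∧ μ ≤ 1 ∧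
      μ ≤ √(M : ℝ) / √(d : ℝ) ∧ (1 < K → μ ≤ 1 / (√(K : ℝ) * √√(d : ℝ))) ∧
      1 / μ ≤ 1 + √(d : ℝ) / √(M : ℝ) + if 1 < K then √(K : ℝ) * √√(d : ℝ) else 0 := by
  have hd' : (0 : ℝ) < d := by exact_mod_cast hd
  have hM' : (0 : ℝ) < M := by exact_mod_cast hM
  have hK' : (0 : ℝ) < K := by exact_mod_cast hK
  have h1 : 0 < √(M : ℝ) / √(d : ℝ) := by positivity
  have h2 : 0 < √(d : ℝ) / √(M : ℝ) := by positivity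
  have h3 : 0 < √(K : ℝ) * √√(d : ℝ) := by positivity
  have h4 : 1 / (√(M : ℝ) / √(d : ℝ)) = √(d : ℝ) / √(M : ℝ) := one_div_div _ _
  refine ⟨_, rfl, ?_⟩
  rw [← sqrt_sqrt_eq_rpow hd'.le]
  split_ifs with h
  · refine ⟨by positivity, (min_le_left _ _).trans (min_le_left _ _),
      (min_le_left _ _).trans (min_le_right _ _), fun _ => min_le_right _ _, ?_⟩
    -- The reciprocal of the minimum is the reciprocal of one entry, hence at most the sum of all
    -- three.
    rcases min_choice (min 1 (√(M : ℝ) / √(d : ℝ))) (1 / (√(K : ℝ) * √√(d : ℝ))) with h5 | h5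
    · rw [h5]
      rcases min_choice 1 (√(M : ℝ) / √(d : ℝ)) with h6 | h6 <;> rw [h6]
      · rw [one_div_one]; linarith
      · rw [h4]; linarith
    · rw [h5, one_div_one_div]; linarith
  · refine ⟨by positivity, min_le_left _ _, min_le_right _ _, fun h' => absurd h' h, ?_⟩
    rcases min_choice 1 (√(M : ℝ) / √(d : ℝ)) with h6 | h6 <;> rw [h6]
    · rw [one_div_one]; linarith
    · rw [h4]; linarith

theorem fedStep_pos {G B : ℝ} (hG : 0 < G) (hB : 0 < B) {d M K R : ℕ} (hd : 1 ≤ d) (hM : 1 ≤ M)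
    (hK : 1 ≤ K) (hR : 1 ≤ R) : 0 < fedStep G B d M K R := by
  obtain ⟨μ, h, h0, -⟩ := exists_fedStep_factor (G := G) (B := B) (R := R) hd hM hK
  have hK' : (0 : ℝ) < K := by exact_mod_cast hK
  have hR' : (0 : ℝ) < R := by exact_mod_cast hR
  rw [h]
  positivity

theorem sqrt_mul_le_five_mul {x y : ℝ} (hy : 0 ≤ y) (h : x ≤ 23 * y ^ 2) : √x ≤ 5 * y :=
  Real.sqrt_le_iff.2 ⟨by positivity, by nlinarith [sq_nonneg y]⟩

/-- The price of the local steps, with `k = √K`, `r = √R` and `D = d^{1/4}`. The conditional means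
contribute a multiple of `1/D` and the errors a multiple of `D/k`; both are at most `D`, with
constants `2 + 10`. -/
theorem drift_term_le {G B k r D η : ℝ} (hG : 0 < G) (hB : 0 < B) (hk : 1 ≤ k) (hr : 1 ≤ r)
    (hD : 1 ≤ D) (hη : η ≤ B / (G * (k * r)) * (1 / (k * D))) :
    G * (2 * (η * ((k ^ 2 - 1) * G + √((k ^ 2 - 1) * (23 * D ^ 4 * G ^ 2))))) ≤
      12 * (G * B * D / r) := by
  have hk2 : 0 ≤ k ^ 2 - 1 := by nlinarith
  have e1 : √((k ^ 2 - 1) * (23 * D ^ 4 * G ^ 2)) ≤ 5 * (k * D ^ 2 * G) := by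
    refine sqrt_mul_le_five_mul (by positivity) ?_
    have : 0 ≤ D ^ 4 * G ^ 2 := by positivity
    linarith [show 23 * (k * D ^ 2 * G) ^ 2 =
      (k ^ 2 - 1) * (23 * D ^ 4 * G ^ 2) + 23 * (D ^ 4 * G ^ 2) by ring]
  have e2 : (k ^ 2 - 1) * G ≤ k ^ 2 * G := by linarith
  have e4 : 0 ≤ (k ^ 2 - 1) * G := mul_nonneg hk2 hG.le
  have hr0 : 0 < r := by linarith
  have hk0 : 0 < k := by linarith
  have hD0 : 0 < D := by linarith
  have h1 : 1 / D ≤ D := by rw [div_le_iff₀ hD0]; nlinarith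
  have h2 : 1 / k ≤ 1 := by rw [div_le_iff₀ hk0]; linarith
  have h3 : 0 ≤ G * B / r := by positivity
  have h4 : 0 ≤ G * B * D / r := by positivity
  calc G * (2 * (η * ((k ^ 2 - 1) * G + √((k ^ 2 - 1) * (23 * D ^ 4 * G ^ 2)))))
      ≤ G * (2 * (B / (G * (k * r)) * (1 / (k * D)) * (k ^ 2 * G + 5 * (k * D ^ 2 * G)))) := by
        gcongr
    _ = 2 * (G * B / r * (1 / D)) + 10 * (G * B * D / r * (1 / k)) := by field_simp; ring
    _ ≤ 2 * (G * B / r * D) + 10 * (G * B * D / r * 1) := by gcongr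
    _ = _ := by ring

/-- Each entry of the minimum in the step size controls one growing term, and the initial distance
pays the sum of their reciprocals, which reproduces the three terms of the rate. For `K = 1` the
price of the local steps is zero. -/
theorem fed_terms_le_fedRate {G B : ℝ} (hG : 0 < G) (hB : 0 < B) {d M K R : ℕ} (hd : 1 ≤ d)
    (hM : 1 ≤ M) (hK : 1 ≤ K) (hR : 1 ≤ R) {η : ℝ} (hη : η = fedStep G B d M K R) :
    1 / ((K : ℝ) * R) * (B ^ 2 / (2 * η) + η * (K * R) * (G ^ 2 + 1 / M * (23 * d * G ^ 2)) +
      B * √(K * R * (1 / M) * (23 * d * G ^ 2))) +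
      G * (2 * (η * ((K - 1) * G + √((K - 1) * (23 * d * G ^ 2))))) ≤
      40 * fedRate G B d M K R := by
  obtain ⟨μ, h, h0, h1, h2, h3, h4⟩ := exists_fedStep_factor (G := G) (B := B) (R := R) hd hM hK
  rw [← hη] at h
  have hd' : (1 : ℝ) ≤ d := by exact_mod_cast hd
  have hM' : (1 : ℝ) ≤ M := by exact_mod_cast hM
  have hK' : (1 : ℝ) ≤ K := by exact_mod_cast hK
  have hR' : (1 : ℝ) ≤ R := by exact_mod_cast hR
  set D := √√(d : ℝ) with hD
  set k := √(K : ℝ) with hk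
  set r := √(R : ℝ) with hr
  set q := √(M : ℝ) with hq
  have hD1 : 1 ≤ D := Real.one_le_sqrt.2 (Real.one_le_sqrt.2 hd')
  have hk1 : 1 ≤ k := Real.one_le_sqrt.2 hK'
  have hr1 : 1 ≤ r := Real.one_le_sqrt.2 hR'
  have hq1 : 1 ≤ q := Real.one_le_sqrt.2 hM'
  have eK : (K : ℝ) = k ^ 2 := (Real.sq_sqrt (by linarith)).symm
  have eR : (R : ℝ) = r ^ 2 := (Real.sq_sqrt (by linarith)).symm
  have eM : (M : ℝ) = q ^ 2 := (Real.sq_sqrt (by linarith)).symm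
  have esd : √(d : ℝ) = D ^ 2 := (Real.sq_sqrt (Real.sqrt_nonneg _)).symm
  have ed : (d : ℝ) = D ^ 4 := by
    rw [show D ^ 4 = (D ^ 2) ^ 2 by ring, ← esd, Real.sq_sqrt (by linarith)]
  have eKR : √((K : ℝ) * R) = k * r := Real.sqrt_mul (by linarith) _
  have eMKR : √((M : ℝ) * K * R) = q * k * r := by
    rw [Real.sqrt_mul (by positivity), Real.sqrt_mul (by linarith)]
  rw [fedRate, ← sqrt_sqrt_eq_rpow (by linarith), ← hD, eKR, eMKR, esd, ← hr]
  rw [esd] at h2 h4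
  rw [eKR] at h
  have hDp : 0 < D := by linarith
  have hkp : 0 < k := by linarith
  have hrp : 0 < r := by linarith
  have hqp : 0 < q := by linarith
  have t1 : 1 / ((K : ℝ) * R) * (B ^ 2 / (2 * η)) ≤ 1 / 2 * (G * B / (k * r) +
      G * B * D ^ 2 / (q * k * r) + if 1 < K then G * B * D / r else 0) := by
    have e1 : 1 / ((K : ℝ) * R) * (B ^ 2 / (2 * η)) = G * B / (2 * (k * r)) * (1 / μ) := by
      rw [h, eK, eR]; field_simp
    rw [e1]
    refine (mul_le_mul_of_nonneg_left h4 (by positivity)).trans_eq ?_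
    split_ifs
    · field_simp
    · rw [add_zero, add_zero]; field_simp
  have t2 : η * G ^ 2 ≤ G * B / (k * r) := by
    have e1 : η * G ^ 2 = G * B / (k * r) * μ := by rw [h]; field_simp
    rw [e1]
    exact mul_le_of_le_one_right (by positivity) h1
  have t3 : η * (1 / M * (23 * d * G ^ 2)) ≤ 23 * (G * B * D ^ 2 / (q * k * r)) := by
    have e1 : η * (1 / M * (23 * d * G ^ 2)) = 23 * (G * B * D ^ 4 / (q ^ 2 * (k * r))) * μ := by
      rw [h, eM, ed]; field_simp
    rw [e1]
    refine (mul_le_mul_of_nonneg_left h2 (by positivity)).trans_eq ?_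
    field_simp
  have t4 : 1 / ((K : ℝ) * R) * (B * √(K * R * (1 / M) * (23 * d * G ^ 2))) ≤
      5 * (G * B * D ^ 2 / (q * k * r)) := by
    have e1 : √(K * R * (1 / M) * (23 * d * G ^ 2)) ≤ 5 * (k * r / q * D ^ 2 * G) :=
      sqrt_mul_le_five_mul (by positivity) (le_of_eq (by rw [eK, eR, eM, ed]; field_simp))
    calc 1 / ((K : ℝ) * R) * (B * √(K * R * (1 / M) * (23 * d * G ^ 2)))
        ≤ 1 / ((K : ℝ) * R) * (B * (5 * (k * r / q * D ^ 2 * G))) := by gcongr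
      _ = _ := by rw [eK, eR]; field_simp
  have t5 : G * (2 * (η * ((K - 1) * G + √((K - 1) * (23 * d * G ^ 2))))) ≤
      12 * if 1 < K then G * B * D / r else 0 := by
    split_ifs with hK1
    · rw [eK, ed]
      refine drift_term_le hG hB hk1 hr1 hD1 ?_
      rw [h]
      exact mul_le_mul_of_nonneg_left (h3 hK1) (by positivity)
    · have : K = 1 := by omega
      subst this
      simp
  have hKR : (0 : ℝ) < K * R := by positivity
  have e0 : 1 / ((K : ℝ) * R) * (B ^ 2 / (2 * η) + η * (K * R) * (G ^ 2 + 1 / M *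
      (23 * d * G ^ 2)) + B * √(K * R * (1 / M) * (23 * d * G ^ 2))) =
      1 / ((K : ℝ) * R) * (B ^ 2 / (2 * η)) + (η * G ^ 2 + η * (1 / M * (23 * d * G ^ 2))) +
      1 / ((K : ℝ) * R) * (B * √(K * R * (1 / M) * (23 * d * G ^ 2))) := by
    field_simp
  rw [e0]
  have p1 : 0 ≤ G * B / (k * r) := by positivity
  have p2 : 0 ≤ G * B * D ^ 2 / (q * k * r) := by positivity
  have p3 : 0 ≤ if 1 < K then G * B * D / r else 0 := by split_ifs <;> positivity
  linarith

/-- Two terms agree exactly; for the third, the hypothesis says `√K ≤ a^{1/4} d^{1/4}`, which trades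
the missing `√K` in the denominator for the missing `d^{1/4}` in the numerator. -/
theorem fedRate_le_ncRate {a : ℝ} (ha : 0 < a) {d M K R : ℕ} (hd : 1 ≤ d) (hM : 1 ≤ M)
    (hK : 1 ≤ K) (hR : 1 ≤ R) {G B : ℝ} (hG : 0 < G) (hB : 0 < B) (h : (K : ℝ) ^ 2 ≤ a * d) :
    fedRate G B d M K R ≤
      (1 / √(d : ℝ) + 1 / √(M : ℝ) + a ^ (1 / 4 : ℝ)) * ncRate G B d (K * R) := by
  have hd' : (0 : ℝ) < d := by exact_mod_cast hd
  have hM' : (0 : ℝ) < M := by exact_mod_cast hM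
  have hK' : (0 : ℝ) < K := by exact_mod_cast hK
  have hR' : (0 : ℝ) < R := by exact_mod_cast hR
  rw [fedRate, ncRate, ← sqrt_sqrt_eq_rpow hd'.le, ← sqrt_sqrt_eq_rpow ha.le, Nat.cast_mul,
    add_mul, add_mul, mul_assoc (M : ℝ), Real.sqrt_mul hM'.le]
  have h1 : √(K : ℝ) ≤ √√a * √√(d : ℝ) := by
    rw [← Real.sqrt_mul (Real.sqrt_nonneg _), ← Real.sqrt_mul ha.le]
    exact Real.sqrt_le_sqrt (Real.le_sqrt_of_sq_le h)
  have esd : √(d : ℝ) = √√(d : ℝ) ^ 2 := (Real.sq_sqrt (Real.sqrt_nonneg _)).symm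
  refine add_le_add (add_le_add (le_of_eq ?_) (le_of_eq ?_)) ?_
  · field_simp
  · field_simp
  · have h2 : 0 ≤ √√a * (G * B * √(d : ℝ) / √((K : ℝ) * R)) := by positivity
    split_ifs
    · rw [Real.sqrt_mul hK'.le]
      have h3 : G * B * √√(d : ℝ) / √(R : ℝ) =
          √(K : ℝ) * (G * B * √√(d : ℝ) / (√(K : ℝ) * √(R : ℝ))) := by
        field_simp
      rw [h3]
      refine (mul_le_mul_of_nonneg_right h1 (by positivity)).trans_eq ?_
      linear_combination -(√√a * G * B / (√(K : ℝ) * √(R : ℝ))) * esd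
    · exact h2

/-! ### Averaging rounds and the regret of the two methods -/

section Consensus

variable {Ω : Type*} {d M : ℕ} {f : ℕ → Fin M → Ω → Vec d → ℝ} {u : ℕ → Fin M → Ω → Vec d}

/-- Replacing all machines by their average leaves the average unchanged, so communication is
invisible to it. -/
theorem sum_inv_smul_iter_succ (K : ℕ) (η δ : ℝ) (t : ℕ) (ω : Ω) :
    ∑ m, (1 / M : ℝ) • iter K η δ f u (t + 1) m ω =
      ∑ m, (1 / M : ℝ) • iter K η δ f u t m ω - η • ∑ m, (1 / M : ℝ) • est K η δ f u t m ω := by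
  simp only [iter_succ]
  rcases Nat.eq_zero_or_pos M with rfl | hM
  · simp
  have hM' : (M : ℝ) ≠ 0 := by exact_mod_cast hM.ne'
  split_ifs
  · rw [Finset.sum_const, Finset.card_univ, Fintype.card_fin, ← Nat.cast_smul_eq_nsmul ℝ, smul_smul,
      mul_one_div_cancel hM', one_smul, Finset.sum_sub_distrib, smul_sub, ← Finset.smul_sum,
      ← Finset.smul_sum, ← Finset.smul_sum, one_div, smul_comm η]
  · simp only [smul_sub, Finset.sum_sub_distrib, Finset.smul_sum, smul_comm η]

theorem iter_mul_eq (K : ℕ) (hK : 1 ≤ K) (η δ : ℝ) (q : ℕ) (m n : Fin M) (ω : Ω) :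
    iter K η δ f u (K * q) m ω = iter K η δ f u (K * q) n ω := by
  rcases Nat.eq_zero_or_pos q with rfl | hq
  · simp [iter_zero]
  · obtain ⟨s, hs⟩ := Nat.exists_eq_succ_of_ne_zero (Nat.mul_pos hK hq).ne'
    have : (s + 1) % K = 0 := by rw [← Nat.succ_eq_add_one, ← hs, Nat.mul_mod_right]
    rw [hs, Nat.succ_eq_add_one, iter_succ, iter_succ, if_pos this, if_pos this]

theorem iter_add_eq (K : ℕ) (η δ : ℝ) (q j : ℕ) (hj : j < K) (m : Fin M) (ω : Ω) :
    iter K η δ f u (K * q + j) m ω = iter K η δ f u (K * q) m ω -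
      η • ∑ i ∈ Finset.range j, est K η δ f u (K * q + i) m ω := by
  induction j with
  | zero => simp
  | succ j ih =>
    have h : (K * q + j + 1) % K ≠ 0 := by
      rw [add_assoc, Nat.mul_add_mod, Nat.mod_eq_of_lt hj]; omega
    rw [← add_assoc, iter_succ, if_neg h, ih (by omega), Finset.sum_range_succ, smul_add]
    abel

end Consensus

namespace IsAdaptiveGame

variable {Ω : Type*} {d M : ℕ} {m₀ : MeasurableSpace Ω} {P : Measure Ω}
  {G : ℝ} {T : ℕ} {f : ℕ → Fin M → Ω → Vec d → ℝ} {u : ℕ → Fin M → Ω → Vec d}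

theorem avgRegret_le (hg : IsAdaptiveGame P G T f u) (hd : 1 ≤ d) (hM : 1 ≤ M) (hT : 1 ≤ T)
    (hG : 0 ≤ G) {δ : ℝ} (hδ : 0 < δ) (K : ℕ) (η : ℝ) {ω : Ω}
    (hω : ∀ t < T, ∀ m, ‖u t m ω‖ = 1) (y : Vec d) :
    avgRegret T δ (fun t m => f t m ω) (fun t m => u t m ω)
      (fun t m => iter K η δ f u t m ω) y ≤ 1 / ((M : ℝ) * T) * ∑ t ∈ Finset.range T, ∑ m,
        inner ℝ (iter K η δ f u t m ω - y) (drift K η δ f u t m ω) + 3 * (G * δ) := by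
  have hM' : (0 : ℝ) < M := by exact_mod_cast hM
  have hT' : (0 : ℝ) < T := by exact_mod_cast hT
  rw [avgRegret]
  have h := Finset.sum_le_sum fun t (ht : t ∈ Finset.range T) =>
    Finset.sum_le_sum fun m (_ : m ∈ Finset.univ) =>
      hg.two_point_cost_le hd hG hδ K η (Finset.mem_range.1 ht) m
        (hω t (Finset.mem_range.1 ht) m) y
  refine (mul_le_mul_of_nonneg_left h (by positivity)).trans_eq ?_
  simp only [Finset.sum_add_distrib, ← Finset.mul_sum, Finset.sum_const, Finset.card_univ,
    Fintype.card_fin, Finset.card_range, nsmul_eq_mul]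
  field_simp
  ring

variable [IsProbabilityMeasure P]

/-- The bounded conditional means add up linearly in the number of steps, but the orthogonal errors,
which carry the dimension, only as its square root. -/
theorem integral_norm_sum_est_le (hg : IsAdaptiveGame P G T f u) (hd : 1 ≤ d) (hG : 0 ≤ G)
    {δ : ℝ} (hδ : 0 < δ) (K : ℕ) (η : ℝ) (s j : ℕ) (hj : s + j ≤ T) (m : Fin M) :
    Integrable (fun ω => ‖∑ i ∈ Finset.range j, est K η δ f u (s + i) m ω‖) P ∧
    ∫ ω, ‖∑ i ∈ Finset.range j, est K η δ f u (s + i) m ω‖ ∂P ≤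
      j * G + √(j * (23 * d * G ^ 2)) := by
  have hlt : ∀ i ∈ Finset.range j, s + i < T := fun i hi => by
    have := Finset.mem_range.1 hi; omega
  have hν : MemLp (fun ω => ∑ i ∈ Finset.range j, noise K η δ f u (s + i) m ω) 2 P :=
    memLp_finsetSum _ fun i hi => hg.memLp_noise hd hG hδ K η (hlt i hi) m
  have hν2 : ∫ ω, ‖∑ i ∈ Finset.range j, noise K η δ f u (s + i) m ω‖ ^ 2 ∂P ≤
      j * (23 * d * G ^ 2) := by
    have h := integral_normSq_sum_le (P := P) (ξ := fun i => noise K η δ f u (s + i) m)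
      (Finset.range j) (fun i hi => hg.memLp_noise hd hG hδ K η (hlt i hi) m)
      (fun i hi k hk hik => hg.integral_inner_noise_noise hd hG hδ K η (hlt i hi) (hlt k hk)
        (fun h => hik (by simpa using congrArg Prod.fst h)))
      (fun i hi => hg.integral_normSq_noise_le hd hG hδ K η (hlt i hi) m) (fun _ => 1)
    simpa using h
  have hpt : ∀ ω, ‖∑ i ∈ Finset.range j, est K η δ f u (s + i) m ω‖ ≤
      j * G + ‖∑ i ∈ Finset.range j, noise K η δ f u (s + i) m ω‖ := by
    intro ω
    have h1 : ∑ i ∈ Finset.range j, est K η δ f u (s + i) m ω =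
        ∑ i ∈ Finset.range j, drift K η δ f u (s + i) m ω +
        ∑ i ∈ Finset.range j, noise K η δ f u (s + i) m ω := by
      rw [← Finset.sum_add_distrib]
      exact Finset.sum_congr rfl fun i _ => by simp [noise]
    rw [h1]
    refine (norm_add_le _ _).trans (add_le_add_left ?_ _)
    refine (norm_sum_le _ _).trans ((Finset.sum_le_sum fun i hi =>
      hg.norm_drift_le hd hG hδ K η (hlt i hi) m ω).trans_eq ?_)
    rw [Finset.sum_const, Finset.card_range, nsmul_eq_mul]
  have hi := (hν.integrable (by norm_num)).norm
  have hI : Integrable (fun ω => (j : ℝ) * G +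
      ‖∑ i ∈ Finset.range j, noise K η δ f u (s + i) m ω‖) P := (integrable_const _).add hi
  have hE : Integrable (fun ω => ‖∑ i ∈ Finset.range j, est K η δ f u (s + i) m ω‖) P := by
    refine hI.mono' (Finset.measurable_sum _ fun i hi =>
      hg.measurable_est K η δ (hlt i hi) m).norm.aestronglyMeasurable (.of_forall fun ω => ?_)
    rw [norm_norm]
    exact hpt ω
  refine ⟨hE, (integral_mono hE hI hpt).trans ?_⟩
  rw [integral_add (integrable_const _) hi, integral_const, probReal_univ, one_smul]
  exact add_le_add_right (integral_norm_le_sqrt hν hν2) _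

/-- The machines of FedOSGD stay close to their average. -/
theorem integral_norm_sub_average_le (hg : IsAdaptiveGame P G T f u) (hd : 1 ≤ d) (hG : 0 ≤ G)
    {δ : ℝ} (hδ : 0 < δ) {K : ℕ} (hK : 1 ≤ K) {η : ℝ} (hη : 0 ≤ η) {t : ℕ} (ht : t < T)
    (m : Fin M) :
    Integrable (fun ω => ‖iter K η δ f u t m ω - ∑ n, (1 / M : ℝ) • iter K η δ f u t n ω‖) P ∧
    ∫ ω, ‖iter K η δ f u t m ω - ∑ n, (1 / M : ℝ) • iter K η δ f u t n ω‖ ∂P ≤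
      2 * (η * ((K - 1) * G + √((K - 1) * (23 * d * G ^ 2)))) := by
  have hM : (M : ℝ) ≠ 0 := by
    have := m.pos
    exact_mod_cast this.ne'
  set q := t / K
  set j := t % K
  have htj : K * q + j = t := Nat.div_add_mod t K
  have hj : j < K := Nat.mod_lt _ hK
  set V : Fin M → Ω → Vec d := fun n ω => ∑ i ∈ Finset.range j, est K η δ f u (K * q + i) n ω
  have hV := fun n => hg.integral_norm_sum_est_le hd hG hδ K η (K * q) j (by omega) n
  -- At most `K - 1` local steps separate `t` from the last common point; the bound thus vanishes
  -- for `K = 1`.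
  have hjK : (j : ℝ) ≤ K - 1 := by
    have : j + 1 ≤ K := hj
    have : ((j + 1 : ℕ) : ℝ) ≤ K := by exact_mod_cast this
    push_cast at this
    linarith
  set D := ((K : ℝ) - 1) * G + √((K - 1) * (23 * d * G ^ 2))
  have hVD : ∀ n, ∫ ω, ‖V n ω‖ ∂P ≤ D := fun n => (hV n).2.trans (by
    change _ ≤ ((K : ℝ) - 1) * G + √((K - 1) * (23 * d * G ^ 2))
    gcongr)
  have hx : ∀ n ω, iter K η δ f u t n ω = iter K η δ f u (K * q) m ω - η • V n ω := by
    intro n ω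
    rw [iter_mul_eq K hK η δ q m n ω, ← iter_add_eq K η δ q j hj n ω, htj]
  have hdiff : ∀ ω, iter K η δ f u t m ω - ∑ n, (1 / M : ℝ) • iter K η δ f u t n ω =
      η • (∑ n, (1 / M : ℝ) • V n ω - V m ω) := by
    intro ω
    simp only [hx, smul_sub, Finset.sum_sub_distrib, Finset.sum_const, Finset.card_univ,
      Fintype.card_fin]
    rw [← Nat.cast_smul_eq_nsmul ℝ, smul_smul, mul_one_div_cancel hM, one_smul]
    have h1 : ∀ n, (1 / M : ℝ) • η • V n ω = η • (1 / M : ℝ) • V n ω := fun n => smul_comm _ _ _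
    simp_rw [h1]
    rw [← Finset.smul_sum]
    abel
  have hpt : ∀ ω, ‖iter K η δ f u t m ω - ∑ n, (1 / M : ℝ) • iter K η δ f u t n ω‖ ≤
      η * (∑ n, (1 / M : ℝ) * ‖V n ω‖ + ‖V m ω‖) := by
    intro ω
    rw [hdiff, norm_smul, Real.norm_of_nonneg hη]
    refine mul_le_mul_of_nonneg_left ((norm_sub_le _ _).trans (add_le_add_left ?_ _)) hη
    refine (norm_sum_le _ _).trans_eq (Finset.sum_congr rfl fun n _ => ?_)
    rw [norm_smul, Real.norm_of_nonneg (by positivity)]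
  have i1 : Integrable (fun ω => ∑ n, (1 / M : ℝ) * ‖V n ω‖) P :=
    integrable_finsetSum _ fun n _ => (hV n).1.const_mul _
  have i2 : Integrable (fun ω => η * (∑ n, (1 / M : ℝ) * ‖V n ω‖ + ‖V m ω‖)) P :=
    (i1.add (hV m).1).const_mul η
  have i3 : Integrable
      (fun ω => ‖iter K η δ f u t m ω - ∑ n, (1 / M : ℝ) • iter K η δ f u t n ω‖) P := by
    refine i2.mono' ((hg.measurable_iter K η δ ht m).sub (Finset.measurable_sum _ fun n _ =>
      (hg.measurable_iter K η δ ht n).const_smul (1 / M : ℝ))).norm.aestronglyMeasurable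
      (.of_forall fun ω => ?_)
    rw [norm_norm]
    exact hpt ω
  refine ⟨i3, (integral_mono i3 i2 hpt).trans ?_⟩
  rw [integral_const_mul, integral_add i1 (hV m).1,
    integral_finsetSum _ fun n _ => (hV n).1.const_mul _]
  simp_rw [integral_const_mul]
  have h1 : ∑ n : Fin M, (1 / M : ℝ) * ∫ ω, ‖V n ω‖ ∂P ≤ D := by
    refine (Finset.sum_le_sum fun n _ => mul_le_mul_of_nonneg_left (hVD n) (by positivity)).trans_eq
      ?_
    rw [Finset.sum_const, Finset.card_univ, Fintype.card_fin, nsmul_eq_mul]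
    field_simp
  nlinarith [hVD m]

/-- The conditional mean is taken at the local point but paired with the average; the mismatch costs
`G` times the distance between the two. The constant is 40 plus 3 from the hypothesis on `G δ`,
rounded up. -/
theorem fed_regret_le (hg : IsAdaptiveGame P G T f u) {B δ : ℝ} {K R : ℕ} (hd : 1 ≤ d)
    (hM : 1 ≤ M) (hK : 1 ≤ K) (hR : 1 ≤ R) (hT : T = K * R) (hG : 0 < G) (hB : 0 < B)
    (hδ : 0 < δ) (hδ' : G * δ ≤ fedRate G B d M K R) {y : Ω → Vec d}
    (hy : ∀ ω, IsBestInBall T B (fun t m => f t m ω) (y ω)) :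
    ∫ ω, avgRegret T δ (fun t m => f t m ω) (fun t m => u t m ω)
      (fun t m => iter K (fedStep G B d M K R) δ f u t m ω) (y ω) ∂P ≤
        50 * fedRate G B d M K R := by
  set η := fedStep G B d M K R with hη
  have hη0 : 0 < η := fedStep_pos hG hB hd hM hK hR
  have hM' : (0 : ℝ) < M := by exact_mod_cast hM
  have hK' : (0 : ℝ) < K := by exact_mod_cast hK
  have hR' : (0 : ℝ) < R := by exact_mod_cast hR
  have hT1 : 1 ≤ T := by rw [hT]; exact Nat.mul_pos hK hR
  have hTc : (T : ℝ) = K * R := by rw [hT]; push_cast; ring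
  have hT' : (0 : ℝ) < T := by exact_mod_cast hT1
  obtain ⟨W, hWi, hW, hWb⟩ := hg.exists_regret_bound hd hG.le hδ K hη0 hB.le
    (a := fun _ => (1 / M : ℝ)) (by simp [hM'.ne'])
    (fun ω t _ => sum_inv_smul_iter_succ K η δ t ω)
  have hsq : ∑ _m : Fin M, (1 / M : ℝ) ^ 2 = 1 / M := by
    rw [Finset.sum_const, Finset.card_univ, Fintype.card_fin, nsmul_eq_mul]
    field_simp
  rw [hsq] at hWb
  set z : ℕ → Ω → Vec d := fun t ω => ∑ n, (1 / M : ℝ) • iter K η δ f u t n ω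
  have hC := fun t (ht : t ∈ Finset.range T) (m : Fin M) =>
    hg.integral_norm_sub_average_le hd hG.le hδ hK hη0.le (Finset.mem_range.1 ht) m
  have i1 : Integrable (fun ω => ∑ t ∈ Finset.range T, ∑ m,
      ‖iter K η δ f u t m ω - z t ω‖) P :=
    integrable_finsetSum _ fun t ht => integrable_finsetSum _ fun m _ => (hC t ht m).1
  have i2 : Integrable (fun ω => 1 / (T : ℝ) * W ω + G / (M * T) * ∑ t ∈ Finset.range T, ∑ m,
      ‖iter K η δ f u t m ω - z t ω‖) P := (hWi.const_mul _).add (i1.const_mul _)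
  have hle : ∀ᵐ ω ∂P, avgRegret T δ (fun t m => f t m ω) (fun t m => u t m ω)
      (fun t m => iter K η δ f u t m ω) (y ω) ≤
      1 / (T : ℝ) * W ω + G / (M * T) * ∑ t ∈ Finset.range T, ∑ m,
        ‖iter K η δ f u t m ω - z t ω‖ + 3 * (G * δ) := by
    filter_upwards [hg.ae_norm_dir] with ω hω
    refine (hg.avgRegret_le hd hM hT1 hG.le hδ K η hω (y ω)).trans (add_le_add_left ?_ _)
    have h1 : ∀ t ∈ Finset.range T, ∀ m ∈ Finset.univ,
        inner ℝ (iter K η δ f u t m ω - y ω) (drift K η δ f u t m ω) ≤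
        M * (1 / M * inner ℝ (z t ω - y ω) (drift K η δ f u t m ω)) +
          G * ‖iter K η δ f u t m ω - z t ω‖ := by
      intro t ht m _
      have h2 : iter K η δ f u t m ω - y ω =
        (z t ω - y ω) + (iter K η δ f u t m ω - z t ω) := by abel
      have h3 := real_inner_le_norm (iter K η δ f u t m ω - z t ω) (drift K η δ f u t m ω)
      have h4 := hg.norm_drift_le hd hG.le hδ K η (Finset.mem_range.1 ht) m ω
      have h5 : (M : ℝ) * (1 / M * inner ℝ (z t ω - y ω) (drift K η δ f u t m ω)) =
        inner ℝ (z t ω - y ω) (drift K η δ f u t m ω) := by field_simp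
      rw [h5, h2, inner_add_left]
      nlinarith [norm_nonneg (iter K η δ f u t m ω - z t ω)]
    have h6 := Finset.sum_le_sum fun t ht => Finset.sum_le_sum (h1 t ht)
    simp only [Finset.sum_add_distrib, ← Finset.mul_sum] at h6
    have h7 := hW ω (y ω) (hy ω).1
    simp only [← Finset.mul_sum] at h7
    calc 1 / ((M : ℝ) * T) * ∑ t ∈ Finset.range T, ∑ m,
          inner ℝ (iter K η δ f u t m ω - y ω) (drift K η δ f u t m ω)
        ≤ 1 / ((M : ℝ) * T) * (M * W ω + G * ∑ t ∈ Finset.range T, ∑ m,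
            ‖iter K η δ f u t m ω - z t ω‖) := by
          refine mul_le_mul_of_nonneg_left (h6.trans (add_le_add_left ?_ _)) (by positivity)
          exact mul_le_mul_of_nonneg_left h7 hM'.le
      _ = _ := by field_simp
  have hA := hg.integrable_avgRegret hG.le hδ K η hB.le hy
  refine (integral_mono_ae hA (i2.add (integrable_const (3 * (G * δ)))) hle).trans ?_
  have hsum : ∑ t ∈ Finset.range T, ∑ m, ∫ ω, ‖iter K η δ f u t m ω - z t ω‖ ∂P ≤
      T * (M * (2 * (η * ((K - 1) * G + √((K - 1) * (23 * d * G ^ 2)))))) := by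
    refine (Finset.sum_le_sum fun t ht => Finset.sum_le_sum fun m _ => (hC t ht m).2).trans_eq ?_
    simp only [Finset.sum_const, Finset.card_univ, Fintype.card_fin, Finset.card_range,
      nsmul_eq_mul]
  simp only [Pi.add_apply]
  rw [integral_add i2 (integrable_const _), integral_add (hWi.const_mul _) (i1.const_mul _),
    integral_const, probReal_univ, one_smul, integral_const_mul, integral_const_mul,
    integral_finsetSum _ fun t ht => integrable_finsetSum _ fun m _ => (hC t ht m).1]
  have hswap : ∑ t ∈ Finset.range T, ∫ ω, ∑ m, ‖iter K η δ f u t m ω - z t ω‖ ∂P =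
      ∑ t ∈ Finset.range T, ∑ m, ∫ ω, ‖iter K η δ f u t m ω - z t ω‖ ∂P :=
    Finset.sum_congr rfl fun t ht => integral_finsetSum _ fun m _ => (hC t ht m).1
  rw [hswap]
  have h8 := fed_terms_le_fedRate hG hB hd hM hK hR hη
  have h9 : G / (M * T) * (T * (M * (2 * (η * ((K - 1) * G + √((K - 1) * (23 * d * G ^ 2))))))) =
      G * (2 * (η * ((K - 1) * G + √((K - 1) * (23 * d * G ^ 2))))) := by field_simp
  have h10 := mul_le_mul_of_nonneg_left hsum (by positivity : 0 ≤ G / (M * T))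
  rw [h9] at h10
  have h11 := mul_le_mul_of_nonneg_left hWb (by positivity : 0 ≤ 1 / (T : ℝ))
  rw [hTc] at h11 h10 ⊢
  have : 0 < G * δ := by positivity
  linarith

/-- The weights concentrated on one machine give a bound for that machine, uniform over comparators.
Hence the bounds can be summed even though all machines share one comparator. -/
theorem nc_regret_le (hg : IsAdaptiveGame P G T f u) {B δ : ℝ} (hd : 1 ≤ d)
    (hM : 1 ≤ M) (hT : 1 ≤ T) (hG : 0 < G) (hB : 0 < B)
    (hδ : 0 < δ) (hδ' : G * δ ≤ ncRate G B d T) {y : Ω → Vec d}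
    (hy : ∀ ω, IsBestInBall T B (fun t m => f t m ω) (y ω)) :
    ∫ ω, avgRegret T δ (fun t m => f t m ω) (fun t m => u t m ω)
      (fun t m => iter 0 (B / (G * √((d : ℝ) * T))) δ f u t m ω) (y ω) ∂P ≤
        50 * ncRate G B d T := by
  have hd' : (1 : ℝ) ≤ d := by exact_mod_cast hd
  have hM' : (0 : ℝ) < M := by exact_mod_cast hM
  have hT' : (0 : ℝ) < T := by exact_mod_cast hT
  set η := B / (G * √((d : ℝ) * T)) with hη
  have hη0 : 0 < η := by positivity
  have hex := fun m : Fin M => hg.exists_regret_bound hd hG.le hδ 0 hη0 hB.le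
    (a := fun n => if n = m then (1 : ℝ) else 0)
    (by simp [apply_ite abs])
    (fun ω t _ => by
      simp only [ite_smul, one_smul, zero_smul, Finset.sum_ite_eq', Finset.mem_univ, if_true]
      rw [iter_succ, Nat.mod_zero, if_neg (Nat.succ_ne_zero t)])
  simp only [ite_smul, one_smul, zero_smul, ite_mul, one_mul, zero_mul, ite_pow, one_pow, ne_eq,
    OfNat.ofNat_ne_zero, not_false_eq_true, zero_pow,
    Finset.sum_ite_eq', Finset.mem_univ, if_true] at hex
  choose W hWi hW hWb using hex
  have i1 : Integrable (fun ω => 1 / ((M : ℝ) * T) * ∑ m, W m ω) P :=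
    (integrable_finsetSum _ fun m _ => hWi m).const_mul _
  have hle : ∀ᵐ ω ∂P, avgRegret T δ (fun t m => f t m ω) (fun t m => u t m ω)
      (fun t m => iter 0 η δ f u t m ω) (y ω) ≤ 1 / ((M : ℝ) * T) * ∑ m, W m ω + 3 * (G * δ) := by
    filter_upwards [hg.ae_norm_dir] with ω hω
    refine (hg.avgRegret_le hd hM hT hG.le hδ 0 η hω (y ω)).trans (add_le_add_left ?_ _)
    refine mul_le_mul_of_nonneg_left ?_ (by positivity)
    rw [Finset.sum_comm]
    exact Finset.sum_le_sum fun m _ => hW m ω (y ω) (hy ω).1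
  have hA := hg.integrable_avgRegret hG.le hδ 0 η hB.le hy
  refine (integral_mono_ae hA (i1.add (integrable_const (3 * (G * δ)))) hle).trans ?_
  simp only [Pi.add_apply]
  rw [integral_add i1 (integrable_const _), integral_const, probReal_univ, one_smul,
    integral_const_mul, integral_finsetSum _ fun m _ => hWi m]
  set p := √(d : ℝ) with hp
  set r := √(T : ℝ) with hr
  have hp1 : 1 ≤ p := Real.one_le_sqrt.2 hd'
  have hr0 : 0 < r := Real.sqrt_pos.2 hT'
  have ed : (d : ℝ) = p ^ 2 := (Real.sq_sqrt (by linarith)).symm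
  have eT : (T : ℝ) = r ^ 2 := (Real.sq_sqrt hT'.le).symm
  have edT : √((d : ℝ) * T) = p * r := Real.sqrt_mul (by linarith) _
  have hp0 : 0 < p := by linarith
  have hWb' : ∀ m, ∫ ω, W m ω ∂P ≤ 40 * (T * ncRate G B d T) := by
    intro m
    refine (hWb m).trans ?_
    have e1 : B ^ 2 / (2 * η) = 1 / 2 * (G * B * p * r) := by
      rw [hη, edT]; field_simp
    have e2 : η * T * (G ^ 2 + 23 * d * G ^ 2) ≤ 24 * (G * B * p * r) := by
      have : η * T * (G ^ 2 + 23 * d * G ^ 2) ≤ η * T * (24 * d * G ^ 2) := by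
        gcongr; nlinarith [sq_nonneg G]
      refine this.trans_eq ?_
      rw [hη, edT, eT, ed]; field_simp
    have e3 : B * √(T * 1 * (23 * d * G ^ 2)) ≤ 5 * (G * B * p * r) := by
      have := sqrt_mul_le_five_mul (x := T * 1 * (23 * d * G ^ 2)) (y := r * p * G) (by positivity)
        (le_of_eq (by rw [ed, eT]; ring))
      nlinarith
    have e4 : T * ncRate G B d T = G * B * p * r := by
      rw [ncRate, ← hp, ← hr, eT]; field_simp
    rw [e4]
    have : 0 ≤ G * B * p * r := by positivity
    linarith
  have h1 : 1 / ((M : ℝ) * T) * ∑ m, ∫ ω, W m ω ∂P ≤ 40 * ncRate G B d T := by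
    refine (mul_le_mul_of_nonneg_left (Finset.sum_le_sum fun m _ => hWb' m)
      (by positivity)).trans_eq ?_
    rw [Finset.sum_const, Finset.card_univ, Fintype.card_fin, nsmul_eq_mul]
    field_simp
  have : 0 < G * δ := by positivity
  linarith

end IsAdaptiveGame

/-! ### Linear costs made nonnegative -/

theorem hasDerivAt_max_zero_pow (n : ℕ) (x : ℝ) :
    HasDerivAt (fun x : ℝ => max 0 x ^ (n + 2)) ((n + 2) * max 0 x ^ (n + 1)) x := by
  have hR : ∀ x : ℝ, 0 ≤ x → HasDerivWithinAt (fun x : ℝ => max 0 x ^ (n + 2))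
      ((n + 2) * max 0 x ^ (n + 1)) (Set.Ici 0) x := by
    intro x hx
    have h := (hasDerivAt_pow (n + 2) x).hasDerivWithinAt (s := Set.Ici 0)
    rw [max_eq_right hx]
    refine (h.congr (fun y hy => by simp only [max_eq_right (Set.mem_Ici.1 hy)]) (by rw [max_eq_right hx]))
      |>.congr_deriv ?_
    push_cast
    simp
  have hL : ∀ x : ℝ, x ≤ 0 → HasDerivWithinAt (fun x : ℝ => max 0 x ^ (n + 2))
      ((n + 2) * max 0 x ^ (n + 1)) (Set.Iic 0) x := by
    intro x hx
    rw [max_eq_left hx]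
    refine ((hasDerivWithinAt_const x (Set.Iic 0) (0 : ℝ)).congr
      (fun y hy => by rw [max_eq_left hy, zero_pow (by omega)])
      (by rw [max_eq_left hx, zero_pow (by omega)])).congr_deriv ?_
    simp
  rcases lt_trichotomy x 0 with h | h | h
  · exact (hL x h.le).hasDerivAt (Iic_mem_nhds h)
  · subst h
    have := (hL 0 le_rfl).union (hR 0 le_rfl)
    rwa [Set.Iic_union_Ici, hasDerivWithinAt_univ] at this
  · exact (hR x h.le).hasDerivAt (Ici_mem_nhds h)

section HardCost

variable {d : ℕ}

/-- A smooth version of `max 0 (‖x‖ - 2B)` that vanishes on the ball of radius `B`. -/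
def penalty (B : ℝ) (x : Vec d) : ℝ := √(max 0 (‖x‖ - B) ^ 2 + B ^ 2) - B

/-- As a norm in the plane, the square root gets its Lipschitz bound and its convexity from the
triangle inequality. -/
theorem sqrt_sq_add_sq_eq_norm (s B : ℝ) : √(s ^ 2 + B ^ 2) = ‖(s : ℂ) + B * Complex.I‖ := by
  rw [Complex.norm_add_mul_I]

theorem penalty_eq_zero {B : ℝ} (hB : 0 ≤ B) {x : Vec d} (hx : ‖x‖ ≤ B) : penalty B x = 0 := by
  rw [penalty, max_eq_left (by linarith), zero_pow two_ne_zero, zero_add, Real.sqrt_sq hB, sub_self]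

theorem penalty_nonneg {B : ℝ} (x : Vec d) : 0 ≤ penalty B x :=
  sub_nonneg.2 (Real.le_sqrt_of_sq_le (le_add_of_nonneg_left (sq_nonneg _)))

theorem sub_le_penalty {B : ℝ} (x : Vec d) : ‖x‖ - 2 * B ≤ penalty B x := by
  have h1 : ‖x‖ - B ≤ √(max 0 (‖x‖ - B) ^ 2 + B ^ 2) :=
    (le_max_right 0 _).trans (Real.le_sqrt_of_sq_le (le_add_of_nonneg_right (sq_nonneg _)))
  rw [penalty]
  linarith

theorem abs_penalty_sub_le {B : ℝ} (x y : Vec d) : |penalty B x - penalty B y| ≤ ‖x - y‖ := by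
  rw [penalty, penalty, sub_sub_sub_cancel_right, sqrt_sq_add_sq_eq_norm, sqrt_sq_add_sq_eq_norm]
  refine (abs_norm_sub_norm_le _ _).trans ?_
  rw [add_sub_add_right_eq_sub, ← Complex.ofReal_sub, Complex.norm_real, Real.norm_eq_abs]
  refine (abs_max_sub_max_le_abs _ _ _).trans' (by simp only [max_comm (0 : ℝ)]; rfl) |>.trans ?_
  rw [sub_sub_sub_cancel_right]
  exact abs_norm_sub_norm_le _ _

theorem convexOn_penalty {B : ℝ} : ConvexOn ℝ Set.univ (penalty B : Vec d → ℝ) := by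
  refine ⟨convex_univ, fun x _ y _ a b ha hb hab => ?_⟩
  simp only [penalty, smul_eq_mul]
  have h1 : max 0 (‖a • x + b • y‖ - B) ≤ a * max 0 (‖x‖ - B) + b * max 0 (‖y‖ - B) := by
    refine max_le (by positivity) ?_
    have h2 := norm_add_le (a • x) (b • y)
    rw [norm_smul, norm_smul, Real.norm_of_nonneg ha, Real.norm_of_nonneg hb] at h2
    have h3 := mul_le_mul_of_nonneg_left (le_max_right 0 (‖x‖ - B)) ha
    have h4 := mul_le_mul_of_nonneg_left (le_max_right 0 (‖y‖ - B)) hb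
    have : B = a * B + b * B := by rw [← add_mul, hab, one_mul]
    linarith
  have h5 : √(max 0 (‖a • x + b • y‖ - B) ^ 2 + B ^ 2) ≤
      √((a * max 0 (‖x‖ - B) + b * max 0 (‖y‖ - B)) ^ 2 + B ^ 2) := by
    gcongr
  have h6 : √((a * max 0 (‖x‖ - B) + b * max 0 (‖y‖ - B)) ^ 2 + B ^ 2) ≤
      a * √(max 0 (‖x‖ - B) ^ 2 + B ^ 2) + b * √(max 0 (‖y‖ - B) ^ 2 + B ^ 2) := by
    simp only [sqrt_sq_add_sq_eq_norm]
    have e : ((a * max 0 (‖x‖ - B) + b * max 0 (‖y‖ - B) : ℝ) : ℂ) + B * Complex.I =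
        a • (((max 0 (‖x‖ - B) : ℝ) : ℂ) + B * Complex.I) +
        b • (((max 0 (‖y‖ - B) : ℝ) : ℂ) + B * Complex.I) := by
      have : (B : ℂ) = a * B + b * B := by
        rw [← add_mul, ← Complex.ofReal_add, hab, Complex.ofReal_one, one_mul]
      simp only [Complex.real_smul]
      push_cast
      linear_combination this * Complex.I
    rw [e]
    refine (norm_add_le _ _).trans_eq ?_
    rw [norm_smul, norm_smul, Real.norm_of_nonneg ha, Real.norm_of_nonneg hb]
  have : B = a * B + b * B := by rw [← add_mul, hab, one_mul]
  linarith

theorem differentiable_penalty {B : ℝ} (hB : 0 < B) : Differentiable ℝ (penalty B : Vec d → ℝ) := by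
  have h : Differentiable ℝ fun x : Vec d => max 0 (‖x‖ - B) ^ 2 := by
    intro x
    by_cases hx : x = 0
    -- The norm is not differentiable at the origin, but the function vanishes on the whole ball
    -- around it.
    · have : (fun _ => (0 : ℝ)) =ᶠ[nhds x] fun x : Vec d => max 0 (‖x‖ - B) ^ 2 := by
        filter_upwards [Metric.ball_mem_nhds x hB] with z hz
        rw [hx, mem_ball_zero_iff] at hz
        rw [max_eq_left (by linarith), zero_pow two_ne_zero]
      exact (differentiableAt_const _).congr_of_eventuallyEq this.symm
    · have h1 : DifferentiableAt ℝ (fun x : Vec d => ‖x‖ - B) x :=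
        ((contDiffAt_norm ℝ hx).differentiableAt one_ne_zero).sub_const B
      exact (hasDerivAt_max_zero_pow 0 (‖x‖ - B)).differentiableAt.comp x h1
  exact ((h.add_const _).sqrt fun x => by positivity).sub_const B

/-- A linear function, made nonnegative by adding a penalty outside of the ball of radius `B`. -/
def hardCost (G B : ℝ) (z x : Vec d) : ℝ := inner ℝ z x + G / 2 * penalty B x + G * B

theorem isCost_hardCost {G B : ℝ} (hG : 0 < G) (hB : 0 < B) {z : Vec d} (hz : ‖z‖ ≤ G / 2) :
    IsCost G (hardCost G B z) where
  convex := by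
    have h1 : ConvexOn ℝ Set.univ fun x : Vec d => inner ℝ z x :=
      ((innerSL ℝ z).toLinearMap).convexOn convex_univ
    exact (h1.add (convexOn_penalty.smul (by positivity : 0 ≤ G / 2))).add_const _
  differentiable :=
    ((differentiable_const z).inner ℝ differentiable_id |>.add
      ((differentiable_penalty hB).const_mul _)).add_const _
  lipschitz x y := by
    have h1 : hardCost G B z x - hardCost G B z y =
        inner ℝ z (x - y) + G / 2 * (penalty B x - penalty B y) := by
      rw [hardCost, hardCost, inner_sub_right]; ring
    have h2 := abs_real_inner_le_norm z (x - y)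
    have h3 := abs_penalty_sub_le (B := B) x y
    rw [h1]
    refine (abs_add_le _ _).trans ?_
    rw [abs_mul, abs_of_pos (by positivity : 0 < G / 2)]
    nlinarith [norm_nonneg (x - y)]

/-- The radial retraction onto the ball of radius `r`. -/
def clip (r : ℝ) (x : Vec d) : Vec d := min 1 (r / ‖x‖) • x

theorem norm_clip_le {r : ℝ} (hr : 0 ≤ r) (x : Vec d) : ‖clip r x‖ ≤ r := by
  rw [clip, norm_smul, Real.norm_of_nonneg (by positivity)]
  rcases eq_or_ne x 0 with rfl | hx
  · simpa using hr
  · have : 0 < ‖x‖ := norm_pos_iff.2 hx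
    calc min 1 (r / ‖x‖) * ‖x‖ ≤ r / ‖x‖ * ‖x‖ := by gcongr; exact min_le_right _ _
      _ = r := by field_simp

theorem measurable_clip (r : ℝ) : Measurable (clip r : Vec d → Vec d) :=
  (measurable_const.min (measurable_const.div measurable_norm)).smul measurable_id

/-- Beyond radius `2B` the penalty dominates `‖x‖ - 2B` with slope `G/2`, at least as steep as the
linear part can descend. An algorithm therefore gains nothing by querying outside this ball. -/
theorem inner_clip_le_hardCost {G B : ℝ} (hG : 0 ≤ G) (hB : 0 < B) {z : Vec d} (hz : ‖z‖ ≤ G / 2)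
    (x : Vec d) : inner ℝ z (clip (2 * B) x) + G * B ≤ hardCost G B z x := by
  rw [hardCost, clip, inner_smul_right]
  have hp := penalty_nonneg (B := B) x
  have hp2 := sub_le_penalty (B := B) x
  have hi := (abs_le.1 (abs_real_inner_le_norm z x)).1
  rcases le_or_gt ‖x‖ (2 * B) with h | h
  · have : min 1 (2 * B / ‖x‖) * inner ℝ z x = inner ℝ z x := by
      rcases eq_or_ne x 0 with rfl | hx
      · simp
      · rw [min_eq_left ((one_le_div (norm_pos_iff.2 hx)).2 h), one_mul]
    rw [this]
    nlinarith
  · have h0 : 0 < ‖x‖ := by linarith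
    rw [min_eq_right ((div_le_one h0).2 h.le)]
    have h1 : 2 * B / ‖x‖ ≤ 1 := (div_le_one h0).2 h.le
    have h2 : (1 - 2 * B / ‖x‖) * (‖z‖ * ‖x‖) ≤ G / 2 * (‖x‖ - 2 * B) := by
      have : (1 - 2 * B / ‖x‖) * (‖z‖ * ‖x‖) = ‖z‖ * (‖x‖ - 2 * B) := by field_simp
      rw [this]
      exact mul_le_mul_of_nonneg_right hz (by linarith)
    have h3 : (1 - 2 * B / ‖x‖) * -(‖z‖ * ‖x‖) ≤ (1 - 2 * B / ‖x‖) * inner ℝ z x :=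
      mul_le_mul_of_nonneg_left hi (by linarith)
    nlinarith

theorem abs_inner_clip_le {G B : ℝ} (hB : 0 < B) {z : Vec d} (hz : ‖z‖ ≤ G / 2) (x : Vec d) :
    |inner ℝ z (clip (2 * B) x)| ≤ G * B := by
  refine (abs_real_inner_le_norm _ _).trans ?_
  have := norm_clip_le (by positivity : 0 ≤ 2 * B) x
  nlinarith [norm_nonneg z]

theorem hardCost_nonneg {G B : ℝ} (hG : 0 ≤ G) (hB : 0 < B) {z : Vec d} (hz : ‖z‖ ≤ G / 2)
    (x : Vec d) : 0 ≤ hardCost G B z x := by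
  have h1 := inner_clip_le_hardCost hG hB hz x
  have h2 := (abs_le.1 (abs_inner_clip_le hB hz x)).1
  linarith

theorem continuous_hardCost {G B : ℝ} :
    Continuous fun p : Vec d × Vec d => hardCost G B p.1 p.2 := by
  unfold hardCost penalty
  fun_prop

end HardCost

/-! ### Algorithms against random costs -/

namespace TwoPointAlgorithm

variable {S : Type*} [MeasurableSpace S] {d M K : ℕ}

/-- The two points that machine `m` queries at step `t`. -/
def points (A : TwoPointAlgorithm S d M K) (φ : ℕ → Fin M → Vec d → ℝ) (ω : S) (t : ℕ)
    (m : Fin M) : Vec d × Vec d :=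
  A.query t m ω (A.answers φ ω t)

/-- By induction, an algorithm cannot tell apart two families of costs that agree at the points it
queries on one of them. All invariances of the queries below rest on this. -/
theorem answers_eq_of_eq (A : TwoPointAlgorithm S d M K) {φ φ' : ℕ → Fin M → Vec d → ℝ} {ω : S}
    {t : ℕ} (h : ∀ s < t, ∀ m, φ s m (A.points φ ω s m).1 = φ' s m (A.points φ ω s m).1 ∧
      φ s m (A.points φ ω s m).2 = φ' s m (A.points φ ω s m).2) :
    A.answers φ ω t = A.answers φ' ω t := by
  induction t with
  | zero => rfl
  | succ t ih =>
    have ih := ih fun s hs => h s (by omega)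
    have h' := h t (by omega)
    simp only [points] at h'
    simp only [answers]
    rw [← ih]
    congr 1
    ext1 m
    rw [(h' m).1, (h' m).2]

theorem points_eq_of_eq (A : TwoPointAlgorithm S d M K) {φ φ' : ℕ → Fin M → Vec d → ℝ} {ω : S}
    {t : ℕ} (h : ∀ s < t, ∀ m, φ s m (A.points φ ω s m).1 = φ' s m (A.points φ ω s m).1 ∧
      φ s m (A.points φ ω s m).2 = φ' s m (A.points φ ω s m).2) (m : Fin M) :
    A.points φ ω t m = A.points φ' ω t m := by
  rw [points, A.answers_eq_of_eq h, points]

theorem measurable_points (A : TwoPointAlgorithm S d M K) {Y : Type*} [MeasurableSpace Y]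
    {φ : Y → ℕ → Fin M → Vec d → ℝ} (hφ : ∀ t m, Measurable fun p : Y × Vec d => φ p.1 t m p.2)
    (t : ℕ) (m : Fin M) : Measurable fun p : S × Y => A.points (φ p.2) p.1 t m := by
  have hq : ∀ t, (Measurable fun p : S × Y => A.answers (φ p.2) p.1 t) → ∀ m,
      Measurable fun p : S × Y => A.points (φ p.2) p.1 t m := fun t h m =>
    (A.measurable_query t m).comp (measurable_fst.prodMk h)
  have ha : ∀ t, Measurable fun p : S × Y => A.answers (φ p.2) p.1 t := by
    intro t
    induction t with
    | zero => exact measurable_const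
    | succ t ih =>
      simp only [answers]
      refine measurable_pi_iff.2 fun s => measurable_pi_iff.2 fun n => ?_
      by_cases hs : s = t
      · subst hs
        simp only [Function.update_self]
        have h1 := hq s ih n
        exact ((hφ s n).comp (measurable_snd.prodMk h1.fst)).prodMk
          ((hφ s n).comp (measurable_snd.prodMk h1.snd))
      · simp only [Function.update_of_ne hs]
        exact (measurable_pi_iff.1 (measurable_pi_iff.1 ih s) n)
  exact hq t (ha t) m

end TwoPointAlgorithm

theorem exists_isBestInBall {d M : ℕ} (R : ℕ) {B : ℝ} (hB : 0 ≤ B) {φ : ℕ → Fin M → Vec d → ℝ}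
    (hφ : ∀ t m, Continuous (φ t m)) : ∃ y, IsBestInBall R B φ y := by
  obtain ⟨y, hy, hmin⟩ := (isCompact_closedBall (0 : Vec d) B).exists_isMinOn
    ⟨0, by simpa using hB⟩ (f := fun x => ∑ t ∈ Finset.range R, ∑ m, φ t m x)
    (by fun_prop)
  exact ⟨y, by simpa using hy, fun z hz => hmin (by simpa using hz)⟩

/-- Averaging over random linear costs: if every deterministic algorithm has a large expected
cost, then some realization is hard for a randomized algorithm. -/
theorem exists_hard_costs {Y : Type*} [MeasurableSpace Y] (μ : Measure Y) [IsProbabilityMeasure μ]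
    {d M R : ℕ} (hM : 1 ≤ M) (hR : 1 ≤ R) {G B : ℝ} (hG : 0 < G) (hB : 0 < B)
    {Z : ℕ → Fin M → Y → Vec d} (hZ : ∀ t m, Measurable (Z t m))
    (hZG : ∀ᵐ y ∂μ, ∀ t m, ‖Z t m y‖ ≤ G / 2) {V : Y → Vec d} (hV : Measurable V)
    (hVB : ∀ᵐ y ∂μ, ‖V y‖ ≤ B) {S : Type*} [MeasurableSpace S] (Q : Measure S)
    [IsProbabilityMeasure Q] (A : TwoPointAlgorithm S d M 1) {α gap : ℝ}
    (hlow : ∀ ω, ∀ t < R, ∀ m, -α ≤ ∫ y, inner ℝ (Z t m y)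
        (clip (2 * B) (A.points (fun t m => hardCost G B (Z t m y)) ω t m).1) ∂μ ∧
      -α ≤ ∫ y, inner ℝ (Z t m y)
        (clip (2 * B) (A.points (fun t m => hardCost G B (Z t m y)) ω t m).2) ∂μ)
    (hcomp : ∀ t < R, ∀ m, ∫ y, inner ℝ (Z t m y) (V y) ∂μ ≤ -α - gap) :
    ∃ φ : ℕ → Fin M → Vec d → ℝ, (∀ t m, IsCost G (φ t m)) ∧ (∀ t m x, 0 ≤ φ t m x) ∧
      ∃ y : Vec d, IsBestInBall R B φ y ∧
        ENNReal.ofReal (gap + (1 / ((M : ℝ) * (R : ℝ))) *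
          ∑ t ∈ Finset.range R, ∑ m : Fin M, φ t m y) ≤
            ∫⁻ ω, ENNReal.ofReal (A.avgCost R φ ω) ∂Q := by
  have hM' : (0 : ℝ) < M := by exact_mod_cast hM
  have hR' : (0 : ℝ) < R := by exact_mod_cast hR
  set Φ : Y → ℕ → Fin M → Vec d → ℝ := fun y t m => hardCost G B (Z t m y) with hΦ
  have hX : ∀ t m, Measurable fun p : S × Y => A.points (Φ p.2) p.1 t m :=
    A.measurable_points fun t m =>
      continuous_hardCost.measurable.comp (((hZ t m).comp measurable_fst).prodMk measurable_snd)
  set ℓ₁ : ℕ → Fin M → S × Y → ℝ := fun t m p =>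
    inner ℝ (Z t m p.2) (clip (2 * B) (A.points (Φ p.2) p.1 t m).1) with hℓ₁
  set ℓ₂ : ℕ → Fin M → S × Y → ℝ := fun t m p =>
    inner ℝ (Z t m p.2) (clip (2 * B) (A.points (Φ p.2) p.1 t m).2) with hℓ₂
  set c : ℕ → Fin M → Y → ℝ := fun t m y => inner ℝ (Z t m y) (V y) with hc
  have hℓ₁m : ∀ t m, Measurable (ℓ₁ t m) := fun t m =>
    ((hZ t m).comp measurable_snd).inner ((measurable_clip _).comp (hX t m).fst)
  have hℓ₂m : ∀ t m, Measurable (ℓ₂ t m) := fun t m =>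
    ((hZ t m).comp measurable_snd).inner ((measurable_clip _).comp (hX t m).snd)
  have hae : ∀ᵐ p ∂(Q.prod μ), ∀ t m, ‖Z t m p.2‖ ≤ G / 2 :=
    (Measure.quasiMeasurePreserving_snd (μ := Q) (ν := μ)).ae hZG
  have hℓ₁i : ∀ t m, Integrable (ℓ₁ t m) (Q.prod μ) := fun t m =>
    Integrable.of_bound (hℓ₁m t m).aestronglyMeasurable (G * B)
      (hae.mono fun p hp => abs_inner_clip_le hB (hp t m) _)
  have hℓ₂i : ∀ t m, Integrable (ℓ₂ t m) (Q.prod μ) := fun t m =>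
    Integrable.of_bound (hℓ₂m t m).aestronglyMeasurable (G * B)
      (hae.mono fun p hp => abs_inner_clip_le hB (hp t m) _)
  have hci : ∀ t m, Integrable (c t m) μ := fun t m => by
    refine Integrable.of_bound ((hZ t m).inner hV).aestronglyMeasurable (G / 2 * B) ?_
    filter_upwards [hZG, hVB] with y h1 h2
    exact (abs_real_inner_le_norm _ _).trans
      (mul_le_mul (h1 t m) h2 (norm_nonneg _) (by positivity))
  set L : S × Y → ℝ := fun p => (1 / (2 * (M : ℝ) * R)) * ∑ t ∈ Finset.range R, ∑ m,
    (ℓ₁ t m p + ℓ₂ t m p) with hL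
  set C : Y → ℝ := fun y => (1 / ((M : ℝ) * R)) * ∑ t ∈ Finset.range R, ∑ m, c t m y with hC
  have hsi : ∀ t m, Integrable (fun p => ℓ₁ t m p + ℓ₂ t m p) (Q.prod μ) := fun t m =>
    (hℓ₁i t m).add (hℓ₂i t m)
  have hLi : Integrable L (Q.prod μ) :=
    (integrable_finsetSum _ fun t _ => integrable_finsetSum _ fun m _ => hsi t m).const_mul _
  have hCi : Integrable C μ :=
    (integrable_finsetSum _ fun t _ => integrable_finsetSum _ fun m _ => hci t m).const_mul _
  have hLb : -α ≤ ∫ p, L p ∂(Q.prod μ) := by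
    have h1 : ∀ t ∈ Finset.range R, ∀ m ∈ Finset.univ,
        -α + -α ≤ ∫ p, (ℓ₁ t m p + ℓ₂ t m p) ∂(Q.prod μ) := by
      intro t ht m _
      have ht := Finset.mem_range.1 ht
      rw [integral_add (hℓ₁i t m) (hℓ₂i t m), integral_prod _ (hℓ₁i t m),
        integral_prod _ (hℓ₂i t m)]
      have e : ∀ F : S → ℝ, Integrable F Q → (∀ ω, -α ≤ F ω) → -α ≤ ∫ ω, F ω ∂Q := by
        intro F hF h
        simpa using integral_mono (integrable_const (-α)) hF h
      exact add_le_add (e _ (hℓ₁i t m).integral_prod_left fun ω => (hlow ω t ht m).1)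
        (e _ (hℓ₂i t m).integral_prod_left fun ω => (hlow ω t ht m).2)
    have h2 := Finset.sum_le_sum fun t ht => Finset.sum_le_sum (h1 t ht)
    rw [hL, integral_const_mul, integral_finsetSum _ fun t _ => integrable_finsetSum _ fun m _ =>
      hsi t m]
    simp_rw [integral_finsetSum _ fun m _ => hsi _ m]
    refine le_trans (le_of_eq ?_) (mul_le_mul_of_nonneg_left h2 (by positivity))
    simp only [Finset.sum_const, Finset.card_univ, Fintype.card_fin, Finset.card_range,
      nsmul_eq_mul]
    field_simp
    ring
  have hCb : ∫ y, C y ∂μ ≤ -α - gap := by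
    rw [hC, integral_const_mul, integral_finsetSum _ fun t _ => integrable_finsetSum _ fun m _ =>
      hci t m]
    simp_rw [integral_finsetSum _ fun m _ => hci _ m]
    refine (mul_le_mul_of_nonneg_left (Finset.sum_le_sum fun t ht => Finset.sum_le_sum fun m _ =>
      hcomp t (Finset.mem_range.1 ht) m) (by positivity)).trans_eq ?_
    simp only [Finset.sum_const, Finset.card_univ, Fintype.card_fin, Finset.card_range,
      nsmul_eq_mul]
    field_simp
  -- The mean advantage of the comparator over the algorithm is at least `gap`, so some realization
  -- outside the exceptional null set attains it.
  set h : Y → ℝ := fun y => ∫ ω, L (ω, y) ∂Q - C y with hh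
  have hi : Integrable h μ := hLi.integral_prod_right.sub hCi
  obtain ⟨y, hyN, hy⟩ := exists_notMem_null_integral_le hi
    (N := {y | ¬ (Integrable (fun ω => L (ω, y)) Q ∧ (∀ t m, ‖Z t m y‖ ≤ G / 2) ∧ ‖V y‖ ≤ B)})
    (hLi.prod_left_ae.and (hZG.and hVB))
  simp only [Set.mem_ofPred_eq, not_not] at hyN
  obtain ⟨hyL, hyZ, hyV⟩ := hyN
  have hgap : gap + C y ≤ ∫ ω, L (ω, y) ∂Q := by
    have h1 : ∫ y, h y ∂μ = ∫ p, L p ∂(Q.prod μ) - ∫ y, C y ∂μ := by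
      rw [hh, integral_sub hLi.integral_prod_right hCi, integral_prod_symm _ hLi]
    have : h y = ∫ ω, L (ω, y) ∂Q - C y := rfl
    linarith
  refine ⟨Φ y, fun t m => isCost_hardCost hG hB (hyZ t m),
    fun t m x => hardCost_nonneg hG.le hB (hyZ t m) x, ?_⟩
  obtain ⟨w, hw⟩ := exists_isBestInBall R hB.le (φ := Φ y)
    fun t m => (isCost_hardCost hG hB (hyZ t m)).continuous
  refine ⟨w, hw, ?_⟩
  have hLω : ∀ ω, L (ω, y) + G * B ≤ A.avgCost R (Φ y) ω := by
    intro ω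
    rw [TwoPointAlgorithm.avgCost]
    have h1 : L (ω, y) + G * B = (1 / (2 * (M : ℝ) * R)) * ∑ t ∈ Finset.range R, ∑ m,
        ((ℓ₁ t m (ω, y) + G * B) + (ℓ₂ t m (ω, y) + G * B)) := by
      simp only [Finset.sum_add_distrib, Finset.sum_const, Finset.card_univ, Fintype.card_fin,
        Finset.card_range, nsmul_eq_mul, hL]
      field_simp
      ring
    rw [h1]
    refine mul_le_mul_of_nonneg_left (Finset.sum_le_sum fun t _ => Finset.sum_le_sum fun m _ => ?_)
      (by positivity)
    exact add_le_add (inner_clip_le_hardCost hG.le hB (hyZ t m) _)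
      (inner_clip_le_hardCost hG.le hB (hyZ t m) _)
  -- Nonnegativity lets the Bochner integral pass to the lower integral, so the average cost itself
  -- need not be integrable.
  have hL0 : ∀ ω, 0 ≤ L (ω, y) + G * B := by
    intro ω
    have h1 : |L (ω, y)| ≤ G * B := by
      simp only [hL]
      rw [abs_mul, abs_of_nonneg (by positivity)]
      have h2 : |∑ t ∈ Finset.range R, ∑ m, (ℓ₁ t m (ω, y) + ℓ₂ t m (ω, y))| ≤
          ∑ _t ∈ Finset.range R, ∑ _m : Fin M, (G * B + G * B) :=
        (Finset.abs_sum_le_sum_abs _ _).trans (Finset.sum_le_sum fun t _ =>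
          (Finset.abs_sum_le_sum_abs _ _).trans (Finset.sum_le_sum fun m _ =>
            (abs_add_le _ _).trans (add_le_add (abs_inner_clip_le hB (hyZ t m) _)
              (abs_inner_clip_le hB (hyZ t m) _))))
      refine (mul_le_mul_of_nonneg_left h2 (by positivity)).trans_eq ?_
      simp only [Finset.sum_const, Finset.card_univ, Fintype.card_fin, Finset.card_range,
        nsmul_eq_mul]
      field_simp
      ring
    linarith [(abs_le.1 h1).1]
  -- The comparator lies in the ball where the penalty vanishes; its additive `G B` matches that of
  -- the algorithm and cancels.
  have hbest : (1 / ((M : ℝ) * R)) * ∑ t ∈ Finset.range R, ∑ m, Φ y t m w ≤ C y + G * B := by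
    refine (mul_le_mul_of_nonneg_left (hw.2 (V y) hyV) (by positivity)).trans_eq ?_
    simp only [hΦ, hardCost, penalty_eq_zero hB.le hyV, mul_zero, add_zero,
      Finset.sum_add_distrib, Finset.sum_const, Finset.card_univ, Fintype.card_fin,
      Finset.card_range, nsmul_eq_mul, hC, mul_add, hc]
    field_simp
  calc ENNReal.ofReal (gap + (1 / ((M : ℝ) * R)) * ∑ t ∈ Finset.range R, ∑ m, Φ y t m w)
      ≤ ENNReal.ofReal (∫ ω, (L (ω, y) + G * B) ∂Q) := by
        refine ENNReal.ofReal_le_ofReal ?_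
        rw [integral_add hyL (integrable_const _), integral_const, probReal_univ, one_smul]
        linarith
    _ = ∫⁻ ω, ENNReal.ofReal (L (ω, y) + G * B) ∂Q :=
        ofReal_integral_eq_lintegral_ofReal (hyL.add (integrable_const _)) (.of_forall hL0)
    _ ≤ ∫⁻ ω, ENNReal.ofReal (A.avgCost R (Φ y) ω) ∂Q :=
        lintegral_mono fun ω => ENNReal.ofReal_le_ofReal (hLω ω)

/-! ### A compactly supported density with finite Fisher information -/

section Bump

/-- A continuously differentiable probability density on `[-1, 1]`. -/
def bump (w : ℝ) : ℝ := 15 / 16 * max 0 (1 - w ^ 2) ^ 2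

/-- The negative logarithmic derivative of `bump`. -/
def score (w : ℝ) : ℝ := 4 * w / (1 - w ^ 2)

/-- The Stein kernel of `bump`. -/
def kap (w : ℝ) : ℝ := max 0 (1 - w ^ 2) / 6

/-- The probability measure with density `bump`. -/
def bumpMeasure : Measure ℝ := volume.withDensity fun w => ENNReal.ofReal (bump w)

theorem continuous_bump : Continuous bump := by unfold bump; fun_prop

theorem continuous_kap : Continuous kap := by unfold kap; fun_prop

theorem measurable_score : Measurable score := by unfold score; fun_prop

theorem bump_nonneg (w : ℝ) : 0 ≤ bump w := by unfold bump; positivity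

theorem kap_nonneg (w : ℝ) : 0 ≤ kap w := by unfold kap; positivity

theorem kap_le (w : ℝ) : kap w ≤ 1 / 6 := by
  unfold kap
  have : max 0 (1 - w ^ 2) ≤ 1 := max_le zero_le_one (by nlinarith [sq_nonneg w])
  linarith

theorem max_one_sub_sq_eq_zero {w : ℝ} (hw : 1 ≤ |w|) : max 0 (1 - w ^ 2) = 0 :=
  max_eq_left (by rw [← sq_abs]; nlinarith)

theorem bump_eq_zero {w : ℝ} (hw : 1 ≤ |w|) : bump w = 0 := by
  rw [bump, max_one_sub_sq_eq_zero hw]; norm_num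

theorem bump_eq {w : ℝ} (hw : |w| ≤ 1) : bump w = 15 / 16 * (1 - w ^ 2) ^ 2 := by
  rw [bump, max_eq_right]
  rw [← sq_abs]; nlinarith [abs_nonneg w]

/-- The product is continuous although the score alone is a division by zero at `±1`. -/
theorem score_mul_bump (w : ℝ) : score w * bump w = 15 / 4 * (w * max 0 (1 - w ^ 2)) := by
  rw [score, bump]
  rcases le_or_gt (1 - w ^ 2) 0 with h | h
  · simp [max_eq_left h]
  · rw [max_eq_right h.le]
    field_simp
    ring

theorem hasDerivAt_one_sub_sq (w : ℝ) : HasDerivAt (fun w : ℝ => 1 - w ^ 2) (-(2 * w)) w := by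
  simpa using (hasDerivAt_pow 2 w).const_sub 1

theorem hasDerivAt_bump (w : ℝ) : HasDerivAt bump (-(score w * bump w)) w := by
  have h := ((hasDerivAt_max_zero_pow 0 (1 - w ^ 2)).comp w (hasDerivAt_one_sub_sq w)).const_mul
    (15 / 16 : ℝ)
  refine h.congr_deriv ?_
  rw [score_mul_bump]
  norm_num
  ring

/-- The defining property of the Stein kernel: integration by parts against `kap * bump` produces
the coordinate itself instead of the score. -/
theorem hasDerivAt_kap_mul_bump (w : ℝ) :
    HasDerivAt (fun w => kap w * bump w) (-(w * bump w)) w := by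
  have h := ((hasDerivAt_max_zero_pow 1 (1 - w ^ 2)).comp w (hasDerivAt_one_sub_sq w)).const_mul
    (15 / 96 : ℝ)
  have e : (fun w => kap w * bump w) = fun w => 15 / 96 * max 0 (1 - w ^ 2) ^ (1 + 2) := by
    ext w; rw [kap, bump]; ring
  rw [e]
  refine h.congr_deriv ?_
  rw [bump]
  norm_num
  ring

theorem hasCompactSupport_bump : HasCompactSupport bump :=
  HasCompactSupport.intro (isCompact_Icc (a := -1) (b := 1)) fun x hx =>
    bump_eq_zero (by
      by_contra h
      exact hx (Set.mem_Icc.2 (abs_le.1 (not_le.1 h).le)))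

theorem integrable_bump : Integrable bump :=
  continuous_bump.integrable_of_hasCompactSupport hasCompactSupport_bump

theorem integral_bump_mul (f : ℝ → ℝ) :
    ∫ w, bump w * f w = ∫ w in (-1 : ℝ)..1, 15 / 16 * (1 - w ^ 2) ^ 2 * f w := by
  rw [intervalIntegral.integral_of_le (by norm_num),
    ← setIntegral_eq_integral_of_forall_compl_eq_zero (s := Set.Ioc (-1 : ℝ) 1)]
  · refine setIntegral_congr_fun measurableSet_Ioc fun w hw => ?_
    rw [bump_eq (abs_le.2 ⟨hw.1.le, hw.2⟩)]
  · intro w hw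
    rw [bump_eq_zero, zero_mul]
    by_contra h
    have := abs_lt.1 (not_le.1 h)
    exact hw ⟨this.1, this.2.le⟩

theorem integral_bumpMeasure (f : ℝ → ℝ) : ∫ w, f w ∂bumpMeasure = ∫ w, bump w * f w := by
  rw [bumpMeasure, integral_withDensity_eq_integral_toReal_smul
    continuous_bump.measurable.ennreal_ofReal (.of_forall fun _ => ENNReal.ofReal_lt_top)]
  simp only [ENNReal.toReal_ofReal (bump_nonneg _), smul_eq_mul]

theorem integral_bump : ∫ w, bump w = 1 := by
  have h := integral_bump_mul fun _ => 1
  simp only [mul_one] at h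
  rw [h]
  have e : ∀ w : ℝ, 15 / 16 * (1 - w ^ 2) ^ 2 = 15 / 16 - 15 / 8 * w ^ 2 + 15 / 16 * w ^ 4 :=
    fun w => by ring
  simp_rw [e]
  rw [intervalIntegral.integral_add (Continuous.intervalIntegrable (by fun_prop) _ _)
      (Continuous.intervalIntegrable (by fun_prop) _ _),
    intervalIntegral.integral_sub (Continuous.intervalIntegrable (by fun_prop) _ _)
      (Continuous.intervalIntegrable (by fun_prop) _ _)]
  simp only [intervalIntegral.integral_const_mul, integral_pow, intervalIntegral.integral_const]
  norm_num

instance isProbabilityMeasure_bumpMeasure : IsProbabilityMeasure bumpMeasure := by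
  refine ⟨?_⟩
  rw [bumpMeasure, withDensity_apply _ MeasurableSet.univ, setLIntegral_univ,
    ← ofReal_integral_eq_lintegral_ofReal integrable_bump (.of_forall bump_nonneg), integral_bump,
    ENNReal.ofReal_one]

theorem ae_abs_le_bumpMeasure : ∀ᵐ w ∂bumpMeasure, |w| ≤ 1 := by
  rw [bumpMeasure, ae_withDensity_iff continuous_bump.measurable.ennreal_ofReal]
  refine .of_forall fun w hw => ?_
  by_contra h
  exact hw (by rw [bump_eq_zero (not_le.1 h).le, ENNReal.ofReal_zero])

theorem integral_id_bumpMeasure : ∫ w, w ∂bumpMeasure = 0 := by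
  rw [integral_bumpMeasure, integral_bump_mul]
  have e : ∀ w : ℝ, 15 / 16 * (1 - w ^ 2) ^ 2 * w =
      15 / 16 * w ^ 1 - 15 / 8 * w ^ 3 + 15 / 16 * w ^ 5 := fun w => by ring
  simp_rw [e]
  rw [intervalIntegral.integral_add (Continuous.intervalIntegrable (by fun_prop) _ _)
      (Continuous.intervalIntegrable (by fun_prop) _ _),
    intervalIntegral.integral_sub (Continuous.intervalIntegrable (by fun_prop) _ _)
      (Continuous.intervalIntegrable (by fun_prop) _ _)]
  simp only [intervalIntegral.integral_const_mul, integral_pow]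
  norm_num

theorem integral_sq_bumpMeasure : ∫ w, w ^ 2 ∂bumpMeasure = 1 / 7 := by
  rw [integral_bumpMeasure, integral_bump_mul]
  have e : ∀ w : ℝ, 15 / 16 * (1 - w ^ 2) ^ 2 * w ^ 2 =
      15 / 16 * w ^ 2 - 15 / 8 * w ^ 4 + 15 / 16 * w ^ 6 := fun w => by ring
  simp_rw [e]
  rw [intervalIntegral.integral_add (Continuous.intervalIntegrable (by fun_prop) _ _)
      (Continuous.intervalIntegrable (by fun_prop) _ _),
    intervalIntegral.integral_sub (Continuous.intervalIntegrable (by fun_prop) _ _)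
      (Continuous.intervalIntegrable (by fun_prop) _ _)]
  simp only [intervalIntegral.integral_const_mul, integral_pow]
  norm_num

theorem integral_score_bumpMeasure : ∫ w, score w ∂bumpMeasure = 0 := by
  rw [integral_bumpMeasure]
  have h := integral_neg_eq_self (fun w => bump w * score w) volume
  have e : ∀ w, bump (-w) * score (-w) = -(bump w * score w) := fun w => by
    rw [bump, score, bump, score, neg_sq]; ring
  simp only [e, integral_neg] at h
  linarith

/-- Squaring the score cancels the square in the density, leaving `15 w²`; only at `±1`, where the
score is zero by convention, is this not an equality. The Fisher information is thus at most 10. -/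
theorem bump_mul_score_sq_le (w : ℝ) : bump w * score w ^ 2 ≤ Set.indicator (Set.Icc (-1) 1)
    (fun w => 15 * w ^ 2) w := by
  by_cases hw : w ∈ Set.Icc (-1 : ℝ) 1
  · rw [Set.indicator_of_mem hw, bump_eq (abs_le.2 hw), score]
    rcases eq_or_ne (1 - w ^ 2) 0 with h | h
    · rw [h]; simp; positivity
    · refine le_of_eq ?_
      field_simp
      ring
  · rw [Set.indicator_of_notMem hw, bump_eq_zero, zero_mul]
    by_contra h
    exact hw (abs_le.1 (not_le.1 h).le)

theorem integrable_indicator_sq :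
    Integrable (Set.indicator (Set.Icc (-1) 1) fun w : ℝ => 15 * w ^ 2) :=
  ((by fun_prop : Continuous fun w : ℝ => 15 * w ^ 2).integrableOn_Icc).integrable_indicator
    measurableSet_Icc

theorem integrable_bump_mul_score_sq : Integrable fun w => bump w * score w ^ 2 := by
  refine integrable_indicator_sq.mono' (continuous_bump.measurable.mul
    (measurable_score.pow_const 2)).aestronglyMeasurable (.of_forall fun w => ?_)
  rw [Real.norm_of_nonneg (mul_nonneg (bump_nonneg w) (sq_nonneg _))]
  exact bump_mul_score_sq_le w

theorem memLp_score : MemLp score 2 bumpMeasure := by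
  rw [memLp_two_iff_integrable_sq measurable_score.aestronglyMeasurable, bumpMeasure,
    integrable_withDensity_iff_integrable_smul' continuous_bump.measurable.ennreal_ofReal
      (.of_forall fun _ => ENNReal.ofReal_lt_top)]
  simpa only [ENNReal.toReal_ofReal (bump_nonneg _), smul_eq_mul] using integrable_bump_mul_score_sq

theorem integral_score_sq_le : ∫ w, score w ^ 2 ∂bumpMeasure ≤ 10 := by
  rw [integral_bumpMeasure]
  refine (integral_mono integrable_bump_mul_score_sq integrable_indicator_sq
    bump_mul_score_sq_le).trans_eq ?_
  rw [integral_indicator measurableSet_Icc, integral_Icc_eq_integral_Ioc,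
    ← intervalIntegral.integral_of_le (by norm_num), intervalIntegral.integral_const_mul,
    integral_pow]
  norm_num

end Bump

theorem integral_pi_bumpMeasure {ι : Type*} [Fintype ι] (f : (ι → ℝ) → ℝ) :
    ∫ y, f y ∂(Measure.pi fun _ : ι => bumpMeasure) = ∫ y : ι → ℝ, (∏ i, bump (y i)) * f y := by
  have hm : Measurable fun y : ι → ℝ => ENNReal.ofReal (∏ i, bump (y i)) :=
    (Finset.measurable_prod _ fun i _ =>
      continuous_bump.measurable.comp (measurable_pi_apply i)).ennreal_ofReal
  simp only [bumpMeasure]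
  rw [pi_withDensity_ofReal (fun _ => integrable_bump) (fun _ => bump_nonneg),
    integral_withDensity_eq_integral_toReal_smul hm (.of_forall fun _ => ENNReal.ofReal_lt_top)]
  simp only [ENNReal.toReal_ofReal (Finset.prod_nonneg fun i _ => bump_nonneg _), smul_eq_mul]

/-! ### Integration by parts along an invariant direction -/

section Translate

variable {ι : Type*} [Fintype ι] [DecidableEq ι]

/-- The derivative of the integral of `∏ i, p i (y i)` against a function that is invariant in a
direction `b`, along `b`. -/
theorem integral_deriv_translate_eq_zero {p p' : ι → ℝ → ℝ}
    (hp : ∀ i x, HasDerivAt (p i) (p' i x) x) (hpc : ∀ i, Continuous (p' i))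
    (h0 : ∀ i x, 1 < |x| → p i x = 0) (h0' : ∀ i x, 1 < |x| → p' i x = 0)
    {g : (ι → ℝ) → ℝ} (hg : Measurable g) {C : ℝ} (hgC : ∀ y, |g y| ≤ C) {b : ι → ℝ}
    (hinv : ∀ y (τ : ℝ), g (y + τ • b) = g y) :
    ∫ y : ι → ℝ, g y * ∑ i, (∏ k ∈ Finset.univ.erase i, p k (y k)) * (p' i (y i) * b i) = 0 := by
  have hpc' : ∀ i, Continuous (p i) := fun i =>
    continuous_iff_continuousAt.2 fun x => (hp i x).continuousAt
  have hC : 0 ≤ C := (abs_nonneg _).trans (hgC 0)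
  set D : ℝ × (ι → ℝ) → ℝ := fun q => ∑ i, (∏ k ∈ Finset.univ.erase i, p k (q.2 k + q.1 * b k)) *
    (p' i (q.2 i + q.1 * b i) * b i) with hD
  have hDc : Continuous D := by
    refine continuous_finsetSum _ fun i _ => ?_
    have h1 : ∀ k, Continuous fun q : ℝ × (ι → ℝ) => q.2 k + q.1 * b k := fun k => by fun_prop
    exact (continuous_finsetProd _ fun k _ => (hpc' k).comp (h1 k)).mul
      (((hpc i).comp (h1 i)).mul continuous_const)
  set r := 1 + ‖b‖
  have hfar : ∀ (τ : ℝ) (y : ι → ℝ), |τ| ≤ 1 → y ∉ Metric.closedBall (0 : ι → ℝ) r →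
      ∃ i, 1 < |y i + τ * b i| := by
    intro τ y hτ hy
    rw [mem_closedBall_zero_iff, pi_norm_le_iff_of_nonneg (by positivity)] at hy
    push Not at hy
    obtain ⟨i, hi⟩ := hy
    refine ⟨i, ?_⟩
    have h1 : |τ * b i| ≤ ‖b‖ := by
      rw [abs_mul]
      have := norm_le_pi_norm b i
      rw [Real.norm_eq_abs] at this
      nlinarith [abs_nonneg τ, abs_nonneg (b i)]
    have h2 := abs_sub_abs_le_abs_sub (y i) (-(τ * b i))
    rw [abs_neg, sub_neg_eq_add] at h2
    rw [Real.norm_eq_abs] at hi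
    simp only [r] at hi
    linarith
  have hD0 : ∀ (τ : ℝ) (y : ι → ℝ), |τ| ≤ 1 → y ∉ Metric.closedBall (0 : ι → ℝ) r →
      D (τ, y) = 0 := by
    intro τ y hτ hy
    obtain ⟨j, hj⟩ := hfar τ y hτ hy
    refine Finset.sum_eq_zero fun i _ => ?_
    by_cases hij : j = i
    · subst hij
      simp only [h0' j _ hj, zero_mul, mul_zero]
    · rw [Finset.prod_eq_zero (Finset.mem_erase.2 ⟨hij, Finset.mem_univ j⟩) (h0 j _ hj), zero_mul]
  obtain ⟨A, hA⟩ := ((isCompact_Icc (a := (-1 : ℝ)) (b := 1)).prod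
    (isCompact_closedBall (0 : ι → ℝ) r)).exists_bound_of_continuousOn hDc.continuousOn
  set F : ℝ → (ι → ℝ) → ℝ := fun τ y => g y * ∏ i, p i (y i + τ * b i) with hF
  have hFm : ∀ τ, AEStronglyMeasurable (F τ) volume := fun τ =>
    (hg.mul (Finset.measurable_prod _ fun i _ => (hpc' i).measurable.comp
      ((measurable_pi_apply i).add_const _))).aestronglyMeasurable
  have hF0 : Integrable (F 0) := by
    refine Integrable.bdd_mul (c := C) ?_ hg.aestronglyMeasurable (.of_forall hgC)
    refine Continuous.integrable_of_hasCompactSupport (continuous_finsetProd _ fun i _ =>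
      (hpc' i).comp ((continuous_apply i).add continuous_const))
      (HasCompactSupport.intro (isCompact_closedBall (0 : ι → ℝ) r) fun y hy => ?_)
    obtain ⟨j, hj⟩ := hfar 0 y (by simp) hy
    exact Finset.prod_eq_zero (Finset.mem_univ j) (h0 j _ hj)
  -- Only the density is differentiated, so `g` need not be regular. For `|τ| ≤ 1` everything lives
  -- in one ball, where the derivative of the product is bounded by compactness.
  have key := hasDerivAt_integral_of_dominated_loc_of_deriv_le (μ := (volume : Measure (ι → ℝ)))
    (F := F) (x₀ := 0) (s := Metric.ball 0 1) (Metric.ball_mem_nhds _ one_pos)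
    (.of_forall hFm) hF0 (F' := fun τ y => g y * D (τ, y))
    (hg.mul (hDc.measurable.comp (measurable_const.prodMk measurable_id))).aestronglyMeasurable
    (bound := Set.indicator (Metric.closedBall (0 : ι → ℝ) r) fun _ => C * A)
    (.of_forall fun y τ hτ => by
      have hτ : |τ| ≤ 1 := by simpa using (mem_ball_zero_iff.1 hτ).le
      rw [norm_mul]
      by_cases hy : y ∈ Metric.closedBall (0 : ι → ℝ) r
      · rw [Set.indicator_of_mem hy]
        exact mul_le_mul (hgC y) (hA (τ, y) ⟨abs_le.1 hτ, hy⟩) (norm_nonneg _) hC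
      · rw [Set.indicator_of_notMem hy, hD0 τ y hτ hy, norm_zero, mul_zero])
    ((integrable_indicator_iff measurableSet_closedBall).2
      (integrableOn_const (measure_closedBall_lt_top).ne))
    (.of_forall fun y τ _ => by
      refine HasDerivAt.const_mul (g y) ?_
      have h1 : ∀ i ∈ Finset.univ, HasDerivAt (fun τ => p i (y i + τ * b i))
          (p' i (y i + τ * b i) * b i) τ := fun i _ => by
        have h2 : HasDerivAt (fun τ : ℝ => y i + τ * b i) (b i) τ := by
          simpa using ((hasDerivAt_id τ).mul_const (b i)).const_add (y i)
        exact (hp i _).comp τ h2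
      simpa only [smul_eq_mul] using HasDerivAt.fun_finsetProd h1)
  -- As `g` is invariant along `b`, the shift can be undone by a change of variables.
  have hconst : (fun τ => ∫ y, F τ y) = fun _ => ∫ y, F 0 y := by
    ext τ
    rw [← integral_add_right_eq_self (F 0) (τ • b)]
    refine integral_congr_ae (.of_forall fun y => ?_)
    simp only [hF, hinv, Pi.add_apply, Pi.smul_apply, smul_eq_mul, zero_mul, add_zero]
  have h3 := key.2
  rw [hconst] at h3
  have h4 := h3.unique (hasDerivAt_const _ _)
  simpa only [hD, zero_mul, add_zero] using h4

/-- The weights `h` allow two uses: weight 1 everywhere gives scores only, and one factor `kap`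
turns the score of that coordinate into the coordinate itself. -/
theorem integral_weighted_score_eq_zero {h r : ι → ℝ → ℝ}
    (hd : ∀ i x, HasDerivAt (fun w => h i w * bump w) (-(r i x * bump x)) x)
    (hc : ∀ i, Continuous fun x => r i x * bump x)
    {g : (ι → ℝ) → ℝ} (hg : Measurable g) {C : ℝ} (hgC : ∀ y, |g y| ≤ C) {b : ι → ℝ}
    (hinv : ∀ y (τ : ℝ), g (y + τ • b) = g y) :
    ∫ y, g y * ∑ i, b i * (r i (y i) * ∏ k ∈ Finset.univ.erase i, h k (y k))
      ∂(Measure.pi fun _ : ι => bumpMeasure) = 0 := by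
  have key := integral_deriv_translate_eq_zero hd (fun i => (hc i).neg)
    (fun i x hx => by rw [bump_eq_zero hx.le, mul_zero])
    (fun i x hx => by rw [bump_eq_zero hx.le, mul_zero, neg_zero]) hg hgC hinv
  rw [integral_pi_bumpMeasure, ← neg_eq_zero, ← integral_neg, ← key]
  refine integral_congr_ae (.of_forall fun y => ?_)
  simp only
  rw [mul_left_comm, ← mul_neg, Finset.mul_sum, ← Finset.sum_neg_distrib]
  congr 1
  refine Finset.sum_congr rfl fun i _ => ?_
  rw [← Finset.mul_prod_erase Finset.univ (fun i => bump (y i)) (Finset.mem_univ i),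
    Finset.prod_mul_distrib]
  ring

theorem integral_score_eq_zero {g : (ι → ℝ) → ℝ} (hg : Measurable g) {C : ℝ}
    (hgC : ∀ y, |g y| ≤ C) {b : ι → ℝ} (hinv : ∀ y (τ : ℝ), g (y + τ • b) = g y) :
    ∫ y, g y * ∑ i, b i * score (y i) ∂(Measure.pi fun _ : ι => bumpMeasure) = 0 := by
  have h := integral_weighted_score_eq_zero (ι := ι) (h := fun _ _ => 1) (r := fun _ => score)
    (fun i x => by simpa using hasDerivAt_bump x)
    (fun i => by simp only [score_mul_bump]; fun_prop) hg hgC hinv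
  simpa using h

theorem integral_shift_eq_zero (i₀ : ι) {g : (ι → ℝ) → ℝ} (hg : Measurable g) {C : ℝ}
    (hgC : ∀ y, |g y| ≤ C) {b : ι → ℝ} (hinv : ∀ y (τ : ℝ), g (y + τ • b) = g y) :
    ∫ y, g y * ∑ i, b i * (if i = i₀ then y i else kap (y i₀) * score (y i))
      ∂(Measure.pi fun _ : ι => bumpMeasure) = 0 := by
  have h := integral_weighted_score_eq_zero (ι := ι) (h := fun i w => if i = i₀ then kap w else 1)
    (r := fun i w => if i = i₀ then w else score w)
    (fun i x => by
      by_cases hi : i = i₀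
      · simpa only [if_pos hi] using hasDerivAt_kap_mul_bump x
      · simpa only [if_neg hi, one_mul] using hasDerivAt_bump x)
    (fun i => by
      by_cases hi : i = i₀
      · simp only [if_pos hi]; exact continuous_id.mul continuous_bump
      · simp only [if_neg hi, score_mul_bump]; fun_prop) hg hgC hinv
  rw [← h]
  refine integral_congr_ae (.of_forall fun y => ?_)
  simp only
  congr 1
  refine Finset.sum_congr rfl fun i _ => ?_
  by_cases hi : i = i₀
  · subst hi
    simp only [if_true]
    rw [Finset.prod_eq_one, mul_one]
    intro k hk
    rw [if_neg (Finset.ne_of_mem_erase hk)]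
  · simp only [if_neg hi]
    rw [Finset.prod_ite_eq' (Finset.univ.erase i) i₀ (fun k => kap (y k)),
      if_pos (Finset.mem_erase.2 ⟨fun h => hi h.symm, Finset.mem_univ _⟩), mul_comm (kap _)]

end Translate

/-! ### Independent blocks and projections onto two directions -/

/-- Replacing some of the coordinates by an independent copy. -/
theorem measurePreserving_resample {ι : Type*} [Fintype ι] (ν : Measure ℝ)
    [IsProbabilityMeasure ν] (q : ι → Prop) [DecidablePred q] :
    MeasurePreserving (fun (p : (ι → ℝ) × (ι → ℝ)) i => if q i then p.2 i else p.1 i)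
      ((Measure.pi fun _ => ν).prod (Measure.pi fun _ => ν)) (Measure.pi fun _ => ν) := by
  have hm : Measurable fun (p : (ι → ℝ) × (ι → ℝ)) i => if q i then p.2 i else p.1 i := by
    refine measurable_pi_iff.2 fun i => ?_
    by_cases hi : q i <;> simp only [hi, if_true, if_false] <;> fun_prop
  refine ⟨hm, (Measure.pi_eq fun s hs => ?_).symm⟩
  rw [Measure.map_apply hm (MeasurableSet.univ_pi hs)]
  have h : (fun (p : (ι → ℝ) × (ι → ℝ)) i => if q i then p.2 i else p.1 i) ⁻¹' Set.univ.pi s =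
      (Set.univ.pi fun i => if q i then Set.univ else s i) ×ˢ
        (Set.univ.pi fun i => if q i then s i else Set.univ) := by
    ext p
    simp only [Set.mem_preimage, Set.mem_pi, Set.mem_univ, true_imp_iff, Set.mem_prod]
    rw [← forall_and]
    refine forall_congr' fun i => ?_
    by_cases hi : q i <;> simp [hi]
  rw [h, Measure.prod_prod, Measure.pi_pi, Measure.pi_pi, ← Finset.prod_mul_distrib]
  refine Finset.prod_congr rfl fun i _ => ?_
  by_cases hi : q i <;> simp [hi]

section TwoDirections

variable {E : Type*} [NormedAddCommGroup E] [InnerProductSpace ℝ E]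

/-- The orthogonal projection onto the span of `v₁, v₂`, when they are orthogonal and each of them
is a unit vector or zero. -/
def proj₂ (v₁ v₂ w : E) : E := inner ℝ v₁ w • v₁ + inner ℝ v₂ w • v₂

theorem inner_proj₂_comm (v₁ v₂ w w' : E) :
    inner ℝ (proj₂ v₁ v₂ w) w' = inner ℝ w (proj₂ v₁ v₂ w') := by
  simp only [proj₂, inner_add_left, inner_add_right, real_inner_smul_left, real_inner_smul_right,
    real_inner_comm w]
  ring

theorem norm_proj₂_le {v₁ v₂ : E} (h₁ : ‖v₁‖ ≤ 1) (h₂ : ‖v₂‖ ≤ 1) (w : E) :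
    ‖proj₂ v₁ v₂ w‖ ≤ 2 * ‖w‖ := by
  have h : ∀ v : E, ‖v‖ ≤ 1 → ‖inner ℝ v w • v‖ ≤ ‖w‖ := by
    intro v hv
    rw [norm_smul]
    have := norm_inner_le_norm (𝕜 := ℝ) v w
    have h1 : ‖v‖ * ‖w‖ ≤ ‖w‖ := mul_le_of_le_one_left (norm_nonneg _) hv
    calc ‖inner ℝ v w‖ * ‖v‖ ≤ ‖w‖ * 1 :=
          mul_le_mul (this.trans h1) hv (norm_nonneg _) (norm_nonneg _)
      _ = ‖w‖ := mul_one _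
  refine (norm_add_le _ _).trans ?_
  linarith [h v₁ h₁, h v₂ h₂]

theorem norm_proj₂_sq_le {v₁ v₂ : E} (h₁ : ‖v₁‖ ≤ 1) (h₂ : ‖v₂‖ ≤ 1) (h : inner ℝ v₁ v₂ = 0)
    (w : E) : ‖proj₂ v₁ v₂ w‖ ^ 2 ≤ inner ℝ v₁ w ^ 2 + inner ℝ v₂ w ^ 2 := by
  rw [proj₂, norm_add_sq_real, real_inner_smul_left, real_inner_smul_right, h, norm_smul, norm_smul,
    mul_pow, mul_pow, Real.norm_eq_abs, Real.norm_eq_abs, sq_abs, sq_abs]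
  have h3 : ‖v₁‖ ^ 2 ≤ 1 := by nlinarith [norm_nonneg v₁]
  have h4 : ‖v₂‖ ^ 2 ≤ 1 := by nlinarith [norm_nonneg v₂]
  nlinarith [sq_nonneg (inner ℝ v₁ w), sq_nonneg (inner ℝ v₂ w)]

theorem inner_sub_proj₂_eq_zero {v₁ v₂ : E} (h₁ : ‖v₁‖ = 1 ∨ v₁ = 0) (h₂ : ‖v₂‖ = 1 ∨ v₂ = 0)
    (h : inner ℝ v₁ v₂ = 0) (w : E) :
    inner ℝ v₁ (w - proj₂ v₁ v₂ w) = 0 ∧ inner ℝ v₂ (w - proj₂ v₁ v₂ w) = 0 := by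
  have h' : inner ℝ v₂ v₁ = 0 := by rw [real_inner_comm, h]
  constructor
  · rcases h₁ with h₁ | h₁
    · rw [proj₂, inner_sub_right, inner_add_right, real_inner_smul_right, real_inner_smul_right, h,
        real_inner_self_eq_norm_sq, h₁]
      ring
    · rw [h₁, inner_zero_left]
  · rcases h₂ with h₂ | h₂
    · rw [proj₂, inner_sub_right, inner_add_right, real_inner_smul_right, real_inner_smul_right, h',
        real_inner_self_eq_norm_sq, h₂]
      ring
    · rw [h₂, inner_zero_left]

end TwoDirections

section Blocks

variable {β : Type*} {d : ℕ}

/-- The law of independent random vectors, indexed by `β`, with independent coordinates. -/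
abbrev blockLaw (β : Type*) [Fintype β] (d : ℕ) : Measure (β × Fin d → ℝ) :=
  Measure.pi fun _ => bumpMeasure

/-- The vector of the values of `h` at the coordinates of the block `b`. -/
def blockVec (h : ℝ → ℝ) (y : β × Fin d → ℝ) (b : β) : Vec d :=
  WithLp.toLp 2 fun j => h (y (b, j))

theorem inner_blockVec (h : ℝ → ℝ) (v : Vec d) (y : β × Fin d → ℝ) (b : β) :
    inner ℝ v (blockVec h y b) = ∑ j, v j * h (y (b, j)) := by
  simp [blockVec, PiLp.inner_apply, mul_comm]

theorem measurable_blockVec {h : ℝ → ℝ} (hh : Measurable h) (b : β) :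
    Measurable fun y : β × Fin d → ℝ => blockVec h y b :=
  (WithLp.measurable_toLp 2 _).comp
    (measurable_pi_iff.2 fun j => hh.comp (measurable_pi_apply (b, j)))

theorem memLp_eval [Fintype β] {h : ℝ → ℝ} (hL : MemLp h 2 bumpMeasure) (i : β × Fin d) :
    MemLp (fun y => h (y i)) 2 (blockLaw β d) :=
  hL.comp_measurePreserving (measurePreserving_eval _ i)

theorem memLp_blockVec [Fintype β] {h : ℝ → ℝ} (hL : MemLp h 2 bumpMeasure) (b : β) :
    MemLp (fun y : β × Fin d → ℝ => blockVec h y b) 2 (blockLaw β d) :=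
  MemLp.of_eval_piLp fun j => memLp_eval hL (b, j)

theorem integral_eval_mul_eval [Fintype β] {h : ℝ → ℝ} (hL : MemLp h 2 bumpMeasure)
    (h0 : ∫ w, h w ∂bumpMeasure = 0) {i k : β × Fin d} (hik : i ≠ k) :
    ∫ y, h (y i) * h (y k) ∂(blockLaw β d) = 0 := by
  have hI := (iIndepFun_pi (μ := fun _ : β × Fin d => bumpMeasure) (X := fun _ => h)
    fun _ => hL.aestronglyMeasurable.aemeasurable).indepFun hik
  rw [hI.integral_fun_mul_eq_mul_integral (memLp_eval hL i).1 (memLp_eval hL k).1,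
    integral_comp_eval (μ := fun _ : β × Fin d => bumpMeasure) hL.aestronglyMeasurable, h0,
    zero_mul]

/-- The coordinates are orthogonal in `L²`, so the second moment along one direction is that of a
single coordinate, free of `d`. -/
theorem integral_inner_sq_blockVec_le_of_norm_le [Fintype β] {h : ℝ → ℝ} (hL : MemLp h 2 bumpMeasure)
    (h0 : ∫ w, h w ∂bumpMeasure = 0) {s : ℝ} (hs : ∫ w, h w ^ 2 ∂bumpMeasure ≤ s) (b : β)
    {v : Vec d} (hv : ‖v‖ ≤ 1) : ∫ y, inner ℝ v (blockVec h y b) ^ 2 ∂(blockLaw β d) ≤ s := by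
  have hs0 : 0 ≤ s := (integral_nonneg fun w => sq_nonneg _).trans hs
  have hsq : ∀ i : β × Fin d, ∫ y, ‖h (y i)‖ ^ 2 ∂(blockLaw β d) ≤ s := by
    intro i
    have hm : AEStronglyMeasurable (fun w => h w ^ 2) bumpMeasure := hL.1.pow 2
    have e := integral_comp_eval (μ := fun _ : β × Fin d => bumpMeasure) (i := i) hm
    simp only [Real.norm_eq_abs, sq_abs]
    exact e.trans_le hs
  have horth : ∀ j ∈ Finset.univ, ∀ k ∈ Finset.univ, j ≠ k →
      ∫ y : β × Fin d → ℝ, inner ℝ (h (y (b, j))) (h (y (b, k))) ∂(blockLaw β d) = 0 := by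
    intro j _ k _ hjk
    have hne : (b, k) ≠ (b, j) := fun h => hjk (Prod.ext_iff.1 h).2.symm
    exact integral_eval_mul_eval hL h0 hne
  have h1 := integral_normSq_sum_le (P := blockLaw β d)
    (ξ := fun (j : Fin d) (y : β × Fin d → ℝ) => h (y (b, j))) Finset.univ
    (fun j _ => memLp_eval hL (b, j)) horth (fun j _ => hsq (b, j)) fun j => v j
  simp only [Real.norm_eq_abs, sq_abs, smul_eq_mul] at h1
  simp only [inner_blockVec]
  refine h1.trans (mul_le_of_le_one_left hs0 ?_)
  rw [← EuclideanSpace.real_norm_sq_eq]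
  nlinarith [norm_nonneg v]

variable [DecidableEq β]

/-- Replaces the block `b` of `y` by that of `y'`. -/
def putBlock (b : β) (y y' : β × Fin d → ℝ) : β × Fin d → ℝ := fun i => if i.1 = b then y' i else y i

theorem blockVec_putBlock_self (h : ℝ → ℝ) (b : β) (y y' : β × Fin d → ℝ) :
    blockVec h (putBlock b y y') b = blockVec h y' b := by
  simp [blockVec, putBlock]

theorem blockVec_putBlock_of_ne (h : ℝ → ℝ) {b c : β} (hbc : c ≠ b) (y y' : β × Fin d → ℝ) :
    blockVec h (putBlock b y y') c = blockVec h y c := by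
  simp [blockVec, putBlock, hbc]

variable [Fintype β]

theorem measurePreserving_putBlock (b : β) :
    MeasurePreserving (fun p : (β × Fin d → ℝ) × (β × Fin d → ℝ) => putBlock b p.1 p.2)
      ((blockLaw β d).prod (blockLaw β d)) (blockLaw β d) :=
  measurePreserving_resample bumpMeasure fun i : β × Fin d => i.1 = b

theorem measurable_putBlock (b : β) (y : β × Fin d → ℝ) : Measurable (putBlock b y) :=
  (measurePreserving_putBlock b).measurable.comp (measurable_const.prodMk measurable_id)

/-- Resampling one block preserves the law; the inner integral plays the part of the conditional
expectation given the other blocks. -/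
theorem integral_eq_integral_putBlock (b : β) {F : (β × Fin d → ℝ) → ℝ}
    (hF : Integrable F (blockLaw β d)) : ∫ y, F y ∂(blockLaw β d) =
      ∫ y, ∫ y', F (putBlock b y y') ∂(blockLaw β d) ∂(blockLaw β d) := by
  have hp := measurePreserving_putBlock (d := d) b
  have h : ∫ y, F y ∂(blockLaw β d) =
      ∫ p, F (putBlock b p.1 p.2) ∂((blockLaw β d).prod (blockLaw β d)) := by
    conv_lhs => rw [← hp.map_eq]
    exact integral_map hp.measurable.aemeasurable (by rw [hp.map_eq]; exact hF.1)
  rw [h, integral_prod]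
  exact hp.integrable_comp_of_integrable hF

theorem integral_inner_blockVec_eq_zero {h : ℝ → ℝ} (hL : MemLp h 2 bumpMeasure)
    (h0 : ∫ w, h w ∂bumpMeasure = 0) (b : β) {V : (β × Fin d → ℝ) → Vec d}
    (hV : MemLp V 2 (blockLaw β d)) (hVb : ∀ y y', V (putBlock b y y') = V y) :
    ∫ y, inner ℝ (V y) (blockVec h y b) ∂(blockLaw β d) = 0 := by
  rw [integral_eq_integral_putBlock b (integrable_inner_of_memLp hV (memLp_blockVec hL b))]
  simp only [hVb, blockVec_putBlock_self, inner_blockVec]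
  refine integral_eq_zero_of_ae (.of_forall fun y => ?_)
  simp only [Pi.zero_apply]
  rw [integral_finsetSum _ fun j _ => ((memLp_eval hL (b, j)).integrable (by norm_num)).const_mul _]
  refine Finset.sum_eq_zero fun j _ => ?_
  rw [integral_const_mul, integral_comp_eval (μ := fun _ : β × Fin d => bumpMeasure)
    hL.aestronglyMeasurable, h0, mul_zero]

theorem integral_inner_sq_blockVec_le {h : ℝ → ℝ} (hL : MemLp h 2 bumpMeasure)
    (h0 : ∫ w, h w ∂bumpMeasure = 0) {s : ℝ} (hs : ∫ w, h w ^ 2 ∂bumpMeasure ≤ s) (b : β)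
    {V : (β × Fin d → ℝ) → Vec d} (hVm : Measurable V) (hV1 : ∀ y, ‖V y‖ ≤ 1)
    (hVb : ∀ y y', V (putBlock b y y') = V y) :
    Integrable (fun y => inner ℝ (V y) (blockVec h y b) ^ 2) (blockLaw β d) ∧
      ∫ y, inner ℝ (V y) (blockVec h y b) ^ 2 ∂(blockLaw β d) ≤ s := by
  have hs0 : 0 ≤ s := (integral_nonneg fun w => sq_nonneg _).trans hs
  have hbL := memLp_blockVec (d := d) hL b
  have hi : Integrable (fun y => inner ℝ (V y) (blockVec h y b) ^ 2) (blockLaw β d) := by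
    refine (hbL.integrable_norm_pow two_ne_zero).mono'
      ((hVm.aestronglyMeasurable.inner hbL.1).pow 2) (.of_forall fun y => ?_)
    rw [Real.norm_of_nonneg (sq_nonneg _), ← sq_abs]
    refine pow_le_pow_left₀ (abs_nonneg _) ((abs_real_inner_le_norm _ _).trans ?_) 2
    exact mul_le_of_le_one_left (norm_nonneg _) (hV1 y)
  refine ⟨hi, ?_⟩
  have hfix : ∀ y, ∫ y', inner ℝ (V y) (blockVec h y' b) ^ 2 ∂(blockLaw β d) ≤ s := fun y =>
    integral_inner_sq_blockVec_le_of_norm_le hL h0 hs b (hV1 y)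
  rw [integral_eq_integral_putBlock b hi]
  simp only [hVb, blockVec_putBlock_self]
  -- No integrability has to be proved: the integral of a non-integrable function is zero by
  -- convention, and `s` is nonnegative.
  by_cases hI : Integrable (fun y => ∫ y', inner ℝ (V y) (blockVec h y' b) ^ 2 ∂(blockLaw β d))
      (blockLaw β d)
  · refine (integral_mono hI (integrable_const s) hfix).trans_eq ?_
    simp
  · rw [integral_undef hI]
    exact hs0

end Blocks

theorem abs_apply_le_norm {d : ℕ} (v : Vec d) (j : Fin d) : |v j| ≤ ‖v‖ := by
  simpa using PiLp.norm_apply_le v j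

theorem measurable_vec_apply {Y : Type*} [MeasurableSpace Y] {d : ℕ} {v : Y → Vec d}
    (hv : Measurable v) (j : Fin d) : Measurable fun y => v y j :=
  (EuclideanSpace.proj (𝕜 := ℝ) j).measurable.comp hv

theorem measurable_proj₂ {Y : Type*} [MeasurableSpace Y] {d : ℕ} {v₁ v₂ w : Y → Vec d}
    (hv₁ : Measurable v₁) (hv₂ : Measurable v₂) (hw : Measurable w) :
    Measurable fun y => proj₂ (v₁ y) (v₂ y) (w y) := by
  have h₁ : Measurable fun y => inner ℝ (v₁ y) (w y) := hv₁.inner hw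
  have h₂ : Measurable fun y => inner ℝ (v₂ y) (w y) := hv₂.inner hw
  exact (h₁.smul hv₁).add (h₂.smul hv₂)

/-! ### Correlation with a hidden vector -/

section Hidden

variable {σ : Type*} {d : ℕ}

/-- Moves the hidden vector by `w` and all other blocks by `-ε w`. -/
def shiftBlocks (ε : ℝ) (w : Vec d) : Option σ × Fin d → ℝ := fun i =>
  match i.1 with
  | none => w i.2
  | some _ => -ε * w i.2

/-- The hidden vector times a Stein kernel, paired with a statistic. -/
def steinWeight (u : (Option σ × Fin d → ℝ) → Vec d) (y : Option σ × Fin d → ℝ) : Vec d :=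
  WithLp.toLp 2 fun j => kap (y (none, j)) * u y j

theorem norm_steinWeight_le {u : (Option σ × Fin d → ℝ) → Vec d} {C : ℝ} {y : Option σ × Fin d → ℝ}
    (h : ‖u y‖ ≤ C) : ‖steinWeight u y‖ ≤ C / 6 := by
  have hC : 0 ≤ C := (norm_nonneg _).trans h
  refine (sq_le_sq₀ (norm_nonneg _) (by positivity)).1 ?_
  have h1 : ‖u y‖ ^ 2 ≤ C ^ 2 := pow_le_pow_left₀ (norm_nonneg _) h 2
  rw [EuclideanSpace.real_norm_sq_eq] at h1 ⊢
  have h2 : ∑ j, steinWeight u y j ^ 2 ≤ ∑ j, 1 / 36 * u y j ^ 2 := by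
    refine Finset.sum_le_sum fun j _ => ?_
    simp only [steinWeight, mul_pow]
    refine mul_le_mul_of_nonneg_right ?_ (sq_nonneg _)
    nlinarith [kap_nonneg (y (none, j)), kap_le (y (none, j))]
  rw [← Finset.mul_sum] at h2
  linarith

theorem measurable_steinWeight {u : (Option σ × Fin d → ℝ) → Vec d} (hu : Measurable u) :
    Measurable (steinWeight u) :=
  (WithLp.measurable_toLp 2 _).comp (measurable_pi_iff.2 fun j =>
    (continuous_kap.measurable.comp (measurable_pi_apply _)).mul
      (measurable_vec_apply hu j))

variable [DecidableEq σ]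

/-- Moves the block `s` by `w`. -/
def moveBlock (s : σ) (w : Vec d) : Option σ × Fin d → ℝ := fun i =>
  if i.1 = some s then w i.2 else 0

variable [Fintype σ]

/-- Stein's identity for the hidden vector. -/
theorem integral_inner_hidden {u : (Option σ × Fin d → ℝ) → Vec d} (hu : Measurable u) {C : ℝ}
    (huC : ∀ y, ‖u y‖ ≤ C) {ε : ℝ} (hshift : ∀ y w, u (y + shiftBlocks ε w) = u y) :
    ∫ y, inner ℝ (blockVec id y none) (u y) ∂(blockLaw (Option σ) d) =
      ε * ∑ s : σ, ∫ y, inner ℝ (steinWeight u y) (blockVec score y (some s))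
        ∂(blockLaw (Option σ) d) := by
  have hidL : MemLp (id : ℝ → ℝ) 2 bumpMeasure :=
    MemLp.of_bound measurable_id.aestronglyMeasurable 1 ae_abs_le_bumpMeasure
  have huL : MemLp u 2 (blockLaw (Option σ) d) :=
    MemLp.of_bound hu.aestronglyMeasurable C (.of_forall huC)
  have haL : MemLp (steinWeight u) 2 (blockLaw (Option σ) d) :=
    MemLp.of_bound (measurable_steinWeight hu).aestronglyMeasurable (C / 6)
      (.of_forall fun y => norm_steinWeight_le (huC y))
  have i1 := integrable_inner_of_memLp (memLp_blockVec (d := d) hidL (none : Option σ)) huL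
  have i2 := fun s : σ => integrable_inner_of_memLp haL
    (memLp_blockVec (d := d) memLp_score (some s))
  have hj : ∀ j : Fin d, ∫ y, u y j * (y (none, j) - ε * ∑ s : σ,
      kap (y (none, j)) * score (y (some s, j))) ∂(blockLaw (Option σ) d) = 0 := by
    intro j
    -- The statistic is invariant when coordinate `j` of the hidden vector grows and coordinate `j`
    -- of every other block shrinks by `ε` times as much. The kernel sits on the hidden coordinate.
    have key := integral_shift_eq_zero (ι := Option σ × Fin d) (none, j) (g := fun y => u y j)
      (measurable_vec_apply hu j)
      (fun y => (abs_apply_le_norm (u y) j).trans (huC y))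
      (b := shiftBlocks ε (EuclideanSpace.single j 1)) (fun y τ => by
        have : τ • shiftBlocks (σ := σ) ε (EuclideanSpace.single j (1 : ℝ)) =
            shiftBlocks ε (τ • EuclideanSpace.single j (1 : ℝ)) := by
          ext ⟨o, k⟩
          cases o with
          | none => simp [shiftBlocks]
          | some s => simp only [shiftBlocks, Pi.smul_apply, PiLp.smul_apply, smul_eq_mul]; ring
        rw [this, hshift])
    rw [← key]
    refine integral_congr_ae (.of_forall fun y => ?_)
    simp only
    congr 1
    rw [Fintype.sum_prod_type, Fintype.sum_option]
    have hk : ∀ (o : Option σ), ∑ k, shiftBlocks ε (EuclideanSpace.single j 1) (o, k) *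
        (if (o, k) = (none, j) then y (o, k) else kap (y (none, j)) * score (y (o, k))) =
        shiftBlocks ε (EuclideanSpace.single j 1) (o, j) *
        (if (o, j) = (none, j) then y (o, j) else kap (y (none, j)) * score (y (o, j))) := by
      intro o
      refine Finset.sum_eq_single j (fun k _ hk => ?_) (fun h => absurd (Finset.mem_univ j) h)
      cases o <;> simp [shiftBlocks, hk]
    simp only [hk]
    simp [shiftBlocks, Finset.mul_sum, sub_eq_add_neg, Finset.sum_neg_distrib]
  have hint : ∀ j : Fin d, Integrable (fun y => u y j * (y (none, j) - ε * ∑ s : σ,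
      kap (y (none, j)) * score (y (some s, j)))) (blockLaw (Option σ) d) := by
    intro j
    refine Integrable.bdd_mul (c := C) ?_
      (measurable_vec_apply hu j).aestronglyMeasurable
      (.of_forall fun y => (abs_apply_le_norm (u y) j).trans (huC y))
    refine ((memLp_eval hidL (none, j)).integrable (by norm_num)).sub
      ((integrable_finsetSum _ fun s _ => ?_).const_mul ε)
    refine Integrable.bdd_mul (c := 1 / 6) ((memLp_eval memLp_score (some s, j)).integrable
      (by norm_num)) (continuous_kap.measurable.comp (measurable_pi_apply _)).aestronglyMeasurable
      (.of_forall fun y => ?_)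
    rw [Real.norm_of_nonneg (kap_nonneg _)]
    exact kap_le _
  have hsum : ∫ y, (inner ℝ (blockVec id y none) (u y) - ε * ∑ s : σ,
      inner ℝ (steinWeight u y) (blockVec score y (some s))) ∂(blockLaw (Option σ) d) = 0 := by
    rw [← Finset.sum_eq_zero (s := Finset.univ) fun j _ => hj j,
      ← integral_finsetSum _ fun j _ => hint j]
    refine integral_congr_ae (.of_forall fun y => ?_)
    simp only [real_inner_comm (u y), inner_blockVec, steinWeight, id, mul_sub,
      Finset.sum_sub_distrib]
    rw [Finset.sum_comm]
    simp only [Finset.mul_sum]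
    congr 1
    exact Finset.sum_congr rfl fun j _ => Finset.sum_congr rfl fun s _ => by ring
  rw [integral_sub i1 ((integrable_finsetSum _ fun s _ => i2 s).const_mul ε), integral_const_mul,
    integral_finsetSum _ fun s _ => i2 s] at hsum
  linarith

/-- The score of a block is only correlated with a statistic through the queried directions. -/
theorem integral_inner_score_sub_proj₂ {u : (Option σ × Fin d → ℝ) → Vec d} (hu : Measurable u)
    {C : ℝ} (huC : ∀ y, ‖u y‖ ≤ C) (s : σ) {v₁ v₂ : (Option σ × Fin d → ℝ) → Vec d}
    (hv₁ : Measurable v₁) (hv₂ : Measurable v₂) (hn₁ : ∀ y, ‖v₁ y‖ = 1 ∨ v₁ y = 0)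
    (hn₂ : ∀ y, ‖v₂ y‖ = 1 ∨ v₂ y = 0) (horth : ∀ y, inner ℝ (v₁ y) (v₂ y) = 0)
    (hv₁s : ∀ y y', v₁ (putBlock (some s) y y') = v₁ y)
    (hv₂s : ∀ y y', v₂ (putBlock (some s) y y') = v₂ y)
    (hmove : ∀ y w, inner ℝ (v₁ y) w = 0 → inner ℝ (v₂ y) w = 0 → u (y + moveBlock s w) = u y) :
    ∫ y, inner ℝ (steinWeight u y) (blockVec score y (some s)) ∂(blockLaw (Option σ) d) =
      ∫ y, inner ℝ (steinWeight u y) (proj₂ (v₁ y) (v₂ y) (blockVec score y (some s)))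
        ∂(blockLaw (Option σ) d) := by
  set a := steinWeight u with ha
  have haC : ∀ y, ‖a y‖ ≤ C / 6 := fun y => norm_steinWeight_le (huC y)
  have ham : Measurable a := measurable_steinWeight hu
  have haL : MemLp a 2 (blockLaw (Option σ) d) :=
    MemLp.of_bound ham.aestronglyMeasurable (C / 6) (.of_forall haC)
  have hle : ∀ v : Vec d, ‖v‖ = 1 ∨ v = 0 → ‖v‖ ≤ 1 := by
    rintro v (h | rfl)
    · exact h.le
    · simp
  have hsL : MemLp (fun y : Option σ × Fin d → ℝ => blockVec score y (some s)) 2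
    (blockLaw (Option σ) d) := memLp_blockVec memLp_score (some s)
  -- The part of the basis vector `e_j` orthogonal to both queried directions. The statistic is
  -- blind to moves of the block along it.
  set c : Fin d → (Option σ × Fin d → ℝ) → Vec d := fun j y =>
    EuclideanSpace.single j 1 - proj₂ (v₁ y) (v₂ y) (EuclideanSpace.single j 1) with hc
  have hcm : ∀ j, Measurable (c j) := by
    intro j
    have hj : Measurable fun _ : Option σ × Fin d → ℝ => EuclideanSpace.single j (1 : ℝ) :=
      measurable_const
    exact hj.sub (measurable_proj₂ hv₁ hv₂ hj)
  have hcb : ∀ j y, ‖c j y‖ ≤ 3 := by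
    intro j y
    have h1 := norm_proj₂_le (hle _ (hn₁ y)) (hle _ (hn₂ y)) (EuclideanSpace.single j (1 : ℝ))
    have h2 := norm_sub_le (EuclideanSpace.single j (1 : ℝ))
      (proj₂ (v₁ y) (v₂ y) (EuclideanSpace.single j 1))
    have h3 : ‖EuclideanSpace.single j (1 : ℝ)‖ = 1 := by simp
    rw [h3] at h1 h2
    linarith
  have hcL : ∀ j, MemLp (c j) 2 (blockLaw (Option σ) d) := fun j =>
    MemLp.of_bound (hcm j).aestronglyMeasurable 3 (.of_forall (hcb j))
  have hcs : ∀ j y y', c j (putBlock (some s) y y') = c j y := by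
    intro j y y'
    simp only [hc, hv₁s, hv₂s]
  have hterm : ∀ j, Integrable (fun y => a y j * inner ℝ (c j y) (blockVec score y (some s)))
      (blockLaw (Option σ) d) := by
    intro j
    have h1 : ∀ᵐ y ∂(blockLaw (Option σ) d), ‖a y j‖ ≤ C / 6 :=
      .of_forall fun y => (abs_apply_le_norm (a y) j).trans (haC y)
    exact (integrable_inner_of_memLp (hcL j) hsL).bdd_mul
      (measurable_vec_apply ham j).aestronglyMeasurable h1
  have hzero : ∀ j, ∫ y, a y j * inner ℝ (c j y) (blockVec score y (some s))
      ∂(blockLaw (Option σ) d) = 0 := by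
    intro j
    -- With all other blocks frozen, the queried directions, and hence `c j`, are constant.
    -- Integration by parts in the block `s` alone then applies.
    rw [integral_eq_integral_putBlock (some s) (hterm j)]
    refine integral_eq_zero_of_ae (.of_forall fun y => ?_)
    simp only [hcs, blockVec_putBlock_self, Pi.zero_apply]
    have key := integral_score_eq_zero (ι := Option σ × Fin d)
      (g := fun y' => a (putBlock (some s) y y') j)
      (measurable_vec_apply (ham.comp (measurable_putBlock (some s) y)) j)
      (fun y' => (abs_apply_le_norm _ j).trans (haC _)) (b := moveBlock s (c j y))
      (fun y' τ => by
        have h1 : putBlock (some s) y (y' + τ • moveBlock s (c j y)) =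
            putBlock (some s) y y' + moveBlock s (τ • c j y) := by
          ext i
          by_cases hi : i.1 = some s <;> simp [putBlock, moveBlock, hi]
        have h2 := inner_sub_proj₂_eq_zero (hn₁ y) (hn₂ y) (horth y) (EuclideanSpace.single j 1)
        have h3 : u (putBlock (some s) y y' + moveBlock s (τ • c j y)) =
            u (putBlock (some s) y y') := by
          refine hmove _ _ ?_ ?_
          · rw [hv₁s, real_inner_smul_right, h2.1, mul_zero]
          · rw [hv₂s, real_inner_smul_right, h2.2, mul_zero]
        simp only [ha, steinWeight, h1, h3]
        simp [moveBlock])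
    rw [← key]
    refine integral_congr_ae (.of_forall fun y' => ?_)
    simp only
    congr 1
    rw [inner_blockVec, Fintype.sum_prod_type,
      Finset.sum_eq_single (some s) (fun o _ ho => by simp [moveBlock, ho]) (by simp)]
    simp [moveBlock]
  have hsplit : ∀ y, inner ℝ (a y) (blockVec score y (some s)) =
      inner ℝ (a y) (proj₂ (v₁ y) (v₂ y) (blockVec score y (some s))) +
        ∑ j, a y j * inner ℝ (c j y) (blockVec score y (some s)) := by
    intro y
    set w := blockVec score y (some s)
    have h1 : ∀ j, inner ℝ (c j y) w = w j - proj₂ (v₁ y) (v₂ y) w j := by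
      intro j
      simp only [hc]
      rw [inner_sub_left, inner_proj₂_comm, EuclideanSpace.inner_single_left,
        EuclideanSpace.inner_single_left]
      simp
    simp only [h1, mul_sub, Finset.sum_sub_distrib, PiLp.inner_apply]
    simp [mul_comm]
  have hpL : MemLp (fun y => proj₂ (v₁ y) (v₂ y) (blockVec score y (some s))) 2
      (blockLaw (Option σ) d) := by
    have hm := measurable_blockVec (d := d) measurable_score (some s)
    refine hsL.of_le_mul (c := 2) (measurable_proj₂ hv₁ hv₂ hm).aestronglyMeasurable
      (.of_forall fun y => ?_)
    exact norm_proj₂_le (hle _ (hn₁ y)) (hle _ (hn₂ y)) _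
  simp_rw [hsplit]
  rw [integral_add (integrable_inner_of_memLp haL hpL) (integrable_finsetSum _ fun j _ => hterm j),
    integral_finsetSum _ fun j _ => hterm j, Finset.sum_eq_zero fun j _ => hzero j, add_zero]

/-- A statistic that sees the hidden vector only through two directions of each block is almost
uncorrelated with it. -/
theorem abs_integral_inner_hidden_le {u : (Option σ × Fin d → ℝ) → Vec d} (hu : Measurable u)
    {C : ℝ} (huC : ∀ y, ‖u y‖ ≤ C) {ε : ℝ} (hε : 0 ≤ ε)
    (hshift : ∀ y w, u (y + shiftBlocks ε w) = u y) (step : σ → ℕ)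
    {v₁ v₂ : σ → (Option σ × Fin d → ℝ) → Vec d}
    (hv₁ : ∀ s, Measurable (v₁ s)) (hv₂ : ∀ s, Measurable (v₂ s))
    (hn₁ : ∀ s y, ‖v₁ s y‖ = 1 ∨ v₁ s y = 0) (hn₂ : ∀ s y, ‖v₂ s y‖ = 1 ∨ v₂ s y = 0)
    (horth : ∀ s y, inner ℝ (v₁ s y) (v₂ s y) = 0)
    (hv₁s : ∀ s s', step s ≤ step s' → ∀ y y', v₁ s (putBlock (some s') y y') = v₁ s y)
    (hv₂s : ∀ s s', step s ≤ step s' → ∀ y y', v₂ s (putBlock (some s') y y') = v₂ s y)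
    (hmove : ∀ s y w, inner ℝ (v₁ s y) w = 0 → inner ℝ (v₂ s y) w = 0 →
      u (y + moveBlock s w) = u y) :
    |∫ y, inner ℝ (blockVec id y none) (u y) ∂(blockLaw (Option σ) d)| ≤
      ε * (C / 6 * √(20 * Fintype.card σ)) := by
  have hC : 0 ≤ C := (norm_nonneg _).trans (huC 0)
  have hle : ∀ v : Vec d, ‖v‖ = 1 ∨ v = 0 → ‖v‖ ≤ 1 := by
    rintro v (h | rfl)
    · exact h.le
    · simp
  set a := steinWeight u with ha
  have haC : ∀ y, ‖a y‖ ≤ C / 6 := fun y => norm_steinWeight_le (huC y)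
  have ham : Measurable a := measurable_steinWeight hu
  have haL : MemLp a 2 (blockLaw (Option σ) d) :=
    MemLp.of_bound ham.aestronglyMeasurable (C / 6) (.of_forall haC)
  set p : σ → (Option σ × Fin d → ℝ) → Vec d := fun s y =>
    proj₂ (v₁ s y) (v₂ s y) (blockVec score y (some s)) with hp
  have hscm : ∀ s : σ, Measurable fun y : Option σ × Fin d → ℝ => blockVec score y (some s) :=
    fun s => measurable_blockVec measurable_score (some s)
  have hsL : ∀ s : σ, MemLp (fun y : Option σ × Fin d → ℝ => blockVec score y (some s)) 2
    (blockLaw (Option σ) d) := fun s => memLp_blockVec memLp_score (some s)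
  have hpL : ∀ s, MemLp (p s) 2 (blockLaw (Option σ) d) := fun s =>
    (hsL s).of_le_mul (c := 2) (measurable_proj₂ (hv₁ s) (hv₂ s) (hscm s)).aestronglyMeasurable
      (.of_forall fun y => norm_proj₂_le (hle _ (hn₁ s y)) (hle _ (hn₂ s y)) _)
  -- Two directions, each with Fisher information at most 10, and both determined without the block
  -- `s`.
  have hp2 : ∀ s, ∫ y, ‖p s y‖ ^ 2 ∂(blockLaw (Option σ) d) ≤ 20 := by
    intro s
    have h1 := integral_inner_sq_blockVec_le memLp_score integral_score_bumpMeasure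
      integral_score_sq_le (some s) (hv₁ s) (fun y => hle _ (hn₁ s y)) (hv₁s s s le_rfl)
    have h2 := integral_inner_sq_blockVec_le memLp_score integral_score_bumpMeasure
      integral_score_sq_le (some s) (hv₂ s) (fun y => hle _ (hn₂ s y)) (hv₂s s s le_rfl)
    refine (integral_mono ((hpL s).integrable_norm_pow two_ne_zero) (h1.1.add h2.1) fun y =>
      norm_proj₂_sq_le (hle _ (hn₁ s y)) (hle _ (hn₂ s y)) (horth s y) _).trans ?_
    rw [integral_add' h1.1 h2.1]
    linarith [h1.2, h2.2]
  -- A martingale-difference argument: when `s'` is not earlier than `s`, everything but the score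
  -- of `s'` is independent of the block `s'`. This includes distinct machines at the same step.
  have hporth : ∀ s s', s ≠ s' → ∫ y, inner ℝ (p s y) (p s' y) ∂(blockLaw (Option σ) d) = 0 := by
    intro s s' hne
    wlog hst : step s ≤ step s' generalizing s s'
    · rw [← this s' s hne.symm (by omega)]
      simp_rw [real_inner_comm]
    have h1 : ∀ y, inner ℝ (p s y) (p s' y) =
        inner ℝ (proj₂ (v₁ s' y) (v₂ s' y) (p s y)) (blockVec score y (some s')) := fun y =>
      (inner_proj₂_comm _ _ _ _).symm
    simp_rw [h1]
    refine integral_inner_blockVec_eq_zero memLp_score integral_score_bumpMeasure (some s') ?_ ?_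
    · exact (hpL s).of_le_mul (c := 2) (measurable_proj₂ (hv₁ s') (hv₂ s')
        (measurable_proj₂ (hv₁ s) (hv₂ s) (hscm s))).aestronglyMeasurable
        (.of_forall fun y => norm_proj₂_le (hle _ (hn₁ s' y)) (hle _ (hn₂ s' y)) _)
    · intro y y'
      have hne' : some s ≠ some s' := fun h => hne (Option.some_injective _ h)
      simp only [hp, hv₁s s s' hst, hv₂s s s' hst, hv₁s s' s' le_rfl, hv₂s s' s' le_rfl,
        blockVec_putBlock_of_ne score hne']
  have hsum := integral_normSq_sum_le (P := blockLaw (Option σ) d) Finset.univ (fun s _ => hpL s)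
    (fun s _ s' _ hne => hporth s s' hne) (fun s _ => hp2 s) fun _ => 1
  simp only [one_smul, one_pow, Finset.sum_const, Finset.card_univ, nsmul_eq_mul, mul_one] at hsum
  have hsumL : MemLp (fun y => ∑ s, p s y) 2 (blockLaw (Option σ) d) :=
    memLp_finsetSum _ fun s _ => hpL s
  have hnorm := integral_norm_le_sqrt hsumL hsum
  have hkey : ∑ s, ∫ y, inner ℝ (a y) (blockVec score y (some s)) ∂(blockLaw (Option σ) d) =
      ∫ y, inner ℝ (a y) (∑ s, p s y) ∂(blockLaw (Option σ) d) := by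
    simp only [inner_sum]
    rw [integral_finsetSum _ fun s _ => integrable_inner_of_memLp haL (hpL s)]
    exact Finset.sum_congr rfl fun s _ => integral_inner_score_sub_proj₂ hu huC s (hv₁ s) (hv₂ s)
      (hn₁ s) (hn₂ s) (horth s) (hv₁s s s le_rfl) (hv₂s s s le_rfl) (hmove s)
  rw [integral_inner_hidden hu huC hshift, hkey, abs_mul, abs_of_nonneg hε]
  refine mul_le_mul_of_nonneg_left ?_ hε
  have h1 : |∫ y, inner ℝ (a y) (∑ s, p s y) ∂(blockLaw (Option σ) d)| ≤
      ∫ y, C / 6 * ‖∑ s, p s y‖ ∂(blockLaw (Option σ) d) := by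
    refine (abs_integral_le_integral_abs).trans (integral_mono
      (integrable_inner_of_memLp haL hsumL).abs
      ((hsumL.integrable (by norm_num)).norm.const_mul _) fun y => ?_)
    exact (abs_real_inner_le_norm _ _).trans
      (mul_le_mul_of_nonneg_right (haC y) (norm_nonneg _))
  rw [integral_const_mul] at h1
  rw [mul_comm (20 : ℝ)]
  exact h1.trans (mul_le_mul_of_nonneg_left hnorm (by positivity))

end Hidden

/-! ### Gram–Schmidt for a pair of queries -/

section Directions

variable {E : Type*} [NormedAddCommGroup E] [InnerProductSpace ℝ E]

theorem norm_inv_norm_smul (x : E) : ‖‖x‖⁻¹ • x‖ = 1 ∨ ‖x‖⁻¹ • x = 0 := by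
  rcases eq_or_ne x 0 with rfl | h
  · right; simp
  · left
    rw [norm_smul, norm_inv, norm_norm, inv_mul_cancel₀ (norm_ne_zero_iff.2 h)]

/-- The first of the two orthogonal directions spanned by a pair of vectors. -/
def dir₁ (x : E × E) : E := ‖x.1‖⁻¹ • x.1

/-- The component of the second vector of a pair that is orthogonal to the first one. -/
def orthPart (x : E × E) : E := x.2 - inner ℝ (dir₁ x) x.2 • dir₁ x

/-- The second of the two orthogonal directions spanned by a pair of vectors. -/
def dir₂ (x : E × E) : E := ‖orthPart x‖⁻¹ • orthPart x

theorem inner_dir₁_dir₂ (x : E × E) : inner ℝ (dir₁ x) (dir₂ x) = 0 := by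
  rw [dir₂, orthPart, real_inner_smul_right, inner_sub_right, real_inner_smul_right,
    real_inner_self_eq_norm_sq]
  rcases norm_inv_norm_smul x.1 with h | h
  · rw [dir₁, h]; ring
  · rw [dir₁, h]; simp

theorem norm_smul_inv_norm_smul (x : E) : ‖x‖ • ‖x‖⁻¹ • x = x := by
  rcases eq_or_ne x 0 with rfl | h
  · simp
  · rw [smul_smul, mul_inv_cancel₀ (norm_ne_zero_iff.2 h), one_smul]

/-- The two directions span the two queries, also in degenerate cases where a direction is zero
because the inverse of zero is zero. -/
theorem inner_eq_zero_of_dir {x : E × E} {w : E} (h₁ : inner ℝ (dir₁ x) w = 0)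
    (h₂ : inner ℝ (dir₂ x) w = 0) : inner ℝ x.1 w = 0 ∧ inner ℝ x.2 w = 0 := by
  have h3 : inner ℝ (orthPart x) w = 0 := by
    rw [← norm_smul_inv_norm_smul (orthPart x), real_inner_smul_left]
    exact mul_eq_zero_of_right _ h₂
  constructor
  · rw [← norm_smul_inv_norm_smul x.1, real_inner_smul_left]
    exact mul_eq_zero_of_right _ h₁
  · rw [orthPart, inner_sub_left, real_inner_smul_left, h₁, mul_zero, sub_zero] at h3
    exact h3

end Directions

theorem measurable_dir₁ {d : ℕ} : Measurable (dir₁ : Vec d × Vec d → Vec d) :=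
  (measurable_fst.norm.inv).smul measurable_fst

theorem measurable_dir₂ {d : ℕ} : Measurable (dir₂ : Vec d × Vec d → Vec d) := by
  have h1 : Measurable fun x : Vec d × Vec d => inner ℝ (dir₁ x) x.2 :=
    measurable_dir₁.inner measurable_snd
  have h : Measurable (orthPart : Vec d × Vec d → Vec d) :=
    measurable_snd.sub (h1.smul measurable_dir₁)
  exact (h.norm.inv).smul h

theorem measurable_hardCost_comp {Y : Type*} [MeasurableSpace Y] {d : ℕ} {G B : ℝ}
    {Z : Y → Vec d} (hZ : Measurable Z) :
    Measurable fun p : Y × Vec d => hardCost G B (Z p.1) p.2 :=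
  continuous_hardCost.measurable.comp ((hZ.comp measurable_fst).prodMk measurable_snd)

theorem TwoPointAlgorithm.measurable_points_apply {S Y : Type*} [MeasurableSpace S]
    [MeasurableSpace Y] {d M K : ℕ} (A : TwoPointAlgorithm S d M K)
    {φ : Y → ℕ → Fin M → Vec d → ℝ} (hφ : ∀ t m, Measurable fun p : Y × Vec d => φ p.1 t m p.2)
    (ω : S) (t : ℕ) (m : Fin M) : Measurable fun y => A.points (φ y) ω t m := by
  have h : Measurable fun y : Y => (ω, y) := measurable_const.prodMk measurable_id
  exact (A.measurable_points hφ t m).comp h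

theorem ae_abs_le_pi_bumpMeasure {ι : Type*} [Fintype ι] :
    ∀ᵐ y ∂(Measure.pi fun _ : ι => bumpMeasure), ∀ i, |y i| ≤ 1 :=
  ae_all_iff.2 fun i =>
    (measurePreserving_eval (fun _ : ι => bumpMeasure) i).quasiMeasurePreserving.ae
      ae_abs_le_bumpMeasure

theorem memLp_id_bumpMeasure : MemLp (id : ℝ → ℝ) 2 bumpMeasure :=
  MemLp.of_bound measurable_id.aestronglyMeasurable 1 ae_abs_le_bumpMeasure

theorem norm_blockVec_id_le {β : Type*} {d : ℕ} {y : β × Fin d → ℝ} (hy : ∀ i, |y i| ≤ 1) (b : β) :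
    ‖blockVec id y b‖ ≤ √(d : ℝ) := by
  refine Real.le_sqrt_of_sq_le ?_
  rw [EuclideanSpace.real_norm_sq_eq]
  refine (Finset.sum_le_sum fun j _ => ?_).trans_eq (b := ∑ _j : Fin d, (1 : ℝ)) (by simp)
  simp only [blockVec, id, ← sq_abs (y _)]
  nlinarith [hy (b, j), abs_nonneg (y (b, j))]

/-! ### The lower bound in terms of the dimension -/

section HiddenVector

variable {d M R : ℕ}

/-- The block of machine `m` at step `t`; the hidden vector is the block `none`. -/
def gameBlock (R : ℕ) (t : ℕ) (m : Fin M) : Option (Fin R × Fin M) :=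
  if h : t < R then some (⟨t, h⟩, m) else none

/-- A small hidden vector, blurred by noise of order one. -/
def hiddenCost (γ ε : ℝ) (t : ℕ) (m : Fin M) (y : Option (Fin R × Fin M) × Fin d → ℝ) : Vec d :=
  γ • (blockVec id y (gameBlock R t m) + ε • blockVec id y none)

theorem gameBlock_of_lt {t : ℕ} (h : t < R) (m : Fin M) : gameBlock R t m = some (⟨t, h⟩, m) :=
  dif_pos h

theorem measurable_hiddenCost (γ ε : ℝ) (t : ℕ) (m : Fin M) :
    Measurable (hiddenCost (d := d) (R := R) γ ε t m) := by
  have h1 := measurable_blockVec (d := d) measurable_id (gameBlock R t m)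
  have h2 := measurable_blockVec (d := d) measurable_id (none : Option (Fin R × Fin M))
  have h3 : Measurable fun y : Option (Fin R × Fin M) × Fin d → ℝ => ε • blockVec id y none :=
    h2.const_smul ε
  exact (h1.add h3).const_smul γ

theorem hiddenCost_putBlock (γ ε : ℝ) {t : ℕ} (ht : t < R) (m : Fin M) {s : Fin R × Fin M}
    (hs : ((⟨t, ht⟩, m) : Fin R × Fin M) ≠ s) (y y' : Option (Fin R × Fin M) × Fin d → ℝ) :
    hiddenCost γ ε t m (putBlock (some s) y y') = hiddenCost γ ε t m y := by
  rw [hiddenCost, hiddenCost, gameBlock_of_lt ht,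
    blockVec_putBlock_of_ne _ (fun h => hs (Option.some_injective _ h)),
    blockVec_putBlock_of_ne _ (by simp)]

theorem hiddenCost_add_shiftBlocks (γ ε : ℝ) {t : ℕ} (ht : t < R) (m : Fin M) (w : Vec d)
    (y : Option (Fin R × Fin M) × Fin d → ℝ) :
    hiddenCost γ ε t m (y + shiftBlocks ε w) = hiddenCost γ ε t m y := by
  rw [hiddenCost, hiddenCost, gameBlock_of_lt ht]
  congr 1
  ext j
  simp [blockVec, shiftBlocks]
  ring

theorem hiddenCost_add_moveBlock (γ ε : ℝ) {t : ℕ} (ht : t < R) (m : Fin M) (s : Fin R × Fin M)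
    (w : Vec d) (y : Option (Fin R × Fin M) × Fin d → ℝ) :
    hiddenCost γ ε t m (y + moveBlock s w) =
      hiddenCost γ ε t m y + if ((⟨t, ht⟩, m) : Fin R × Fin M) = s then γ • w else 0 := by
  rw [hiddenCost, hiddenCost, gameBlock_of_lt ht]
  ext j
  by_cases h : ((⟨t, ht⟩, m) : Fin R × Fin M) = s
  · simp [blockVec, moveBlock, h]
    ring
  · simp [blockVec, moveBlock, h]

theorem hardCost_add_of_inner_eq_zero {G B : ℝ} {z w x : Vec d} (h : inner ℝ x w = 0) :
    hardCost G B (z + w) x = hardCost G B z x := by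
  rw [hardCost, hardCost, inner_add_left, real_inner_comm x w, h, add_zero]

variable {S : Type*} [MeasurableSpace S] (A : TwoPointAlgorithm S d M 1) (G B γ ε : ℝ) (ω : S)

/-- The queries of an algorithm against the random costs with a hidden vector. -/
def hiddenPoints (t : ℕ) (m : Fin M) (y : Option (Fin R × Fin M) × Fin d → ℝ) : Vec d × Vec d :=
  A.points (fun t m => hardCost G B (hiddenCost γ ε t m y)) ω t m

theorem measurable_hiddenPoints (t : ℕ) (m : Fin M) :
    Measurable (hiddenPoints (R := R) A G B γ ε ω t m) := by
  have hφ := fun t m => measurable_hardCost_comp (G := G) (B := B)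
    (measurable_hiddenCost (d := d) (M := M) (R := R) γ ε t m)
  unfold hiddenPoints
  exact A.measurable_points_apply hφ ω t m

/-- Queries use answers of strictly earlier steps only, so `t = s.1` is allowed, for every machine.
-/
theorem hiddenPoints_putBlock {t : ℕ} (m : Fin M) {s : Fin R × Fin M} (hs : t ≤ s.1)
    (y y' : Option (Fin R × Fin M) × Fin d → ℝ) :
    hiddenPoints A G B γ ε ω t m (putBlock (some s) y y') = hiddenPoints A G B γ ε ω t m y := by
  refine (A.points_eq_of_eq (fun r hr n => ?_) m).symm
  have hrR : r < R := by omega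
  have hne : ((⟨r, hrR⟩, n) : Fin R × Fin M) ≠ s := by
    rintro rfl
    exact absurd hs (not_le.2 hr)
  simp only [hiddenCost_putBlock γ ε hrR n hne, and_self]

theorem hiddenPoints_add_shiftBlocks {t : ℕ} (ht : t ≤ R) (m : Fin M)
    (y : Option (Fin R × Fin M) × Fin d → ℝ) (w : Vec d) :
    hiddenPoints A G B γ ε ω t m (y + shiftBlocks ε w) = hiddenPoints A G B γ ε ω t m y := by
  refine (A.points_eq_of_eq (fun r hr n => ?_) m).symm
  simp only [hiddenCost_add_shiftBlocks γ ε (hr.trans_le ht), and_self]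

/-- The block `s` is seen through its inner products with the two points queried there; a move
orthogonal to both changes no answer. -/
theorem hiddenPoints_add_moveBlock {t : ℕ} (ht : t ≤ R) (m : Fin M) (s : Fin R × Fin M)
    (y : Option (Fin R × Fin M) × Fin d → ℝ) (w : Vec d)
    (h₁ : inner ℝ (hiddenPoints A G B γ ε ω s.1 s.2 y).1 w = 0)
    (h₂ : inner ℝ (hiddenPoints A G B γ ε ω s.1 s.2 y).2 w = 0) :
    hiddenPoints A G B γ ε ω t m (y + moveBlock s w) = hiddenPoints A G B γ ε ω t m y := by
  refine (A.points_eq_of_eq (fun r hr n => ?_) m).symm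
  have hrR : r < R := hr.trans_le ht
  simp only [hiddenCost_add_moveBlock γ ε hrR]
  by_cases hs : ((⟨r, hrR⟩, n) : Fin R × Fin M) = s
  · simp only [if_pos hs]
    subst hs
    exact ⟨(hardCost_add_of_inner_eq_zero (by rw [real_inner_smul_right]
                                              exact mul_eq_zero_of_right _ h₁)).symm,
      (hardCost_add_of_inner_eq_zero (by rw [real_inner_smul_right]
                                         exact mul_eq_zero_of_right _ h₂)).symm⟩
  · simp only [if_neg hs, add_zero, and_self]

/-- No algorithm finds the hidden vector. -/
theorem neg_le_integral_inner_hiddenCost (hB : 0 ≤ B) (hγ : 0 ≤ γ) (hε : 0 ≤ ε) {t : ℕ}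
    (ht : t < R) (m : Fin M) {π : Vec d × Vec d → Vec d} (hπ : Measurable π) :
    -(γ * (ε * (ε * (2 * B / 6 * √(20 * (R * M)))))) ≤
      ∫ y, inner ℝ (hiddenCost γ ε t m y) (clip (2 * B) (π (hiddenPoints A G B γ ε ω t m y)))
        ∂(blockLaw (Option (Fin R × Fin M)) d) := by
  set u : (Option (Fin R × Fin M) × Fin d → ℝ) → Vec d := fun y =>
    clip (2 * B) (π (hiddenPoints A G B γ ε ω t m y)) with hu
  have hum : Measurable u := (measurable_clip _).comp
    (hπ.comp (measurable_hiddenPoints A G B γ ε ω t m))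
  have huC : ∀ y, ‖u y‖ ≤ 2 * B := fun y => norm_clip_le (by positivity) _
  have huL : MemLp u 2 (blockLaw (Option (Fin R × Fin M)) d) :=
    MemLp.of_bound hum.aestronglyMeasurable (2 * B) (.of_forall huC)
  have key := abs_integral_inner_hidden_le (σ := Fin R × Fin M) hum huC hε
    (fun y w => by simp only [hu, hiddenPoints_add_shiftBlocks A G B γ ε ω ht.le])
    (fun s => (s.1 : ℕ))
    (v₁ := fun s y => dir₁ (hiddenPoints A G B γ ε ω s.1 s.2 y))
    (v₂ := fun s y => dir₂ (hiddenPoints A G B γ ε ω s.1 s.2 y))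
    (fun s => measurable_dir₁.comp (measurable_hiddenPoints A G B γ ε ω s.1 s.2))
    (fun s => measurable_dir₂.comp (measurable_hiddenPoints A G B γ ε ω s.1 s.2))
    (fun s y => norm_inv_norm_smul _) (fun s y => norm_inv_norm_smul _)
    (fun s y => inner_dir₁_dir₂ _)
    (fun s s' h y y' => by simp only [hiddenPoints_putBlock A G B γ ε ω s.2 h])
    (fun s s' h y y' => by simp only [hiddenPoints_putBlock A G B γ ε ω s.2 h])
    (fun s y w h1 h2 => by
      obtain ⟨h3, h4⟩ := inner_eq_zero_of_dir h1 h2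
      simp only [hu, hiddenPoints_add_moveBlock A G B γ ε ω ht.le m s y w h3 h4])
  rw [Fintype.card_prod, Fintype.card_fin, Fintype.card_fin, Nat.cast_mul] at key
  -- The noise of the current block is independent of the current query, so only the hidden part of
  -- the cost contributes.
  have h0 := integral_inner_blockVec_eq_zero memLp_id_bumpMeasure integral_id_bumpMeasure
    (some (⟨t, ht⟩, m)) huL (fun y y' => by
      simp only [hu, hiddenPoints_putBlock A G B γ ε ω m (s := (⟨t, ht⟩, m)) le_rfl])
  have e : ∀ y, inner ℝ (hiddenCost γ ε t m y) (u y) = γ *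
      (inner ℝ (u y) (blockVec id y (some (⟨t, ht⟩, m))) +
        ε * inner ℝ (blockVec id y none) (u y)) := by
    intro y
    rw [hiddenCost, gameBlock_of_lt ht, real_inner_smul_left, inner_add_left, real_inner_smul_left,
      real_inner_comm (u y)]
  have i1 := integrable_inner_of_memLp huL (memLp_blockVec (d := d) memLp_id_bumpMeasure
    (some ((⟨t, ht⟩, m) : Fin R × Fin M)))
  have i2 := integrable_inner_of_memLp (memLp_blockVec (d := d) memLp_id_bumpMeasure
    (none : Option (Fin R × Fin M))) huL
  change _ ≤ ∫ y, inner ℝ (hiddenCost γ ε t m y) (u y) ∂(blockLaw (Option (Fin R × Fin M)) d)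
  rw [integral_congr_ae (.of_forall e)]
  rw [integral_const_mul, integral_add i1 (i2.const_mul ε), h0, zero_add, integral_const_mul,
    ← mul_neg, ← mul_neg]
  exact mul_le_mul_of_nonneg_left (mul_le_mul_of_nonneg_left (abs_le.1 key).1 hε) hγ

theorem integral_inner_hiddenCost_hidden {t : ℕ} (ht : t < R) (m : Fin M) :
    ∫ y, inner ℝ (hiddenCost γ ε t m y) (blockVec id y none)
      ∂(blockLaw (Option (Fin R × Fin M)) d) = γ * (ε * (d / 7)) := by
  have hL := memLp_blockVec (d := d) memLp_id_bumpMeasure (none : Option (Fin R × Fin M))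
  have hL' := memLp_blockVec (d := d) memLp_id_bumpMeasure
    (some ((⟨t, ht⟩, m) : Fin R × Fin M))
  have h0 := integral_inner_blockVec_eq_zero memLp_id_bumpMeasure integral_id_bumpMeasure
    (some (⟨t, ht⟩, m)) hL (fun y y' => by rw [blockVec_putBlock_of_ne _ (by simp)])
  have e : ∀ y : Option (Fin R × Fin M) × Fin d → ℝ,
      inner ℝ (hiddenCost γ ε t m y) (blockVec id y none) = γ *
      (inner ℝ (blockVec id y none) (blockVec id y (some (⟨t, ht⟩, m))) +
        ε * ∑ j, y (none, j) ^ 2) := by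
    intro y
    rw [hiddenCost, gameBlock_of_lt ht, real_inner_smul_left, inner_add_left, real_inner_smul_left,
      real_inner_comm (blockVec id y none), real_inner_self_eq_norm_sq,
      EuclideanSpace.real_norm_sq_eq]
    rfl
  have i1 := integrable_inner_of_memLp hL hL'
  have i2 : ∀ j : Fin d, Integrable (fun y : Option (Fin R × Fin M) × Fin d → ℝ => y (none, j) ^ 2)
      (blockLaw (Option (Fin R × Fin M)) d) := fun j => by
    simpa using (memLp_eval (d := d) memLp_id_bumpMeasure
      ((none : Option (Fin R × Fin M)), j)).integrable_norm_pow two_ne_zero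
  have i3 : ∀ j : Fin d, ∫ y : Option (Fin R × Fin M) × Fin d → ℝ, y (none, j) ^ 2
      ∂(blockLaw (Option (Fin R × Fin M)) d) = 1 / 7 := fun j => by
    have hm : AEStronglyMeasurable (fun w : ℝ => w ^ 2) bumpMeasure :=
      (measurable_id.pow_const 2).aestronglyMeasurable
    have := integral_comp_eval (μ := fun _ : Option (Fin R × Fin M) × Fin d => bumpMeasure)
      (i := (none, j)) hm
    exact this.trans integral_sq_bumpMeasure
  simp_rw [e]
  rw [integral_const_mul, integral_add i1 ((integrable_finsetSum _ fun j _ => i2 j).const_mul ε),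
    h0, zero_add, integral_const_mul, integral_finsetSum _ fun j _ => i2 j]
  simp only [i3]
  rw [Finset.sum_const, Finset.card_univ, Fintype.card_fin, nsmul_eq_mul, mul_one_div]

end HiddenVector

/-- The lower bound that is due to the dimension. -/
theorem exists_hard_costs_of_dim {d M R : ℕ} (hd : 1 ≤ d) (hM : 1 ≤ M) (hR : 1 ≤ R) {G B : ℝ}
    (hG : 0 < G) (hB : 0 < B) {S : Type*} [MeasurableSpace S] (Q : Measure S)
    [IsProbabilityMeasure Q] (A : TwoPointAlgorithm S d M 1) {ε : ℝ} (hε : 0 ≤ ε) (hε1 : ε ≤ 1)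
    (hεd : 21 * (ε * √((R : ℝ) * M)) ≤ √(d : ℝ)) :
    ∃ φ : ℕ → Fin M → Vec d → ℝ, (∀ t m, IsCost G (φ t m)) ∧ (∀ t m x, 0 ≤ φ t m x) ∧
      ∃ y : Vec d, IsBestInBall R B φ y ∧
        ENNReal.ofReal (G * B * ε / 56 + (1 / ((M : ℝ) * (R : ℝ))) *
          ∑ t ∈ Finset.range R, ∑ m : Fin M, φ t m y) ≤
            ∫⁻ ω, ENNReal.ofReal (A.avgCost R φ ω) ∂Q := by
  have hd' : (0 : ℝ) < d := by exact_mod_cast hd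
  set p := √(d : ℝ) with hp
  have hp0 : 0 < p := Real.sqrt_pos.2 hd'
  have ed : (d : ℝ) = p ^ 2 := (Real.sq_sqrt hd'.le).symm
  -- The blocks have norm at most `√d` and `ε ≤ 1`, so this scale keeps the cost vectors below
  -- `G/2`.
  set γ := G / (4 * p) with hγ
  have hγ0 : 0 < γ := by positivity
  refine exists_hard_costs (blockLaw (Option (Fin R × Fin M)) d) hM hR hG hB
    (Z := fun t m => hiddenCost γ ε t m) (measurable_hiddenCost γ ε)
    (V := fun y => (-(B / p)) • blockVec id y none)
    (α := γ * (ε * (ε * (2 * B / 6 * √(20 * (R * M)))))) ?_ ?_ ?_ Q A ?_ ?_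
  · filter_upwards [ae_abs_le_pi_bumpMeasure] with y hy t m
    -- This also covers `t ≥ R`, where the block is `none` by default: the cost conditions are
    -- required for all `t`.
    have h1 := norm_blockVec_id_le hy (gameBlock R t m)
    have h2 := norm_blockVec_id_le hy none
    rw [hiddenCost, norm_smul, Real.norm_of_nonneg hγ0.le]
    have h3 : ‖blockVec id y (gameBlock R t m) + ε • blockVec id y none‖ ≤ 2 * p := by
      refine (norm_add_le _ _).trans ?_
      rw [norm_smul, Real.norm_of_nonneg hε]
      nlinarith [norm_nonneg (blockVec id y none)]
    refine (mul_le_mul_of_nonneg_left h3 hγ0.le).trans_eq ?_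
    rw [hγ]; field_simp; norm_num
  · exact (measurable_blockVec measurable_id none).const_smul (-(B / p))
  · filter_upwards [ae_abs_le_pi_bumpMeasure] with y hy
    have h2 := norm_blockVec_id_le hy none
    rw [norm_smul, norm_neg, Real.norm_of_nonneg (by positivity)]
    refine (mul_le_mul_of_nonneg_left h2 (by positivity)).trans_eq ?_
    rw [← hp]; field_simp
  · intro ω t ht m
    exact ⟨neg_le_integral_inner_hiddenCost A G B γ ε ω hB.le hγ0.le hε ht m measurable_fst,
      neg_le_integral_inner_hiddenCost A G B γ ε ω hB.le hγ0.le hε ht m measurable_snd⟩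
  · intro t ht m
    simp only [real_inner_smul_right]
    rw [integral_const_mul, integral_inner_hiddenCost_hidden γ ε ht m, ed]
    -- The comparator gains `G B ε / 28`. The factor 21 in the hypothesis on `ε` limits the gain of
    -- the algorithm to `4.473/252` of `G B ε`, just under half of that, which leaves `G B ε / 56`.
    have h1 : √(20 * ((R : ℝ) * M)) ≤ 4.473 * √((R : ℝ) * M) := by
      rw [Real.sqrt_mul (by norm_num)]
      gcongr
      exact Real.sqrt_le_iff.2 ⟨by norm_num, by norm_num⟩
    have h2 : ε * √(20 * ((R : ℝ) * M)) ≤ 4.473 / 21 * p := by nlinarith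
    have h3 : γ * (ε * (ε * (2 * B / 6 * √(20 * (R * M))))) ≤
        γ * (ε * (2 * B / 6 * (4.473 / 21 * p))) := by
      have : ε * (2 * B / 6 * √(20 * (R * M))) = 2 * B / 6 * (ε * √(20 * (R * M))) := by ring
      rw [this]
      gcongr
    have h4 : γ * (ε * (2 * B / 6 * (4.473 / 21 * p))) = G * B * ε * (4.473 / 252) := by
      rw [hγ]; field_simp; ring
    have h5 : -(B / p) * (γ * (ε * (p ^ 2 / 7))) = -(G * B * ε / 28) := by
      rw [hγ]; field_simp; ring
    rw [h5]
    have h6 : 0 ≤ G * B * ε := by positivity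
    linarith

/-! ### The lower bound in terms of the horizon -/

section Horizon

/-- A random linear cost along the unit vector `e`, the same for all machines. -/
def axisCost {d : ℕ} (R : ℕ) (G : ℝ) (e : Vec d) (t : ℕ) (y : Fin R × Fin 1 → ℝ) : Vec d :=
  (G / 2 * if h : t < R then y (⟨t, h⟩, 0) else 0) • e

/-- A function of modulus at most `2` that is correlated with all coordinates. -/
def rieszProd (R : ℕ) (y : Fin R × Fin 1 → ℝ) : ℂ :=
  ∏ i, (1 + ((1 / √(R : ℝ) : ℝ) : ℂ) * Complex.I * (y i : ℂ))

theorem measurable_axisCost {d : ℕ} (R : ℕ) (G : ℝ) (e : Vec d) (t : ℕ) :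
    Measurable (axisCost R G e t) := by
  unfold axisCost
  by_cases h : t < R
  · simp only [dif_pos h]
    have h1 : Measurable fun y : Fin R × Fin 1 → ℝ => G / 2 * y (⟨t, h⟩, 0) :=
      (measurable_pi_apply _).const_mul _
    exact h1.smul_const e
  · simp only [dif_neg h]
    exact measurable_const

theorem continuous_rieszProd (R : ℕ) : Continuous (rieszProd R) := by
  unfold rieszProd
  fun_prop

theorem norm_rieszProd_le {R : ℕ} (hR : 1 ≤ R) {y : Fin R × Fin 1 → ℝ} (hy : ∀ i, |y i| ≤ 1) :
    ‖rieszProd R y‖ ≤ 2 := by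
  have hR' : (0 : ℝ) < R := by exact_mod_cast hR
  have h1 : ∀ i, ‖1 + ((1 / √(R : ℝ) : ℝ) : ℂ) * Complex.I * (y i : ℂ)‖ ^ 2 ≤
      Real.exp (1 / R) := by
    intro i
    have e : (1 : ℂ) + ((1 / √(R : ℝ) : ℝ) : ℂ) * Complex.I * (y i : ℂ) =
        ((1 : ℝ) : ℂ) + ((1 / √(R : ℝ) * y i : ℝ) : ℂ) * Complex.I := by
      push_cast; ring
    rw [e, Complex.norm_add_mul_I, Real.sq_sqrt (by positivity), mul_pow, div_pow,
      Real.sq_sqrt hR'.le]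
    have h2 : y i ^ 2 ≤ 1 := by
      rw [← sq_abs]; nlinarith [hy i, abs_nonneg (y i)]
    have h3 := Real.add_one_le_exp (1 / (R : ℝ))
    have h4 : 1 ^ 2 / (R : ℝ) * y i ^ 2 ≤ 1 / R := by
      rw [one_pow]
      exact mul_le_of_le_one_right (by positivity) h2
    linarith
  have h2 : ‖rieszProd R y‖ ^ 2 ≤ 2 ^ 2 := by
    rw [rieszProd, norm_prod, ← Finset.prod_pow]
    -- The squared modulus is at most the `R`-th power of `exp (1/R)`, that is `e`, which is below
    -- 4.
    refine (Finset.prod_le_prod (fun i _ => by positivity) fun i _ => h1 i).trans ?_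
    rw [Finset.prod_const, Finset.card_univ, Fintype.card_prod, Fintype.card_fin, Fintype.card_fin,
      mul_one, ← Real.exp_nat_mul, mul_one_div_cancel hR'.ne']
    linarith [Real.exp_one_lt_d9]
  exact (sq_le_sq₀ (norm_nonneg _) (by norm_num)).1 h2

theorem integral_mul_im_rieszProd {R : ℕ} (hR : 1 ≤ R) (i₀ : Fin R × Fin 1) :
    ∫ y, y i₀ * (rieszProd R y).im ∂(blockLaw (Fin R) 1) = 1 / (7 * √(R : ℝ)) := by
  set c : ℂ := ((1 / √(R : ℝ) : ℝ) : ℂ) * Complex.I with hc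
  have hid : Integrable (fun w : ℝ => w) bumpMeasure := memLp_id_bumpMeasure.integrable (by norm_num)
  have hsq : Integrable (fun w : ℝ => w ^ 2) bumpMeasure := by
    simpa using memLp_id_bumpMeasure.integrable_norm_pow two_ne_zero
  have hidC : Integrable (fun w : ℝ => (w : ℂ)) bumpMeasure := hid.ofReal
  have hsqC : Integrable (fun w : ℝ => ((w ^ 2 : ℝ) : ℂ)) bumpMeasure := hsq.ofReal
  have e1 : ∫ w : ℝ, (w : ℂ) ∂bumpMeasure = 0 := by
    rw [integral_complex_ofReal, integral_id_bumpMeasure, Complex.ofReal_zero]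
  have h1 : ∫ w : ℝ, (1 + c * (w : ℂ)) ∂bumpMeasure = 1 := by
    rw [integral_add (integrable_const _) (hidC.const_mul c), integral_const_mul, e1]
    simp
  have h2 : ∫ w : ℝ, (w : ℂ) * (1 + c * (w : ℂ)) ∂bumpMeasure = c / 7 := by
    have e : ∀ w : ℝ, (w : ℂ) * (1 + c * (w : ℂ)) = (w : ℂ) + c * ((w ^ 2 : ℝ) : ℂ) := fun w => by
      push_cast; ring
    simp_rw [e]
    rw [integral_add hidC (hsqC.const_mul c), integral_const_mul, e1, integral_complex_ofReal,
      integral_sq_bumpMeasure]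
    push_cast
    ring
  have h3 : ∫ y : Fin R × Fin 1 → ℝ, (y i₀ : ℂ) * rieszProd R y ∂(blockLaw (Fin R) 1) = c / 7 := by
    -- By independence, every factor except that of `i₀` integrates to 1, and this one to the
    -- variance `1/7` times the imaginary coefficient.
    have e : ∀ y : Fin R × Fin 1 → ℝ, (y i₀ : ℂ) * rieszProd R y =
        ∏ i, (if i = i₀ then (y i : ℂ) * (1 + c * (y i : ℂ)) else 1 + c * (y i : ℂ)) := by
      intro y
      rw [rieszProd, ← Finset.mul_prod_erase Finset.univ _ (Finset.mem_univ i₀),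
        ← Finset.mul_prod_erase Finset.univ (fun i => if i = i₀ then _ else _) (Finset.mem_univ i₀),
        if_pos rfl, ← mul_assoc]
      congr 1
      exact Finset.prod_congr rfl fun i hi => by rw [if_neg (Finset.ne_of_mem_erase hi)]
    simp_rw [e]
    rw [integral_fintype_prod_eq_prod (fun (i : Fin R × Fin 1) (w : ℝ) =>
      if i = i₀ then (w : ℂ) * (1 + c * (w : ℂ)) else 1 + c * (w : ℂ)),
      Finset.prod_eq_single i₀]
    · simp only [if_true]
      exact h2
    · intro i _ hi
      simp only [if_neg hi]
      exact h1
    · simp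
  have hint : Integrable (fun y : Fin R × Fin 1 → ℝ => (y i₀ : ℂ) * rieszProd R y)
      (blockLaw (Fin R) 1) := by
    refine Integrable.of_bound (C := 2) (Continuous.aestronglyMeasurable ?_) ?_
    · exact (Complex.continuous_ofReal.comp (continuous_apply i₀)).mul (continuous_rieszProd R)
    · filter_upwards [ae_abs_le_pi_bumpMeasure] with y hy
      rw [norm_mul, Complex.norm_real, Real.norm_eq_abs]
      nlinarith [hy i₀, norm_rieszProd_le hR hy, norm_nonneg (rieszProd R y), abs_nonneg (y i₀)]
  have h4 := Complex.imCLM.integral_comp_comm hint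
  rw [h3] at h4
  have e5 : ∀ y : Fin R × Fin 1 → ℝ, y i₀ * (rieszProd R y).im =
      Complex.imCLM ((y i₀ : ℂ) * rieszProd R y) := fun y => by
    rw [Complex.imCLM_apply, Complex.im_ofReal_mul]
  simp_rw [e5]
  rw [h4, hc, Complex.imCLM_apply]
  have e6 : ((1 / √(R : ℝ) : ℝ) : ℂ) * Complex.I / 7 =
      ((1 / (7 * √(R : ℝ)) : ℝ) : ℂ) * Complex.I := by
    push_cast
    field_simp
  rw [e6]
  simp only [Complex.im_ofReal_mul, Complex.I_im, mul_one]

/-- The lower bound that is due to the horizon. -/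
theorem exists_hard_costs_of_horizon {d M R : ℕ} (hd : 1 ≤ d) (hM : 1 ≤ M) (hR : 1 ≤ R) {G B : ℝ}
    (hG : 0 < G) (hB : 0 < B) {S : Type*} [MeasurableSpace S] (Q : Measure S)
    [IsProbabilityMeasure Q] (A : TwoPointAlgorithm S d M 1) :
    ∃ φ : ℕ → Fin M → Vec d → ℝ, (∀ t m, IsCost G (φ t m)) ∧ (∀ t m x, 0 ≤ φ t m x) ∧
      ∃ y : Vec d, IsBestInBall R B φ y ∧
        ENNReal.ofReal (G * B / (28 * √(R : ℝ)) + (1 / ((M : ℝ) * (R : ℝ))) *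
          ∑ t ∈ Finset.range R, ∑ m : Fin M, φ t m y) ≤
            ∫⁻ ω, ENNReal.ofReal (A.avgCost R φ ω) ∂Q := by
  set e : Vec d := EuclideanSpace.single ⟨0, hd⟩ 1 with he
  have hen : ‖e‖ = 1 := by simp [he]
  have hee : inner ℝ e e = (1 : ℝ) := by rw [real_inner_self_eq_norm_sq, hen, one_pow]
  have hZm : ∀ t, Measurable (axisCost R G e t) := measurable_axisCost R G e
  refine exists_hard_costs (blockLaw (Fin R) 1) hM hR hG hB
    (Z := fun t (_ : Fin M) => axisCost R G e t) (fun t _ => hZm t)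
    (V := fun y => (-(B / 2) * (rieszProd R y).im) • e) (α := 0) ?_ ?_ ?_ Q A ?_ ?_
  · filter_upwards [ae_abs_le_pi_bumpMeasure] with y hy t m
    rw [axisCost, norm_smul, hen, mul_one, norm_mul, Real.norm_of_nonneg (by positivity)]
    refine mul_le_of_le_one_right (by positivity) ?_
    split_ifs
    · exact hy _
    · simp
  · exact (((Complex.measurable_im.comp (continuous_rieszProd R).measurable).const_mul
      (-(B / 2))).smul_const e)
  · filter_upwards [ae_abs_le_pi_bumpMeasure] with y hy
    rw [norm_smul, hen, mul_one, norm_mul, norm_neg, Real.norm_of_nonneg (by positivity)]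
    have h1 := (Complex.abs_im_le_norm (rieszProd R y)).trans (norm_rieszProd_le hR hy)
    rw [Real.norm_eq_abs]
    nlinarith
  · intro ω t ht m
    set X : (Fin R × Fin 1 → ℝ) → Vec d × Vec d := fun y =>
      A.points (fun t (_ : Fin M) => hardCost G B (axisCost R G e t y)) ω t m with hX
    have hXm : Measurable X :=
      A.measurable_points_apply (fun t _ => measurable_hardCost_comp (hZm t)) ω t m
    -- The queries at step `t` do not depend on the coefficient of that step, so the expected linear
    -- loss of the algorithm is zero.
    have hXp : ∀ y y', X (putBlock ⟨t, ht⟩ y y') = X y := by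
      intro y y'
      refine (A.points_eq_of_eq (fun r hr n => ?_) m).symm
      have h1 : axisCost R G e r (putBlock ⟨t, ht⟩ y y') = axisCost R G e r y := by
        rw [axisCost, axisCost, dif_pos (hr.trans ht), dif_pos (hr.trans ht), putBlock,
          if_neg (by simpa using hr.ne)]
      rw [h1]
      exact ⟨rfl, rfl⟩
    have hzero : ∀ π : Vec d × Vec d → Vec d, Measurable π →
        ∫ y, inner ℝ (axisCost R G e t y) (clip (2 * B) (π (X y))) ∂(blockLaw (Fin R) 1) = 0 := by
      intro π hπ
      set g : (Fin R × Fin 1 → ℝ) → ℝ := fun y => inner ℝ e (clip (2 * B) (π (X y))) with hg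
      have hgm : Measurable g := measurable_const.inner ((measurable_clip _).comp (hπ.comp hXm))
      have hgb : ∀ y, |g y| ≤ 2 * B := fun y =>
        (abs_real_inner_le_norm _ _).trans (by
          rw [hen, one_mul]; exact norm_clip_le (by positivity) _)
      have hVm : Measurable fun y => EuclideanSpace.single (0 : Fin 1) (g y) :=
        (WithLp.measurable_toLp 2 _).comp (measurable_pi_iff.2 fun j => by
          rw [Subsingleton.elim j 0]
          simpa using hgm)
      have hVL : MemLp (fun y => EuclideanSpace.single (0 : Fin 1) (g y)) 2 (blockLaw (Fin R) 1) :=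
        MemLp.of_bound hVm.aestronglyMeasurable (2 * B) (.of_forall fun y => by
          simpa using hgb y)
      have key := integral_inner_blockVec_eq_zero memLp_id_bumpMeasure integral_id_bumpMeasure
        (⟨t, ht⟩ : Fin R) hVL (fun y y' => by simp only [hg, hXp])
      have h1 : ∀ y : Fin R × Fin 1 → ℝ, inner ℝ (axisCost R G e t y) (clip (2 * B) (π (X y))) =
          G / 2 * inner ℝ (EuclideanSpace.single (0 : Fin 1) (g y))
            (blockVec id y (⟨t, ht⟩ : Fin R)) := by
        intro y
        rw [inner_blockVec, axisCost, dif_pos ht, real_inner_smul_left]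
        simp [hg]
        ring
      rw [integral_congr_ae (.of_forall h1), integral_const_mul, key, mul_zero]
    rw [neg_zero]
    exact ⟨(hzero _ measurable_fst).ge, (hzero _ measurable_snd).ge⟩
  · intro t ht m
    have h1 : ∀ y : Fin R × Fin 1 → ℝ, inner ℝ (axisCost R G e t y)
        ((-(B / 2) * (rieszProd R y).im) • e) =
        -(G * B / 4) * (y (⟨t, ht⟩, 0) * (rieszProd R y).im) := by
      intro y
      rw [axisCost, dif_pos ht, real_inner_smul_left, real_inner_smul_right, hee]
      ring
    rw [integral_congr_ae (.of_forall h1), integral_const_mul, integral_mul_im_rieszProd hR]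
    refine le_of_eq ?_
    field_simp
    ring

end Horizon

/-- The rate is at most twice its larger term: the horizon term if `d ≤ M`, the dimension term
otherwise. The constant is `1/(2 · 21 · 56)`, from the second case. -/
theorem exists_hard_costs_of_fedRate {d M R : ℕ} (hd : 1 ≤ d) (hM : 1 ≤ M) (hR : 1 ≤ R) {G B : ℝ}
    (hG : 0 < G) (hB : 0 < B) {S : Type*} [MeasurableSpace S] (Q : Measure S)
    [IsProbabilityMeasure Q] (A : TwoPointAlgorithm S d M 1) :
    ∃ φ : ℕ → Fin M → Vec d → ℝ, (∀ t m, IsCost G (φ t m)) ∧ (∀ t m x, 0 ≤ φ t m x) ∧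
      ∃ y : Vec d, IsBestInBall R B φ y ∧
        ENNReal.ofReal (1 / 2352 * min (G * B) (fedRate G B d M 1 R) +
          (1 / ((M : ℝ) * (R : ℝ))) * ∑ t ∈ Finset.range R, ∑ m : Fin M, φ t m y) ≤
            ∫⁻ ω, ENNReal.ofReal (A.avgCost R φ ω) ∂Q := by
  have hd' : (0 : ℝ) < d := by exact_mod_cast hd
  have hM' : (0 : ℝ) < M := by exact_mod_cast hM
  have hR' : (0 : ℝ) < R := by exact_mod_cast hR
  have hrate : fedRate G B d M 1 R =
      G * B / √(R : ℝ) + G * B / √(R : ℝ) * (√(d : ℝ) / √(M : ℝ)) := by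
    rw [fedRate, if_neg (lt_irrefl 1), Nat.cast_one, one_mul, mul_one, add_zero,
      Real.sqrt_mul hM'.le]
    field_simp
  set p := √(d : ℝ)
  set q := √(M : ℝ)
  set r := √(R : ℝ) with hr
  have hp : 0 < p := Real.sqrt_pos.2 hd'
  have hq : 0 < q := Real.sqrt_pos.2 hM'
  have hr0 : 0 < r := Real.sqrt_pos.2 hR'
  have hGB : 0 < G * B := by positivity
  have hGr : 0 < G * B / r := by positivity
  suffices h : ∃ gap, 1 / 2352 * min (G * B) (fedRate G B d M 1 R) ≤ gap ∧
      ∃ φ : ℕ → Fin M → Vec d → ℝ, (∀ t m, IsCost G (φ t m)) ∧ (∀ t m x, 0 ≤ φ t m x) ∧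
      ∃ y : Vec d, IsBestInBall R B φ y ∧
        ENNReal.ofReal (gap + (1 / ((M : ℝ) * (R : ℝ))) *
          ∑ t ∈ Finset.range R, ∑ m : Fin M, φ t m y) ≤
            ∫⁻ ω, ENNReal.ofReal (A.avgCost R φ ω) ∂Q by
    obtain ⟨gap, hgap, φ, h1, h2, y, hy, h3⟩ := h
    exact ⟨φ, h1, h2, y, hy, (ENNReal.ofReal_le_ofReal (by linarith)).trans h3⟩
  rcases le_or_gt p q with h | h
  · refine ⟨_, ?_, exists_hard_costs_of_horizon hd hM hR hG hB Q A⟩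
    have h1 : p / q ≤ 1 := (div_le_one hq).2 h
    have h2 : min (G * B) (fedRate G B d M 1 R) ≤ 2 * (G * B / r) := by
      refine (min_le_right _ _).trans ?_
      rw [hrate]
      nlinarith
    have h3 : G * B / (28 * r) = G * B / r / 28 := by field_simp
    rw [← hr, h3]
    linarith
  · set x := p / (q * r) with hx
    have hx0 : 0 < x := by positivity
    have h1 : min (G * B) (fedRate G B d M 1 R) ≤ 2 * (G * B * min 1 x) := by
      have h2 : 1 ≤ p / q := (one_le_div hq).2 h.le
      have h3 : fedRate G B d M 1 R ≤ 2 * (G * B * x) := by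
        have : G * B * x = G * B / r * (p / q) := by rw [hx]; field_simp
        rw [hrate, this]
        nlinarith
      rcases min_choice 1 x with h4 | h4 <;> rw [h4]
      · exact (min_le_left _ _).trans (by linarith)
      · exact (min_le_right _ _).trans h3
    have hm0 : 0 < min 1 x := lt_min one_pos hx0
    -- Up to the cap at 1, the largest strength of the hidden vector that the hypothesis on `ε`
    -- allows; the cap is the source of `G B` in the minimum.
    refine ⟨_, ?_, exists_hard_costs_of_dim hd hM hR hG hB Q A (ε := min 1 x / 21) (by positivity)
      (by linarith [min_le_left 1 x]) ?_⟩
    · linarith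
    · rw [Real.sqrt_mul hR'.le]
      have h2 : min 1 x * (r * q) ≤ x * (r * q) :=
        mul_le_mul_of_nonneg_right (min_le_right _ _) (by positivity)
      have h3 : x * (r * q) = p := by rw [hx]; field_simp
      linarith

end

theorem mainTheorem12 :
    -- the regret of FedOSGD
    (∃ c : ℝ, 0 < c ∧ ∀ (d M K R : ℕ), 1 ≤ d → 1 ≤ M → 1 ≤ K → 1 ≤ R →
      ∀ (G B δ : ℝ), 0 < G → 0 < B → 0 < δ → G * δ ≤ fedRate G B d M K R →
      ∀ (Ω : Type*) [MeasurableSpace Ω] (P : Measure Ω) [IsProbabilityMeasure P]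
        (f : ℕ → Fin M → Ω → Vec d → ℝ) (u : ℕ → Fin M → Ω → Vec d),
        IsAdaptiveGame P G (K * R) f u →
        ∀ xstar : Ω → Vec d,
          (∀ ω, IsBestInBall (K * R) B (fun t m => f t m ω) (xstar ω)) →
          Integrable (fun ω => avgRegret (K * R) δ (fun t m => f t m ω) (fun t m => u t m ω)
            (fedIterate K (fedStep G B d M K R) δ (fun t m => f t m ω) (fun t m => u t m ω))
            (xstar ω)) P ∧
          ∫ ω, avgRegret (K * R) δ (fun t m => f t m ω) (fun t m => u t m ω)
            (fedIterate K (fedStep G B d M K R) δ (fun t m => f t m ω) (fun t m => u t m ω))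
            (xstar ω) ∂P ≤ c * fedRate G B d M K R) ∧
    -- optimality for `K = 1`: no randomized algorithm does better against all admissible costs
    (∃ c : ℝ, 0 < c ∧ ∀ (d M R : ℕ), 1 ≤ d → 1 ≤ M → 1 ≤ R →
      ∀ (G B : ℝ), 0 < G → 0 < B →
      ∀ (S : Type*) [MeasurableSpace S] (Q : Measure S) [IsProbabilityMeasure Q]
        (A : TwoPointAlgorithm S d M 1),
        ∃ φ : ℕ → Fin M → Vec d → ℝ, (∀ t m, IsCost G (φ t m)) ∧ (∀ t m x, 0 ≤ φ t m x) ∧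
          ∃ y : Vec d, IsBestInBall R B φ y ∧
            ENNReal.ofReal (c * min (G * B) (fedRate G B d M 1 R) +
                (1 / ((M : ℝ) * (R : ℝ))) * ∑ t ∈ Finset.range R, ∑ m : Fin M, φ t m y) ≤
              ∫⁻ ω, ENNReal.ofReal (A.avgCost R φ ω) ∂Q) ∧
    -- the guarantee of the non-collaborative baseline
    (∃ c : ℝ, 0 < c ∧ ∀ (d M T : ℕ), 1 ≤ d → 1 ≤ M → 1 ≤ T →
      ∀ (G B δ : ℝ), 0 < G → 0 < B → 0 < δ → G * δ ≤ ncRate G B d T →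
      ∀ (Ω : Type*) [MeasurableSpace Ω] (P : Measure Ω) [IsProbabilityMeasure P]
        (f : ℕ → Fin M → Ω → Vec d → ℝ) (u : ℕ → Fin M → Ω → Vec d),
        IsAdaptiveGame P G T f u →
        ∀ xstar : Ω → Vec d,
          (∀ ω, IsBestInBall T B (fun t m => f t m ω) (xstar ω)) →
          Integrable (fun ω => avgRegret T δ (fun t m => f t m ω) (fun t m => u t m ω)
            (ncIterate (B / (G * √((d : ℝ) * T))) δ (fun t m => f t m ω) (fun t m => u t m ω))
            (xstar ω)) P ∧
          ∫ ω, avgRegret T δ (fun t m => f t m ω) (fun t m => u t m ω)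
            (ncIterate (B / (G * √((d : ℝ) * T))) δ (fun t m => f t m ω) (fun t m => u t m ω))
            (xstar ω) ∂P ≤ c * ncRate G B d T) ∧
    -- comparison with the baseline when `d` is at least of the order of `K²`
    (∀ a : ℝ, 0 < a → ∀ (d M K R : ℕ), 1 ≤ d → 1 ≤ M → 1 ≤ K → 1 ≤ R →
      ∀ (G B : ℝ), 0 < G → 0 < B → (K : ℝ) ^ 2 ≤ a * d →
        fedRate G B d M K R ≤
          (1 / √(d : ℝ) + 1 / √(M : ℝ) + a ^ (1 / 4 : ℝ)) * ncRate G B d (K * R)) := by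
  refine ⟨⟨50, by norm_num, ?_⟩, ?_, ⟨50, by norm_num, ?_⟩, ?_⟩
  · intro d M K R hd hM hK hR G B δ hG hB hδ hδ' Ω _ P _ f u hg y hy
    exact ⟨hg.integrable_avgRegret hG.le hδ K _ hB.le hy,
      hg.fed_regret_le hd hM hK hR rfl hG hB hδ hδ' hy⟩
  · exact ⟨1 / 2352, by norm_num, fun d M R hd hM hR G B hG hB S _ Q _ A =>
      exists_hard_costs_of_fedRate hd hM hR hG hB Q A⟩
  · intro d M T hd hM hT G B δ hG hB hδ hδ' Ω _ P _ f u hg y hy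
    simp only [ncIterate_eq_fedIterate]
    exact ⟨hg.integrable_avgRegret hG.le hδ 0 _ hB.le hy,
      hg.nc_regret_le hd hM hT hG hB hδ hδ' hy⟩
  · intro a ha d M K R hd hM hK hR G B hG hB h
    exact fedRate_le_ncRate ha hd hM hK hR hG hB h
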